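/- **Theorem (Consistency of the mass conserving mixed stress method).** Let $d\in\{2,3\}$, let $\Omega\subset\mathbb R^d$ be a bounded domain with Lipschitz boundary $\Gamma$, and let $\mathcal T_h$ be a (finite, conforming) triangulation of $\Omega$ into triangles ($d=2$) or tetrahedra ($d=3$), with set of facets $\mathcal F_h$ (element interfaces and boundary facets). Let $k\ge 1$, $\nu>0$ and $f\in L^2(\Omega,\mathbb R^d)$. Write $\operatorname{dev}\tau=\tau-\tfrac1d\operatorname{tr}(\tau)\,\mathrm{Id}$, $\tau:\rho=\sum_{i,j}\tau_{ij}\rho_{ij}$, let $(\cdot,\cdot)$ be the $L^2(\Omega)$ inner products, and let $\nabla$, $\operatorname{div}$ of a vector, resp. matrix, field be taken row-wise. Each facet carries a fixed unit normal $n$ (pointing out of $\Omega$ on $\Gamma$); $[\![\cdot]\!]$ is the difference of the two one-sided traces on an interior facet (the value from the element that $n$ points out of, minus the other value) and the trace itself on a boundary facet; and $v_n=v\cdot n$, $\tau_{nn}=n^{\mathrm T}\tau n$, $\tau_{nt}=\tau n-\tau_{nn}n$. Let $\mathbb P^k(\mathcal T_h)$ denote the functions that are polynomials of degree at most $k$ on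 each element, $H_0(\operatorname{div},\Omega)=\{v\in L^2(\Omega,\mathbb R^d):\operatorname{div}v\in L^2(\Omega),\ v\cdot n=0\text{ on }\Gamma\}$, $L^2_0(\Omega)=\{q\in L^2(\Omega):\int_\Omega q=0\}$, and $$\Sigma_h=\{\tau\in\mathbb P^k(\mathcal T_h,\mathbb R^{d\times d}):\ \operatorname{tr}\tau=0,\ [\![\tau_{nt}]\!]=0\text{ on interior facets},\ \tau_{nt}|_F\text{ is a polynomial of degree at most }k-1\text{ for every }F\in\mathcal F_h\},$$ $$V_h=\mathbb P^k(\mathcal T_h,\mathbb R^d)\cap H_0(\operatorname{div},\Omega),\qquad Q_h=\mathbb P^{k-1}(\mathcal T_h)\cap L^2_0(\Omega).$$ Define $$a(\sigma,\tau)=(\nu^{-1}\operatorname{dev}\sigma,\operatorname{dev}\tau),\qquad b_1(v,q)=(\operatorname{div}v,q),$$ $$b_2(\tau,v)=\sum_{T\in\mathcal T_h}\int_T\operatorname{div}(\tau)\cdot v\,dx-\sum_{F\in\mathcal F_h}\int_F[\![\tau_{nn}]\!]\,v_n\,ds .$$ Suppose that $(\sigma,u,p)$ is an exact solution of the mixed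 Stokes problem $$\tfrac1\nu\operatorname{dev}\sigma-\nabla u=0,\qquad \operatorname{div}\sigma-\nabla p=-f,\qquad \operatorname{div}u=0\quad\text{in }\Omega,\qquad u=0\quad\text{on }\Gamma,$$ (the differential equations holding in the sense of distributions), such that $u\in H^1(\Omega,\mathbb R^d)$, $\sigma\in H^1(\Omega,\mathbb R^{d\times d})$ and $p\in L^2_0(\Omega)$. Then $$a(\sigma,\tau_h)+b_2(\tau_h,u)+b_2(\sigma,v_h)+b_1(v_h,p)+b_1(u,q_h)=-(f,v_h)$$ for all $\tau_h\in\Sigma_h$, $v_h\in V_h$ and $q_h\in Q_h$. -/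

import Mathlib

open MeasureTheory Filter Topology
open scoped ContDiff InnerProductSpace

noncomputable section

namespace MCS

/-- Euclidean space `ℝ^d`. -/
abbrev Eu (d : ℕ) : Type := EuclideanSpace ℝ (Fin d)

/-- Real `d × d` matrices. -/
abbrev Mat (d : ℕ) : Type := Matrix (Fin d) (Fin d) ℝ

variable {d : ℕ}

/-! ### Domains -/

/-- A bounded domain (open, connected, non-empty) with Lipschitz boundary: near every boundary point
the domain is, in suitable orthonormal coordinates, the strict epigraph of a Lipschitz function.
Here `e` is the direction of the last coordinate, and `γ` is a function of the others. -/
structure IsLipschitzDomain (Ω : Set (Eu d)) : Prop where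
  isOpen : IsOpen Ω
  isBounded : Bornology.IsBounded Ω
  isConnected : IsConnected Ω
  lipschitz : ∀ x ∈ frontier Ω, ∃ (e : Eu d) (γ : Eu d → ℝ) (L : NNReal) (r : ℝ),
    ‖e‖ = 1 ∧ LipschitzWith L γ ∧ (∀ (y : Eu d) (t : ℝ), γ (y + t • e) = γ y) ∧ 0 < r ∧
      ∀ y ∈ Metric.ball x r, (y ∈ Ω ↔ γ y < ⟪e, y⟫_ℝ)

/-! ### Weak derivatives and Sobolev spaces -/

/-- Scalar test functions, the elements of `𝒟(U)`. -/
def IsTest (U : Set (Eu d)) (φ : Eu d → ℝ) : Prop :=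
  ContDiff ℝ ∞ φ ∧ HasCompactSupport φ ∧ tsupport φ ⊆ U

/-- `G` is the distributional gradient of the scalar function `w` on `U`. -/
def IsWeakGrad (U : Set (Eu d)) (w : Eu d → ℝ) (G : Eu d → Eu d) : Prop :=
  ∀ φ, IsTest U φ → ∀ i : Fin d,
    ∫ x in U, w x * gradient φ x i = -∫ x in U, G x i * φ x

/-- `g` is the distributional divergence of the vector field `v` on `U`. -/
def IsWeakDiv (U : Set (Eu d)) (v : Eu d → Eu d) (g : Eu d → ℝ) : Prop :=
  ∀ φ, IsTest U φ → ∫ x in U, ⟪v x, gradient φ x⟫_ℝ = -∫ x in U, g x * φ x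

/-- `w ∈ H¹(U)`, with weak gradient `G`. -/
def IsH1Grad (U : Set (Eu d)) (w : Eu d → ℝ) (G : Eu d → Eu d) : Prop :=
  MemLp w 2 (volume.restrict U) ∧ MemLp G 2 (volume.restrict U) ∧ IsWeakGrad U w G

/-- `w ∈ H¹(U)`. -/
def MemH1 (U : Set (Eu d)) (w : Eu d → ℝ) : Prop := ∃ G, IsH1Grad U w G

/-- `φ n` converges to `w` in `H¹(U)`, for smooth `φ n`. -/
def TendstoH1 (U : Set (Eu d)) (φ : ℕ → Eu d → ℝ) (w : Eu d → ℝ) : Prop :=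
  ∃ G, IsH1Grad U w G ∧
    Tendsto (fun n => eLpNorm (fun x => φ n x - w x) 2 (volume.restrict U)) atTop (𝓝 0) ∧
    Tendsto (fun n => eLpNorm (fun x => gradient (φ n) x - G x) 2 (volume.restrict U)) atTop (𝓝 0)

/-- `w ∈ H¹₀(U)`, the closure of the test functions in `H¹(U)`. -/
def MemH10 (U : Set (Eu d)) (w : Eu d → ℝ) : Prop :=
  ∃ φ : ℕ → Eu d → ℝ, (∀ n, IsTest U (φ n)) ∧ TendstoH1 U φ w

/-- `v ∈ H(div, U)`. -/
def MemHDiv (U : Set (Eu d)) (v : Eu d → Eu d) : Prop :=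
  MemLp v 2 (volume.restrict U) ∧
    ∃ g, MemLp g 2 (volume.restrict U) ∧ IsWeakDiv U v g

open Classical in
/-- The divergence of a vector field whose distributional divergence lies in `L²(U)`
(unique up to a null set). -/
def weakDiv (U : Set (Eu d)) (v : Eu d → Eu d) : Eu d → ℝ :=
  if h : ∃ g, MemLp g 2 (volume.restrict U) ∧ IsWeakDiv U v g then h.choose else 0

/-- `v ∈ H₀(div, Ω)`, i.e. `v ∈ H(div, Ω)` and `v · n = 0` on the boundary, where
`v · n ∈ H^{-1/2}(∂Ω)` is the functional `φ ↦ (v, ∇φ) + (div v, φ)`, `φ ∈ H¹(Ω)`. -/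
def MemHDiv0 (Ω : Set (Eu d)) (v : Eu d → Eu d) : Prop :=
  MemHDiv Ω v ∧ ∀ φ G, IsH1Grad Ω φ G →
    (∫ x in Ω, ⟪v x, G x⟫_ℝ) + ∫ x in Ω, weakDiv Ω v x * φ x = 0

/-- `q ∈ L²₀(Ω)`. -/
def MemL20 (Ω : Set (Eu d)) (q : Eu d → ℝ) : Prop :=
  MemLp q 2 (volume.restrict Ω) ∧ ∫ x in Ω, q x = 0

/-! ### Matrices -/

/-- The deviatoric part of a matrix. -/
def dev (A : Mat d) : Mat d := A - (A.trace / d) • (1 : Mat d)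

/-- The Frobenius product `A : B`. -/
def frob (A B : Mat d) : ℝ := ∑ i, ∑ j, A i j * B i j

/-- The `i`-th row of a matrix field, as a vector field. -/
def row (τ : Eu d → Mat d) (i : Fin d) : Eu d → Eu d := fun x => WithLp.toLp 2 (τ x i)

/-- The row-wise divergence of a matrix field on `U`. -/
def matDiv (U : Set (Eu d)) (τ : Eu d → Mat d) : Eu d → Eu d :=
  fun x => WithLp.toLp 2 fun i => weakDiv U (row τ i) x

/-- The product `A n`. -/
def mulV (A : Mat d) (n : Eu d) : Eu d := WithLp.toLp 2 (A.mulVec n)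

/-- The normal-normal component `nᵀ A n`. -/
def nn (n : Eu d) (A : Mat d) : ℝ := ⟪n, mulV A n⟫_ℝ

/-- The normal-tangential component `A n - (nᵀ A n) n`. -/
def nt (n : Eu d) (A : Mat d) : Eu d := mulV A n - nn n A • n

/-! ### Triangulations -/

/-- A triangulation of `Ω`: a finite simplicial complex (triangles, resp. tetrahedra, with their
faces) whose underlying space is the closure of `Ω`. Each facet `F` comes with an adjacent element
`plus F`, which fixes its unit normal: the one pointing out of `plus F`. -/
structure Mesh (Ω : Set (Eu d)) where
  K : Geometry.SimplicialComplex ℝ (Eu d)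
  finite : K.faces.Finite
  space_eq : K.space = closure Ω
  plus : Finset (Eu d) → Finset (Eu d)
  plus_spec : ∀ F ∈ K.faces, F.card = d →
    plus F ∈ K.faces ∧ (plus F).card = d + 1 ∧ F ⊆ plus F

/-- The closed simplex with vertex set `s`. -/
def hull (s : Finset (Eu d)) : Set (Eu d) := convexHull ℝ (s : Set (Eu d))

/-- The open simplex with vertex set `s` (for `s` with `d + 1` elements). -/
def openHull (s : Finset (Eu d)) : Set (Eu d) := interior (hull s)

/-- The surface measure (normalised `(d-1)`-dimensional Hausdorff measure) of the facet with vertex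
set `F`. -/
def surf (F : Finset (Eu d)) : Measure (Eu d) :=
  (Measure.euclideanHausdorffMeasure (d - 1)).restrict (hull F)

/-- `n` is the unit normal of the facet `F` of the simplex `s` that points out of `s`. -/
def IsOuterNormal (s F : Finset (Eu d)) (n : Eu d) : Prop :=
  ‖n‖ = 1 ∧ (∀ x ∈ F, ∀ y ∈ F, ⟪n, y - x⟫_ℝ = 0) ∧ ∀ x ∈ F, ∀ y ∈ s, ⟪n, y - x⟫_ℝ ≤ 0

open Classical in
/-- The outward unit normal of the simplex `s` on its facet `F`. -/
def outerNormal (s F : Finset (Eu d)) : Eu d :=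
  if h : ∃ n, IsOuterNormal s F n then h.choose else 0

/-- `g ∈ L²(F)` is the trace on the facet `F` of the function `w ∈ H¹(s)` on the simplex `s`:
the value at `w` of the continuous extension of the restriction map `φ ↦ φ|F` from smooth
functions to `H¹`. -/
def IsTrace (s F : Finset (Eu d)) (w g : Eu d → ℝ) : Prop :=
  MemLp g 2 (surf F) ∧ ∃ φ : ℕ → Eu d → ℝ, (∀ n, ContDiff ℝ ∞ (φ n)) ∧
    TendstoH1 (openHull s) φ w ∧
    Tendsto (fun n => eLpNorm (fun x => φ n x - g x) 2 (surf F)) atTop (𝓝 0)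

open Classical in
/-- The trace of `w ∈ H¹(s)` on the facet `F` of `s` (unique up to a null set of `F`). -/
def trace (s F : Finset (Eu d)) (w : Eu d → ℝ) : Eu d → ℝ :=
  if h : ∃ g, IsTrace s F w g then h.choose else 0

/-- The trace of a vector field. -/
def traceV (s F : Finset (Eu d)) (v : Eu d → Eu d) : Eu d → Eu d :=
  fun x => WithLp.toLp 2 fun i => trace s F (fun y => v y i) x

/-- The trace of a matrix field. -/
def traceM (s F : Finset (Eu d)) (τ : Eu d → Mat d) : Eu d → Mat d :=
  fun x i j => trace s F (fun y => τ y i j) x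

namespace Mesh

variable {Ω : Set (Eu d)} (M : Mesh Ω)

open Classical in
/-- The elements of the triangulation. -/
def elements : Finset (Finset (Eu d)) := M.finite.toFinset.filter fun s => s.card = d + 1

open Classical in
/-- The facets of the triangulation (element interfaces and boundary facets). -/
def facets : Finset (Finset (Eu d)) := M.finite.toFinset.filter fun s => s.card = d

/-- The facets that do not lie on the boundary of `Ω`. -/
def IsInteriorFacet (F : Finset (Eu d)) : Prop := F ∈ M.facets ∧ ¬ hull F ⊆ frontier Ω

/-- The fixed unit normal of a facet; it points out of `Ω` on boundary facets. -/
def normal (F : Finset (Eu d)) : Eu d := outerNormal (M.plus F) F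

open Classical in
/-- The jump across the facet `F` of a quantity `w` with value `w s` on the side of the element `s`:
the difference of the two values on an interior facet, the value itself on a boundary facet. -/
def jump {X : Type*} [AddCommGroup X] (F : Finset (Eu d)) (w : Finset (Eu d) → X) : X :=
  w (M.plus F) - ∑ s ∈ M.elements.filter fun s => F ⊆ s ∧ s ≠ M.plus F, w s

/-- The jump of the normal-normal component of a matrix field. -/
def jumpNN (τ : Eu d → Mat d) (F : Finset (Eu d)) (x : Eu d) : ℝ :=
  M.jump F fun s => nn (M.normal F) (traceM s F τ x)

/-- The jump of the normal-tangential component of a matrix field. -/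
def jumpNT (τ : Eu d → Mat d) (F : Finset (Eu d)) (x : Eu d) : Eu d :=
  M.jump F fun s => nt (M.normal F) (traceM s F τ x)

/-- The normal component on the facet `F` of a vector field with continuous normal component. -/
def normalTrace (v : Eu d → Eu d) (F : Finset (Eu d)) (x : Eu d) : ℝ :=
  ⟪traceV (M.plus F) F v x, M.normal F⟫_ℝ

end Mesh

/-! ### The discrete spaces -/

/-- The value at `x` of a polynomial in the coordinates. -/
def polyEval (p : MvPolynomial (Fin d) ℝ) (x : Eu d) : ℝ := MvPolynomial.eval (fun i => x i) p

/-- `w ∈ ℙᵏ(𝒯_h)`: on each open element, `w` is a polynomial of degree at most `k`. -/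
def IsPiecewisePoly {Ω : Set (Eu d)} (M : Mesh Ω) (k : ℕ) (w : Eu d → ℝ) : Prop :=
  ∀ s ∈ M.elements, ∃ p : MvPolynomial (Fin d) ℝ, p.totalDegree ≤ k ∧
    ∀ x ∈ openHull s, w x = polyEval p x

/-- The stress space `Σ_h`: trace-free matrix fields, piecewise polynomial of degree at most `k`,
whose normal-tangential component is continuous across interior facets and is a polynomial of degree
at most `k - 1` on every facet. -/
structure MemSigmaH {Ω : Set (Eu d)} (M : Mesh Ω) (k : ℕ) (τ : Eu d → Mat d) : Prop where
  poly : ∀ i j, IsPiecewisePoly M k fun x => τ x i j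
  trace_zero : ∀ s ∈ M.elements, ∀ x ∈ openHull s, (τ x).trace = 0
  jump_nt : ∀ F, M.IsInteriorFacet F → ∀ᵐ x ∂(surf F), M.jumpNT τ F x = 0
  nt_poly : ∀ F ∈ M.facets, ∀ s ∈ M.elements, F ⊆ s → ∀ i : Fin d,
    ∃ p : MvPolynomial (Fin d) ℝ, p.totalDegree ≤ k - 1 ∧
      ∀ᵐ x ∂(surf F), nt (M.normal F) (traceM s F τ x) i = polyEval p x

/-- The velocity space `V_h = ℙᵏ(𝒯_h, ℝ^d) ∩ H₀(div, Ω)`. -/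
def MemVH {Ω : Set (Eu d)} (M : Mesh Ω) (k : ℕ) (v : Eu d → Eu d) : Prop :=
  (∀ i, IsPiecewisePoly M k fun x => v x i) ∧ MemHDiv0 Ω v

/-- The pressure space `Q_h = ℙ^{k-1}(𝒯_h) ∩ L²₀(Ω)`. -/
def MemQH {Ω : Set (Eu d)} (M : Mesh Ω) (k : ℕ) (q : Eu d → ℝ) : Prop :=
  IsPiecewisePoly M (k - 1) q ∧ MemL20 Ω q

/-! ### The bilinear forms -/

/-- `a(σ, τ) = (ν⁻¹ dev σ, dev τ)`. -/
def formA (Ω : Set (Eu d)) (ν : ℝ) (σ τ : Eu d → Mat d) : ℝ :=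
  ∫ x in Ω, ν⁻¹ * frob (dev (σ x)) (dev (τ x))

/-- `b₁(v, q) = (div v, q)`. -/
def formB1 (Ω : Set (Eu d)) (v : Eu d → Eu d) (q : Eu d → ℝ) : ℝ :=
  ∫ x in Ω, weakDiv Ω v x * q x

/-- `b₂(τ, v) = ∑_T ∫_T div τ · v - ∑_F ∫_F ⟦τ_nn⟧ v_n`. -/
def formB2 {Ω : Set (Eu d)} (M : Mesh Ω) (τ : Eu d → Mat d) (v : Eu d → Eu d) : ℝ :=
  (∑ s ∈ M.elements, ∫ x in openHull s, ⟪matDiv (openHull s) τ x, v x⟫_ℝ) -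
    ∑ F ∈ M.facets, ∫ x, M.jumpNN τ F x * M.normalTrace v F x ∂(surf F)

/-! ### The mixed Stokes problem -/

/-- `(σ, u, p)` solves the mixed stress form of the Stokes problem with viscosity `ν` and load `f`:
`ν⁻¹ dev σ - ∇u = 0`, `div σ - ∇p = -f`, `div u = 0` in `Ω` (as distributions), and `u = 0` on the
boundary (i.e. `u` lies in `H¹₀`). -/
structure IsStokesSolution (Ω : Set (Eu d)) (ν : ℝ) (f : Eu d → Eu d)
    (σ : Eu d → Mat d) (u : Eu d → Eu d) (p : Eu d → ℝ) : Prop where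
  constitutive : ∀ i, IsWeakGrad Ω (fun x => u x i) (row (fun x => ν⁻¹ • dev (σ x)) i)
  momentum : ∀ φ, IsTest Ω φ → ∀ i : Fin d,
    (-∫ x in Ω, ⟪row σ i x, gradient φ x⟫_ℝ) + ∫ x in Ω, p x * gradient φ x i =
      -∫ x in Ω, f x i * φ x
  incompressible : IsWeakDiv Ω u 0
  boundary : ∀ i, MemH10 Ω fun x => u x i

end MCS

end

open MeasureTheory Filter Topology
open scoped ContDiff InnerProductSpace

noncomputable section

namespace MCS

variable {d : ℕ}

/-! ### Geometry of a simplex -/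

/-! The identity splits into two independent cancellations.

Constitutive law: for trace-free `τ` the form `a` is `(∇u, τ)`, because `ν⁻¹ dev σ = ∇u`.
Integration by parts on every element turns `(∇u, τ) + ∑_T ∫_T div τ · u` into `∑_F ∫_F ⟦τ n⟧ · u`,
the trace of `u` being the same from both sides. Split `τ n` into its normal and tangential parts.
The first gives exactly the facet term that `b₂` subtracts. The second vanishes, because `⟦τ_nt⟧ =
0` on interior facets and `u = 0` on the boundary. This is `Mesh.integral_add_formB2`.

Momentum balance: since `σ` is in `H¹(Ω)` its traces do not jump (`Mesh.jump_trace_ae_eq_zero`), and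
`v_n` vanishes on outer facets (`Mesh.normalTrace_ae_eq_zero`), so `b₂(σ, v) = (div σ, v)`
(`Mesh.formB2_eq_integral`). The equation `∇p = f + div σ` puts `p` in `H¹(Ω)`
(`isH1Grad_pressure`). The definition of `H₀(div)` may therefore be tested with `p`, giving `(f +
div σ, v) + (div v, p) = 0`. The last term `b₁(u, q)` is zero since `div u = 0`.

The rest supplies the analysis. Green's formula on a simplex comes from integrating radially about
each vertex (`IsSimplex.integral_cone`). The same formula applied to `ψ²` is the trace inequality,
and mollification combined with a contraction gives density of smooth functions
(`exists_tendstoH1`); together they yield traces of `H¹` functions and extend Green's formula to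
them. Localising near one facet turns global weak identities into pointwise statements on that
facet; this needs that two elements at a facet lie on opposite sides (`Mesh.outerNormal_eq_neg`) and
that a Lipschitz domain equals the interior of its closure. -/

/-- `s` is the vertex set of a non-degenerate `d`-simplex. -/
structure IsSimplex (s : Finset (Eu d)) : Prop where
  indep : AffineIndependent ℝ ((↑) : s → Eu d)
  card_eq : s.card = d + 1

namespace IsSimplex

variable {s : Finset (Eu d)} (hs : IsSimplex s)

/-- The vertices of a simplex as an affine basis. -/
def basis : AffineBasis s ℝ (Eu d) where
  toFun := (↑)
  ind' := hs.indep
  tot' := by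
    rw [hs.indep.affineSpan_eq_top_iff_card_eq_finrank_add_one]
    simp [hs.card_eq]

@[simp] lemma basis_apply (v : s) : hs.basis v = v := rfl

lemma range_basis : Set.range hs.basis = (s : Set (Eu d)) := by
  ext x; simp

lemma hull_eq : hull s = {x | ∀ v, 0 ≤ hs.basis.coord v x} := by
  rw [hull, ← hs.range_basis, hs.basis.convexHull_eq_nonneg_coord]

lemma openHull_eq : openHull s = {x | ∀ v, 0 < hs.basis.coord v x} := by
  rw [openHull, hull, ← hs.range_basis, hs.basis.interior_convexHull]

/-- The gradient of a barycentric coordinate. -/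
def grad (v : s) : Eu d :=
  (InnerProductSpace.toDual ℝ (Eu d)).symm (LinearMap.toContinuousLinearMap
    (hs.basis.coord v).linear)

lemma inner_grad (v : s) (w : Eu d) : ⟪hs.grad v, w⟫_ℝ = (hs.basis.coord v).linear w := by
  simp [grad]

lemma coord_sub (v : s) (x y : Eu d) :
    hs.basis.coord v y - hs.basis.coord v x = ⟪hs.grad v, y - x⟫_ℝ := by
  rw [inner_grad, ← vsub_eq_sub y x, AffineMap.linearMap_vsub, vsub_eq_sub]

lemma coord_add (v : s) (x w : Eu d) :
    hs.basis.coord v (x + w) = hs.basis.coord v x + ⟪hs.grad v, w⟫_ℝ := by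
  have := hs.coord_sub v x (x + w)
  rw [add_sub_cancel_left] at this
  linarith

lemma coord_self (v : s) : hs.basis.coord v v = 1 := hs.basis.coord_apply_eq v

lemma coord_of_ne {v w : s} (h : v ≠ w) : hs.basis.coord v w = 0 := hs.basis.coord_apply_ne h

lemma coord_of_mem_erase (v : s) {x : Eu d} (hx : x ∈ s.erase v) : hs.basis.coord v x = 0 := by
  rw [Finset.mem_erase] at hx
  exact hs.coord_of_ne (w := ⟨x, hx.2⟩) (fun h => hx.1 (by simp [h]))

/-- The coordinates sum to one identically, so their differentials sum to zero. -/
lemma sum_inner_grad (e : Eu d) : ∑ v, ⟪hs.grad v, e⟫_ℝ = 0 := by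
  have h1 := hs.basis.sum_coord_apply_eq_one (0 : Eu d)
  have h2 := hs.basis.sum_coord_apply_eq_one (0 + e)
  simp_rw [hs.coord_add, Finset.sum_add_distrib, h1] at h2
  linarith

/-- This is the differential of `x = ∑ λ_v(x) v`. -/
lemma sum_inner_grad_smul (e : Eu d) : ∑ v : s, ⟪hs.grad v, e⟫_ℝ • (v : Eu d) = e := by
  have h1 := hs.basis.linear_combination_coord_eq_self (0 : Eu d)
  have h2 := hs.basis.linear_combination_coord_eq_self (0 + e)
  simp_rw [hs.coord_add, add_smul, Finset.sum_add_distrib, h1] at h2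
  simpa using h2

lemma mem_hull_erase (v : s) (x : Eu d) :
    x ∈ hull (s.erase v) ↔ x ∈ hull s ∧ hs.basis.coord v x = 0 := by
  constructor
  · intro hx
    refine ⟨convexHull_mono (by simp) hx, ?_⟩
    have hc : Convex ℝ {x | hs.basis.coord v x = 0} :=
      (convex_singleton (0 : ℝ)).affine_preimage (hs.basis.coord v)
    exact convexHull_min (fun y hy => hs.coord_of_mem_erase v hy) hc hx
  · rintro ⟨hx, h0⟩
    rw [hs.hull_eq] at hx
    have h1 := hs.basis.linear_combination_coord_eq_self x
    have h2 := hs.basis.sum_coord_apply_eq_one x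
    rw [← Finset.add_sum_erase _ _ (Finset.mem_univ v), h0] at h1 h2
    rw [← h1, zero_smul, zero_add]
    refine (convex_convexHull ℝ _).sum_mem (fun i _ => hx i) (by simpa using h2) fun i hi => ?_
    refine subset_convexHull ℝ _ ?_
    simp only [Finset.mem_erase, Finset.mem_univ, and_true] at hi
    simp [hi]

lemma grad_ne_zero (hd : 0 < d) (v : s) : hs.grad v ≠ 0 := by
  intro h
  have : Nontrivial s := by
    rw [← Fintype.one_lt_card_iff_nontrivial]; simp [hs.card_eq, hd]
  obtain ⟨w, hw⟩ := exists_ne v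
  have := hs.coord_sub v w v
  rw [hs.coord_self, hs.coord_of_ne hw.symm, h] at this
  simp at this

/-- The coordinate of `v` vanishes on the opposite facet and is nonnegative on the simplex, so its
negative gradient points outwards. -/
lemma isOuterNormal (hd : 0 < d) (v : s) :
    IsOuterNormal s (s.erase v) (-(‖hs.grad v‖⁻¹ • hs.grad v)) := by
  have h0 := norm_ne_zero_iff.2 (hs.grad_ne_zero hd v)
  refine ⟨by simp [norm_smul, h0], fun x hx y hy => ?_, fun x hx y hy => ?_⟩
  · rw [inner_neg_left, real_inner_smul_left, ← hs.coord_sub, hs.coord_of_mem_erase v hx,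
      hs.coord_of_mem_erase v hy]
    simp
  · rw [inner_neg_left, real_inner_smul_left, ← hs.coord_sub, hs.coord_of_mem_erase v hx]
    have h1 : 0 ≤ hs.basis.coord v y := by
      have : y ∈ hull s := subset_convexHull ℝ _ hy
      rw [hs.hull_eq] at this
      exact this v
    have := mul_nonneg (inv_nonneg.2 (norm_nonneg (hs.grad v))) h1
    simpa using this

/-- A vector orthogonal to a facet is a multiple of the gradient of a barycentric coordinate. -/
lemma exists_eq_smul_grad (hd : 0 < d) (v : s) {n : Eu d}
    (h : ∀ x ∈ s.erase v, ∀ y ∈ s.erase v, ⟪n, y - x⟫_ℝ = 0) :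
    ∃ w ∈ s.erase v, n = ⟪n, (v : Eu d) - w⟫_ℝ • hs.grad v := by
  have : Nontrivial s := by
    rw [← Fintype.one_lt_card_iff_nontrivial]; simp [hs.card_eq, hd]
  obtain ⟨w, hw⟩ := exists_ne v
  have hwF : (w : Eu d) ∈ s.erase v := by simp [hw]
  refine ⟨w, hwF, ext_inner_right ℝ fun e => ?_⟩
  have e1 : e = ∑ u : s, ⟪hs.grad u, e⟫_ℝ • ((u : Eu d) - w) := by
    simp_rw [smul_sub, Finset.sum_sub_distrib, hs.sum_inner_grad_smul, ← Finset.sum_smul,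
      hs.sum_inner_grad]
    simp
  conv_lhs => rw [e1]
  rw [real_inner_smul_left, inner_sum, Finset.sum_eq_single v]
  · rw [real_inner_smul_right, mul_comm]
  · intro u _ hu
    rw [real_inner_smul_right, h _ hwF _ (by simp [hu]), mul_zero]
  · simp

/-- Orthogonality to the facet leaves one scalar; the inequality at `v` fixes its sign and the unit
norm its size. Uniqueness makes the arbitrary choice in `outerNormal` explicit. -/
lemma eq_of_isOuterNormal (hd : 0 < d) (v : s) {n : Eu d} (hn : IsOuterNormal s (s.erase v) n) :
    n = -(‖hs.grad v‖⁻¹ • hs.grad v) := by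
  obtain ⟨h1, h2, h3⟩ := hn
  obtain ⟨w, hwF, hn⟩ := hs.exists_eq_smul_grad hd v h2
  have hh0 : ⟪n, (v : Eu d) - w⟫_ℝ ≤ 0 := h3 _ hwF _ v.2
  set h := ⟪n, (v : Eu d) - w⟫_ℝ with hh
  have h4 : -h * ‖hs.grad v‖ = 1 := by
    rw [hn, norm_smul, Real.norm_eq_abs, abs_of_nonpos hh0] at h1; exact h1
  have h5 := eq_inv_of_mul_eq_one_left h4
  rw [← h5, hn]; simp

lemma outerNormal_erase (hd : 0 < d) (v : s) :
    outerNormal s (s.erase v) = -(‖hs.grad v‖⁻¹ • hs.grad v) := by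
  have h : ∃ n, IsOuterNormal s (s.erase v) n := ⟨_, hs.isOuterNormal hd v⟩
  rw [outerNormal, dif_pos h]
  exact hs.eq_of_isOuterNormal hd v h.choose_spec

lemma openHull_nonempty (hs : IsSimplex s) : (openHull s).Nonempty := by
  have := hs.basis.centroid_mem_interior_convexHull
  rw [hs.range_basis] at this
  exact ⟨_, this⟩

end IsSimplex

lemma isCompact_hull (s : Finset (Eu d)) : IsCompact (hull s) :=
  s.finite_toSet.isCompact_convexHull ℝ

/-- The interior of a facet, in barycentric coordinates. -/
lemma IsSimplex.exists_pos_coord {s : Finset (Eu d)} (hs : IsSimplex s) (hd : 0 < d) (v : s) :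
    ∃ m ∈ hull (s.erase v), ∀ i, i ≠ v → 0 < hs.basis.coord i m := by
  obtain ⟨q, hq⟩ := hs.openHull_nonempty
  rw [hs.openHull_eq] at hq
  have : Nontrivial s := by
    rw [← Fintype.one_lt_card_iff_nontrivial]; simp [hs.card_eq, hd]
  obtain ⟨w, hw⟩ := exists_ne v
  have hlt : hs.basis.coord v q < 1 := by
    have h1 := hs.basis.sum_coord_apply_eq_one q
    rw [← Finset.add_sum_erase _ _ (Finset.mem_univ v)] at h1
    have h2 : 0 < ∑ i ∈ Finset.univ.erase v, hs.basis.coord i q :=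
      Finset.sum_pos (fun i _ => hq i) ⟨w, by simp [hw]⟩
    linarith
  -- The ray from `v` through `q` meets the opposite facet at parameter `c`: along it the coordinate
  -- of `v` falls from 1 at rate `1 - λ_v(q)`.
  set c := (1 - hs.basis.coord v q)⁻¹ with hc
  have hc0 : 0 < c := inv_pos.2 (by linarith)
  have hco : ∀ i, hs.basis.coord i (v + c • (q - v)) =
      hs.basis.coord i v + c * (hs.basis.coord i q - hs.basis.coord i v) := fun i => by
    rw [hs.coord_add, real_inner_smul_right, hs.coord_sub]
  have hpos : ∀ i, i ≠ v → 0 < hs.basis.coord i (v + c • (q - v)) := fun i hi => by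
    rw [hco, hs.coord_of_ne hi, sub_zero, zero_add]
    exact mul_pos hc0 (hq i)
  have hv : hs.basis.coord v (v + c • (q - v)) = 0 := by
    have h3 : 1 - hs.basis.coord v q ≠ 0 := by linarith
    rw [hco, hs.coord_self, hc]
    field_simp
    ring
  refine ⟨v + c • (q - v), (hs.mem_hull_erase v _).2 ⟨?_, hv⟩, hpos⟩
  rw [hs.hull_eq]
  intro i
  rcases eq_or_ne i v with rfl | hi
  · exact hv.ge
  · exact (hpos i hi).le

lemma isOpen_openHull (s : Finset (Eu d)) : IsOpen (openHull s) := isOpen_interior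

lemma openHull_subset (s : Finset (Eu d)) : openHull s ⊆ hull s := interior_subset

lemma openHull_ae_eq (s : Finset (Eu d)) : (openHull s : Set (Eu d)) =ᵐ[volume] hull s :=
  interior_ae_eq_of_null_frontier ((convex_convexHull ℝ _).addHaar_frontier volume)

lemma restrict_openHull (s : Finset (Eu d)) :
    volume.restrict (openHull s) = volume.restrict (hull s) :=
  Measure.restrict_congr_set (openHull_ae_eq s)

/-! ### Surface measures -/

lemma finrank_orthogonal {a : Eu d} (ha : a ≠ 0) : Module.finrank ℝ (ℝ ∙ a)ᗮ = d - 1 := by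
  have h := (ℝ ∙ a).finrank_add_finrank_orthogonal
  rw [finrank_span_singleton ha, finrank_euclideanSpace_fin] at h
  omega

/-- A set of at most `m` points spans a polytope of vanishing `m`-dimensional measure. -/
lemma euclideanHausdorffMeasure_hull_eq_zero (G : Finset (Eu d)) (m : ℕ) (hG : G.card ≤ m) :
    Measure.euclideanHausdorffMeasure m (hull G) = 0 := by
  rcases G.eq_empty_or_nonempty with rfl | ⟨p, hp⟩
  · simp [hull]
  have hsub : hull G ⊆ (fun w => w + p) '' (vectorSpan ℝ (G : Set (Eu d)) : Set (Eu d)) := by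
    intro x hx
    have hx' : x ∈ affineSpan ℝ (G : Set (Eu d)) := convexHull_subset_affineSpan _ hx
    refine ⟨x - p, ?_, by simp⟩
    have := AffineSubspace.vsub_mem_direction hx' (mem_affineSpan ℝ hp)
    rwa [direction_affineSpan] at this
  refine measure_mono_null hsub ?_
  -- At most `m` points span an affine space of dimension at most `m - 1`, so the Hausdorff
  -- dimension is below `m`.
  have hfr : Module.finrank ℝ (vectorSpan ℝ (G : Set (Eu d))) < m := by
    have hpos : 0 < G.card := Finset.card_pos.2 ⟨p, hp⟩
    have := finrank_vectorSpan_range_le ℝ ((↑) : G → Eu d) (n := G.card - 1)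
      (by simp; omega)
    rw [Subtype.range_coe_subtype] at this
    have h2 : {x | x ∈ G} = (G : Set (Eu d)) := rfl
    rw [h2] at this
    omega
  rw [(isometry_add_right p).euclideanHausdorffMeasure_image]
  rw [Measure.euclideanHausdorffMeasure_def, Measure.smul_apply]
  have : Measure.hausdorffMeasure (m : ℝ) (vectorSpan ℝ (G : Set (Eu d)) : Set (Eu d)) = 0 := by
    refine hausdorffMeasure_of_dimH_lt (d := m) ?_
    have h3 : (vectorSpan ℝ (G : Set (Eu d)) : Set (Eu d)) =
        Subtype.val '' (Set.univ : Set (vectorSpan ℝ (G : Set (Eu d)))) := by simp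
    rw [h3, isometry_subtype_coe.dimH_image, Real.dimH_univ_eq_finrank]
    exact_mod_cast hfr
  rw [this, smul_zero]

lemma volume_hull_eq_zero (G : Finset (Eu d)) (hG : G.card ≤ d) : volume (hull G) = 0 := by
  rw [← EuclideanSpace.euclideanHausdorffMeasure_eq_volume]
  exact euclideanHausdorffMeasure_hull_eq_zero G d hG

/-- The surface measure of a facet in a hyperplane is parametrised by that hyperplane. -/
lemma surf_eq_map {a p : Eu d} (ha : a ≠ 0) (F : Finset (Eu d))
    (hF : ∀ x ∈ hull F, ⟪a, x - p⟫_ℝ = 0) :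
    surf F = (volume.restrict {z : (ℝ ∙ a)ᗮ | p + z ∈ hull F}).map
      (fun z : (ℝ ∙ a)ᗮ => p + (z : Eu d)) := by
  have hiso : Isometry (fun z : (ℝ ∙ a)ᗮ => p + (z : Eu d)) :=
    (isometry_add_left p).comp isometry_subtype_coe
  have hr : hull F ⊆ Set.range (fun z : (ℝ ∙ a)ᗮ => p + (z : Eu d)) := by
    intro x hx
    exact ⟨⟨x - p, Submodule.mem_orthogonal_singleton_iff_inner_right.2 (hF x hx)⟩, by simp⟩
  have hm : MeasurableSet (hull F) := (isCompact_hull F).measurableSet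
  have h1 := hiso.map_euclideanHausdorffMeasure (d := d - 1)
  have h2 : surf F = ((Measure.euclideanHausdorffMeasure (d - 1)).restrict
      (Set.range fun z : (ℝ ∙ a)ᗮ => p + (z : Eu d))).restrict (hull F) := by
    rw [Measure.restrict_restrict hm, Set.inter_eq_left.2 hr, surf]
  -- Writing `d - 1` as the dimension of the hyperplane turns the normalised Hausdorff measure there
  -- into Lebesgue measure.
  rw [h2, ← h1, Measure.restrict_map hiso.continuous.measurable hm, ← finrank_orthogonal ha,
    InnerProductSpace.euclideanHausdorffMeasure_eq_volume]
  rfl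

namespace IsSimplex

variable {s : Finset (Eu d)} (hs : IsSimplex s)

/-- The foot of the altitude through the vertex `v`. -/
def foot (v : s) : Eu d := v + (-(‖hs.grad v‖⁻¹ ^ 2) • hs.grad v)

lemma coord_foot (hd : 0 < d) (v : s) : hs.basis.coord v (hs.foot v) = 0 := by
  have h0 := norm_ne_zero_iff.2 (hs.grad_ne_zero hd v)
  rw [foot, hs.coord_add, hs.coord_self, real_inner_smul_right, real_inner_self_eq_norm_sq]
  field_simp
  ring

lemma surf_erase (hd : 0 < d) (v : s) :
    surf (s.erase v) =
      (volume.restrict {z : (ℝ ∙ hs.grad v)ᗮ | hs.foot v + z ∈ hull (s.erase v)}).map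
        (fun z : (ℝ ∙ hs.grad v)ᗮ => hs.foot v + (z : Eu d)) := by
  refine surf_eq_map (hs.grad_ne_zero hd v) _ fun x hx => ?_
  rw [← hs.coord_sub, hs.coord_foot hd, ((hs.mem_hull_erase v x).1 hx).2, sub_zero]

lemma isFiniteMeasure_surf (hs : IsSimplex s) (hd : 0 < d) (v : s) :
    IsFiniteMeasure (surf (s.erase v)) := by
  rw [hs.surf_erase hd v]
  have hiso : Isometry (fun z : (ℝ ∙ hs.grad v)ᗮ => hs.foot v + (z : Eu d)) :=
    (isometry_add_left _).comp isometry_subtype_coe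
  have : IsCompact {z : (ℝ ∙ hs.grad v)ᗮ | hs.foot v + z ∈ hull (s.erase v)} :=
    hiso.isClosedEmbedding.isCompact_preimage (isCompact_hull _)
  have : IsFiniteMeasure
      (volume.restrict {z : (ℝ ∙ hs.grad v)ᗮ | hs.foot v + z ∈ hull (s.erase v)}) :=
    ⟨by simpa using this.measure_lt_top⟩
  infer_instance

lemma integral_surf_erase (hd : 0 < d) (v : s) (ψ : Eu d → ℝ) :
    ∫ y, ψ y ∂(surf (s.erase v)) =
      ∫ z : (ℝ ∙ hs.grad v)ᗮ, (hull (s.erase v)).indicator ψ (hs.foot v + z) := by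
  have hiso : Isometry (fun z : (ℝ ∙ hs.grad v)ᗮ => hs.foot v + (z : Eu d)) :=
    (isometry_add_left _).comp isometry_subtype_coe
  rw [hs.surf_erase hd v, hiso.isClosedEmbedding.measurableEmbedding.integral_map,
    ← integral_indicator]
  · rfl
  · exact hiso.continuous.measurable (isCompact_hull _).measurableSet

/-- Under the homothety about `v` the other coordinates scale by `τ > 0`, while that of `v` becomes
`1 - τ ≥ 0`. Slices of the simplex parallel to the facet are thus scaled copies of it. -/
lemma add_smul_mem_hull_iff (v : s) {τ : ℝ} (h0 : 0 < τ) (h1 : τ ≤ 1) {w : Eu d}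
    (hw : hs.basis.coord v (v + w) = 0) :
    (v : Eu d) + τ • w ∈ hull s ↔ (v : Eu d) + w ∈ hull (s.erase v) := by
  rw [hs.mem_hull_erase, and_iff_left hw, hs.hull_eq]
  refine forall_congr' fun i => ?_
  rw [hs.coord_add, hs.coord_add, real_inner_smul_right]
  rw [hs.coord_add] at hw
  by_cases hi : i = v
  · subst hi
    rw [hs.coord_self] at hw ⊢
    constructor <;> intro _ <;> nlinarith
  · rw [hs.coord_of_ne hi, zero_add, zero_add, mul_nonneg_iff_of_pos_left h0]

/-- Integration over a simplex in polar coordinates about one of its vertices. -/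
lemma integral_hull_eq (hd : 0 < d) (v : s) {g : Eu d → ℝ} (hg : Continuous g) :
    ∫ x in hull s, g x = ‖hs.grad v‖⁻¹ * ∫ τ in (0 : ℝ)..1,
      τ ^ (d - 1) * ∫ y, g (v + τ • (y - v)) ∂(surf (s.erase v)) := by
  set a := hs.grad v with ha
  have ha0 : a ≠ 0 := hs.grad_ne_zero hd v
  have hpos : 0 < ‖a‖ := norm_pos_iff.2 ha0
  set h : ℝ := ‖a‖⁻¹ with hh
  have hh0 : 0 < h := inv_pos.2 hpos
  set b : Eu d := -(h • a) with hb
  have hb1 : ‖b‖ = 1 := by rw [hb, norm_neg, norm_smul, norm_inv, norm_norm]; field_simp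
  have hab : ⟪a, b⟫_ℝ = -‖a‖ := by
    rw [hb, inner_neg_right, real_inner_smul_right, real_inner_self_eq_norm_sq, hh]; field_simp
  have hspan : (ℝ ∙ b) = ℝ ∙ a := by
    rw [hb, ← neg_smul]
    exact Submodule.span_singleton_smul_eq (IsUnit.mk0 _ (by simpa using hh0.ne')) a
  have hfoot : hs.foot v = v + h • b := by
    rw [foot, hb, smul_neg, smul_smul, neg_smul, sq]
  have hperp : ∀ z : (ℝ ∙ a)ᗮ, ⟪a, (z : Eu d)⟫_ℝ = 0 := fun z =>
    Submodule.mem_orthogonal_singleton_iff_inner_right.1 z.2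
  have hm : MeasurableSet (hull s) := (isCompact_hull s).measurableSet
  set φ : Eu d → ℝ := (hull s).indicator g with hφ
  have hint : Integrable φ := (integrable_indicator_iff hm).2
    (hg.continuousOn.integrableOn_compact (isCompact_hull s))
  -- the slices
  have hslice : ∀ τ, 0 < τ → τ ≤ 1 → ∫ z : (ℝ ∙ a)ᗮ, φ (v + (h * τ) • b + z) =
      τ ^ (d - 1) * ∫ y, g (v + τ • (y - v)) ∂(surf (s.erase v)) := by
    intro τ h0 h1
    -- Rescaling the slice to the full facet produces the Jacobian `τ ^ (d - 1)`.
    have e1 := Measure.integral_comp_inv_smul_of_nonneg (volume : Measure (ℝ ∙ a)ᗮ)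
      (fun z : (ℝ ∙ a)ᗮ => φ (v + (h * τ) • b + τ • (z : Eu d))) h0.le
    simp only [Submodule.coe_smul, smul_inv_smul₀ h0.ne', finrank_orthogonal ha0,
      smul_eq_mul] at e1
    rw [e1, hs.integral_surf_erase hd v]
    congr 1
    refine integral_congr_ae (Eventually.of_forall fun z => ?_)
    have hc : hs.basis.coord v (v + (h • b + (z : Eu d))) = 0 := by
      rw [hs.coord_add, hs.coord_self, inner_add_right, ← ha, hperp, real_inner_smul_right, hab, hh]
      field_simp
      ring
    have key := hs.add_smul_mem_hull_iff v h0 h1 hc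
    have e2 : (v : Eu d) + (h * τ) • b + τ • (z : Eu d) = v + τ • (h • b + z) := by
      rw [smul_add, smul_smul, mul_comm τ h, add_assoc]
    have e3 : hs.foot v + (z : Eu d) = v + (h • b + z) := by rw [hfoot, add_assoc]
    simp only [e2, e3, hφ]
    by_cases hz : (v : Eu d) + (h • b + z) ∈ hull (s.erase v)
    · rw [Set.indicator_of_mem hz, Set.indicator_of_mem (key.2 hz), add_sub_cancel_left]
    · rw [Set.indicator_of_notMem hz, Set.indicator_of_notMem (mt key.1 hz)]
  -- On the slice at distance `t` the coordinate of `v` is `1 - t‖a‖`, and it lies in `[0, 1]` on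
  -- the simplex.
  have hout : ∀ t, t ∉ Set.Icc 0 h → ∫ z : (ℝ ∙ a)ᗮ, φ (v + t • b + z) = 0 := by
    intro t ht
    rw [← integral_zero (ℝ ∙ a)ᗮ ℝ]
    refine integral_congr_ae (Eventually.of_forall fun z => ?_)
    simp only [hφ]
    refine Set.indicator_of_notMem (fun hmem => ht ?_) _
    rw [hs.hull_eq] at hmem
    have hc : hs.basis.coord v (v + t • b + (z : Eu d)) = 1 - t * ‖a‖ := by
      rw [add_assoc, hs.coord_add, hs.coord_self, inner_add_right, ← ha, hperp,
        real_inner_smul_right, hab]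
      ring
    have hc0 := hmem v
    have hc1 : hs.basis.coord v (v + t • b + (z : Eu d)) ≤ 1 := by
      rw [← hs.basis.sum_coord_apply_eq_one (v + t • b + (z : Eu d))]
      exact Finset.single_le_sum (f := fun i => hs.basis.coord i (v + t • b + (z : Eu d)))
        (fun i _ => hmem i) (Finset.mem_univ v)
    rw [hc] at hc0 hc1
    constructor
    · nlinarith
    · rw [hh, ← one_div, le_div_iff₀ hpos]; linarith
  have hmp := ((ℝ ∙ a).measurePreserving_measurableEquivProd (v : Eu d)).symm
  rw [InnerProductSpace.euclideanHausdorffMeasure_eq_volume] at hmp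
  -- The altitude direction is parametrised by arc length, so Fubini introduces no further factor.
  let L : ℝ ≃ₗᵢ[ℝ] (ℝ ∙ a) := (LinearIsometryEquiv.toSpanUnitSingleton b hb1).trans
    (LinearIsometryEquiv.ofEq _ _ hspan)
  have hL : ∀ t, (L t : Eu d) = t • b := fun t => by simp [L]
  have hint2 := hmp.integrable_comp_of_integrable hint
  calc ∫ x in hull s, g x = ∫ x, φ x := (integral_indicator hm).symm
    _ = ∫ q : (ℝ ∙ a) × (ℝ ∙ a)ᗮ, φ (((ℝ ∙ a).measurableEquivProd (v : Eu d)).symm q) :=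
      (hmp.integral_comp' _).symm
    _ = ∫ x : (ℝ ∙ a), ∫ z : (ℝ ∙ a)ᗮ,
          φ (((ℝ ∙ a).measurableEquivProd (v : Eu d)).symm (x, z)) := by
      rw [Measure.volume_eq_prod]
      exact integral_prod _ hint2
    _ = ∫ t : ℝ, ∫ z : (ℝ ∙ a)ᗮ, φ (v + t • b + z) := by
      rw [← L.measurePreserving.integral_comp L.toHomeomorph.measurableEmbedding]
      simp only [Submodule.measurableEquivProd_symm_apply, hL, vadd_eq_add]
      refine integral_congr_ae (Eventually.of_forall fun t => ?_)
      refine integral_congr_ae (Eventually.of_forall fun z => ?_)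
      simp only
      congr 1; abel
    _ = ∫ t in (0 : ℝ)..h, ∫ z : (ℝ ∙ a)ᗮ, φ (v + t • b + z) := by
      rw [intervalIntegral.integral_of_le hh0.le, ← integral_Icc_eq_integral_Ioc]
      exact (setIntegral_eq_integral_of_forall_compl_eq_zero hout).symm
    _ = h * ∫ τ in (0 : ℝ)..1, ∫ z : (ℝ ∙ a)ᗮ, φ (v + (h * τ) • b + z) := by
      have := intervalIntegral.mul_integral_comp_mul_left (a := 0) (b := 1)
        (f := fun t => ∫ z : (ℝ ∙ a)ᗮ, φ (v + t • b + z)) h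
      rw [this]; simp
    _ = _ := by
      congr 1
      rw [intervalIntegral.integral_of_le zero_le_one, intervalIntegral.integral_of_le zero_le_one]
      exact setIntegral_congr_fun measurableSet_Ioc fun τ hτ => hslice τ hτ.1 hτ.2

end IsSimplex

/-! ### Green's formula for smooth functions on a simplex -/

lemma surf_restrict (F : Finset (Eu d)) : (surf F).restrict (hull F) = surf F := by
  rw [surf, Measure.restrict_restrict (isCompact_hull F).measurableSet, Set.inter_self]

lemma ae_surf_mem (F : Finset (Eu d)) : ∀ᵐ x ∂(surf F), x ∈ hull F :=
  ae_restrict_mem (isCompact_hull F).measurableSet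

lemma integrableOn_hull {s : Finset (Eu d)} {g : Eu d → ℝ} (hg : Continuous g) :
    IntegrableOn g (hull s) :=
  hg.continuousOn.integrableOn_compact (isCompact_hull s)

namespace IsSimplex

variable {s : Finset (Eu d)} (hs : IsSimplex s)

/-- The divergence theorem for `ψ (x - v)` on a simplex with vertex `v`. -/
lemma integral_cone (hd : 0 < d) (v : s) {ψ : Eu d → ℝ} (hψ : ContDiff ℝ 1 ψ) :
    ∫ x in hull s, (d * ψ x + fderiv ℝ ψ x (x - v)) =
      ‖hs.grad v‖⁻¹ * ∫ y, ψ y ∂(surf (s.erase v)) := by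
  have := hs.isFiniteMeasure_surf hd v
  have hf : Continuous (fderiv ℝ ψ) := hψ.continuous_fderiv (by simp)
  have hc := hψ.continuous
  have hg : Continuous fun x => d * ψ x + fderiv ℝ ψ x (x - v) := by fun_prop
  rw [hs.integral_hull_eq hd v hg]
  congr 1
  rw [intervalIntegral.integral_of_le zero_le_one]
  simp_rw [← integral_const_mul]
  rw [integral_integral_swap]
  · refine integral_congr_ae (Eventually.of_forall fun y => ?_)
    simp only
    rw [← intervalIntegral.integral_of_le zero_le_one]
    -- For fixed `y` on the facet the radial integrand is an exact derivative; its primitive is `ψ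
    -- y` at `τ = 1` and zero at `τ = 0`, because `d > 0`.
    have hder : ∀ τ ∈ Set.uIcc (0 : ℝ) 1, HasDerivAt (fun τ : ℝ => τ ^ d * ψ (v + τ • (y - v)))
        (τ ^ (d - 1) * (d * ψ (v + τ • (y - v)) +
          fderiv ℝ ψ (v + τ • (y - v)) (v + τ • (y - v) - v))) τ := by
      intro τ _
      have h1 : HasDerivAt (fun τ : ℝ => (v : Eu d) + τ • (y - v)) (y - v) τ := by
        simpa using ((hasDerivAt_id τ).smul_const (y - (v : Eu d))).const_add (v : Eu d)
      have h2 := ((hψ.differentiable (by simp)) (v + τ • (y - v))).hasFDerivAt.comp_hasDerivAt τ h1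
      have h3 := (hasDerivAt_pow d τ).mul h2
      convert! h3 using 1
      obtain ⟨m, rfl⟩ : ∃ m, d = m + 1 := ⟨d - 1, by omega⟩
      simp only [add_sub_cancel_left, map_smul, smul_eq_mul, Nat.add_sub_cancel, pow_succ,
        Function.comp]
      ring
    rw [intervalIntegral.integral_eq_sub_of_hasDerivAt hder]
    · simp [hd.ne']
    · apply Continuous.intervalIntegrable
      fun_prop
  · rw [← surf_restrict, Measure.prod_restrict]
    refine IntegrableOn.mono_set (t := Set.Icc 0 1 ×ˢ hull (s.erase v)) ?_
      (Set.prod_mono Set.Ioc_subset_Icc_self le_rfl)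
    refine ContinuousOn.integrableOn_compact (isCompact_Icc.prod (isCompact_hull _)) ?_
    apply Continuous.continuousOn
    unfold Function.uncurry
    fun_prop

/-- The divergence theorem on a simplex. -/
lemma integral_fderiv (hs : IsSimplex s) (hd : 0 < d) {ψ : Eu d → ℝ} (hψ : ContDiff ℝ 1 ψ) (e : Eu d) :
    ∫ x in hull s, fderiv ℝ ψ x e =
      ∑ v : s, ⟪outerNormal s (s.erase v), e⟫_ℝ * ∫ y, ψ y ∂(surf (s.erase v)) := by
  have hf : Continuous (fderiv ℝ ψ) := hψ.continuous_fderiv (by simp)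
  have hc := hψ.continuous
  -- The constant field `e` is a combination of the cone fields `x - v`, with weights summing to
  -- zero, so the terms `d * ψ x` cancel and the formula for cones applies to each summand.
  have key : ∀ x, fderiv ℝ ψ x e =
      ∑ v : s, -⟪hs.grad v, e⟫_ℝ * (d * ψ x + fderiv ℝ ψ x (x - v)) := by
    intro x
    have e1 : e = ∑ v : s, (-⟪hs.grad v, e⟫_ℝ) • (x - (v : Eu d)) := by
      simp_rw [smul_sub, Finset.sum_sub_distrib, neg_smul, Finset.sum_neg_distrib,
        hs.sum_inner_grad_smul, ← Finset.sum_smul, hs.sum_inner_grad]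
      simp
    conv_lhs => rw [e1, map_sum]
    simp_rw [mul_add, Finset.sum_add_distrib, ← Finset.sum_mul, Finset.sum_neg_distrib,
      hs.sum_inner_grad, map_smul, smul_eq_mul]
    simp
  simp_rw [key]
  rw [integral_finsetSum]
  · refine Finset.sum_congr rfl fun v _ => ?_
    rw [integral_const_mul, hs.integral_cone hd v hψ, hs.outerNormal_erase hd, inner_neg_left,
      real_inner_smul_left]
    ring
  · intro v _
    refine Integrable.const_mul (integrableOn_hull ?_) _
    fun_prop

/-- Integration by parts on a simplex. -/
lemma integral_mul_fderiv (hs : IsSimplex s) (hd : 0 < d) {φ ψ : Eu d → ℝ} (hφ : ContDiff ℝ 1 φ)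
    (hψ : ContDiff ℝ 1 ψ) (e : Eu d) :
    ∫ x in hull s, (φ x * fderiv ℝ ψ x e + fderiv ℝ φ x e * ψ x) =
      ∑ v : s, ⟪outerNormal s (s.erase v), e⟫_ℝ * ∫ y, φ y * ψ y ∂(surf (s.erase v)) := by
  rw [← hs.integral_fderiv hd (hφ.mul hψ)]
  refine integral_congr_ae (Eventually.of_forall fun x => ?_)
  simp only
  rw [fderiv_fun_mul (hφ.differentiable (by simp) x) (hψ.differentiable (by simp) x)]
  simp [mul_comm]

end IsSimplex

/-! ### Test functions and weak derivatives -/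

lemma gradient_apply (φ : Eu d → ℝ) (x : Eu d) (i : Fin d) :
    gradient φ x i = fderiv ℝ φ x (EuclideanSpace.single i 1) := by
  have h : gradient φ x i = ⟪gradient φ x, EuclideanSpace.single i (1 : ℝ)⟫_ℝ := by
    rw [EuclideanSpace.inner_single_right]; simp
  rw [h, gradient, InnerProductSpace.toDual_symm_apply]

lemma inner_gradient (φ : Eu d → ℝ) (x e : Eu d) : ⟪gradient φ x, e⟫_ℝ = fderiv ℝ φ x e := by
  rw [gradient, InnerProductSpace.toDual_symm_apply]

lemma continuous_gradient {φ : Eu d → ℝ} (h : ContDiff ℝ 1 φ) : Continuous (gradient φ) :=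
  (InnerProductSpace.toDual ℝ (Eu d)).symm.continuous.comp (h.continuous_fderiv (by simp))

lemma gradient_sub {φ ψ : Eu d → ℝ} (hφ : ContDiff ℝ 1 φ) (hψ : ContDiff ℝ 1 ψ) (x : Eu d) :
    gradient (fun y => φ y - ψ y) x = gradient φ x - gradient ψ x := by
  rw [gradient, gradient, gradient, fderiv_fun_sub (hφ.differentiable (by simp) x)
    (hψ.differentiable (by simp) x), map_sub]

lemma tsupport_gradient_subset (φ : Eu d → ℝ) : tsupport (gradient φ) ⊆ tsupport φ := by
  refine closure_minimal (fun x hx => ?_) (isClosed_tsupport φ)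
  by_contra h
  exact hx (by rw [gradient, fderiv_of_notMem_tsupport ℝ h, map_zero])

lemma IsTest.contDiff_one {U : Set (Eu d)} {φ : Eu d → ℝ} (h : IsTest U φ) : ContDiff ℝ 1 φ :=
  h.1.of_le (by simp)

lemma IsTest.mono {U V : Set (Eu d)} (hUV : U ⊆ V) {φ : Eu d → ℝ} (h : IsTest U φ) :
    IsTest V φ := ⟨h.1, h.2.1, h.2.2.trans hUV⟩

lemma IsTest.memLp {U : Set (Eu d)} {φ : Eu d → ℝ} (h : IsTest U φ) (V : Set (Eu d)) :
    MemLp φ 2 (volume.restrict V) :=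
  (h.1.continuous.memLp_of_hasCompactSupport h.2.1).restrict V

lemma IsTest.memLp_gradient {U : Set (Eu d)} {φ : Eu d → ℝ} (h : IsTest U φ) (V : Set (Eu d)) :
    MemLp (gradient φ) 2 (volume.restrict V) := by
  refine ((continuous_gradient h.contDiff_one).memLp_of_hasCompactSupport ?_).restrict V
  exact h.2.1.of_isClosed_subset (isClosed_tsupport _) (tsupport_gradient_subset φ)

lemma IsTest.eq_zero {U : Set (Eu d)} {φ : Eu d → ℝ} (h : IsTest U φ) {x : Eu d} (hx : x ∉ U) :
    φ x = 0 := image_eq_zero_of_notMem_tsupport fun h' => hx (h.2.2 h')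

lemma IsTest.gradient_eq_zero {U : Set (Eu d)} {φ : Eu d → ℝ} (h : IsTest U φ) {x : Eu d}
    (hx : x ∉ U) : gradient φ x = 0 :=
  image_eq_zero_of_notMem_tsupport fun h' => hx (h.2.2 (tsupport_gradient_subset φ h'))

lemma memLp_coord {μ : Measure (Eu d)} {G : Eu d → Eu d} (h : MemLp G 2 μ) (i : Fin d) :
    MemLp (fun x => G x i) 2 μ := h.eval_piLp i

lemma integrable_fun_mul {μ : Measure (Eu d)} {f g : Eu d → ℝ} (hf : MemLp f 2 μ)
    (hg : MemLp g 2 μ) : Integrable (fun x => f x * g x) μ := hf.integrable_mul hg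

/-- Square integrable functions are determined by their action on test functions. -/
lemma ae_eq_of_forall_isTest {U : Set (Eu d)} (hU : IsOpen U) {f g : Eu d → ℝ}
    (hf : MemLp f 2 (volume.restrict U)) (hg : MemLp g 2 (volume.restrict U))
    (h : ∀ φ, IsTest U φ → ∫ x in U, f x * φ x = ∫ x in U, g x * φ x) :
    f =ᵐ[volume.restrict U] g := by
  have h1 : LocallyIntegrable (f - g) (volume.restrict U) :=
    (hf.sub hg).locallyIntegrable one_le_two
  have h2 := hU.ae_eq_zero_of_integral_contDiff_smul_eq_zero (h1.locallyIntegrableOn U)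
    fun φ h1 h2 h3 => by
      have ht : IsTest U φ := ⟨h1, h2, h3⟩
      have e : ∀ x, φ x • (f - g) x = f x * φ x - g x * φ x := fun x => by
        simp only [Pi.sub_apply, smul_eq_mul]; ring
      simp_rw [e]
      rw [integral_sub (integrable_fun_mul hf (ht.memLp U)) (integrable_fun_mul hg (ht.memLp U)),
        h φ ht, sub_self]
  filter_upwards [h2, ae_restrict_mem hU.measurableSet] with x hx hxU
  exact sub_eq_zero.1 (hx hxU)

lemma IsWeakGrad.ae_eq {U : Set (Eu d)} (hU : IsOpen U) {w : Eu d → ℝ} {G G' : Eu d → Eu d}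
    (h : IsWeakGrad U w G) (h' : IsWeakGrad U w G') (hG : MemLp G 2 (volume.restrict U))
    (hG' : MemLp G' 2 (volume.restrict U)) : G =ᵐ[volume.restrict U] G' := by
  have : ∀ᵐ x ∂(volume.restrict U), ∀ i, G x i = G' x i := by
    rw [ae_all_iff]
    intro i
    refine ae_eq_of_forall_isTest hU (memLp_coord hG i) (memLp_coord hG' i) fun φ hφ => ?_
    have := h φ hφ i
    rw [h' φ hφ i] at this
    linarith
  filter_upwards [this] with x hx
  ext i; exact hx i

lemma IsWeakDiv.ae_eq {U : Set (Eu d)} (hU : IsOpen U) {v : Eu d → Eu d} {g g' : Eu d → ℝ}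
    (h : IsWeakDiv U v g) (h' : IsWeakDiv U v g') (hg : MemLp g 2 (volume.restrict U))
    (hg' : MemLp g' 2 (volume.restrict U)) : g =ᵐ[volume.restrict U] g' := by
  refine ae_eq_of_forall_isTest hU hg hg' fun φ hφ => ?_
  have := h φ hφ
  rw [h' φ hφ] at this
  linarith

/-- `weakDiv` is an arbitrary choice; uniqueness allows any known `L²` divergence to replace it. -/
lemma weakDiv_ae_eq {U : Set (Eu d)} (hU : IsOpen U) {v : Eu d → Eu d} {g : Eu d → ℝ}
    (hg : MemLp g 2 (volume.restrict U)) (h : IsWeakDiv U v g) :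
    weakDiv U v =ᵐ[volume.restrict U] g := by
  have h0 : ∃ g, MemLp g 2 (volume.restrict U) ∧ IsWeakDiv U v g := ⟨g, hg, h⟩
  rw [weakDiv, dif_pos h0]
  exact h0.choose_spec.2.ae_eq hU h h0.choose_spec.1 hg

/-- Integrals against test functions do not see the rest of the space. -/
lemma setIntegral_eq_of_subset {U V : Set (Eu d)} (hU : MeasurableSet U) (hUV : U ⊆ V)
    {f : Eu d → ℝ} (hf : ∀ x, x ∉ U → f x = 0) : ∫ x in V, f x = ∫ x in U, f x := by
  have h := setIntegral_eq_integral_of_forall_compl_eq_zero (μ := volume.restrict V) hf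
  rw [Measure.restrict_restrict hU, Set.inter_eq_left.2 hUV] at h
  exact h.symm

lemma IsWeakGrad.mono {U V : Set (Eu d)} (hU : MeasurableSet U) (hUV : U ⊆ V) {w : Eu d → ℝ}
    {G : Eu d → Eu d} (h : IsWeakGrad V w G) : IsWeakGrad U w G := by
  intro φ hφ i
  have := h φ (hφ.mono hUV) i
  rwa [setIntegral_eq_of_subset hU hUV fun x hx => by simp [hφ.gradient_eq_zero hx],
    setIntegral_eq_of_subset hU hUV fun x hx => by simp [hφ.eq_zero hx]] at this

lemma IsWeakDiv.mono {U V : Set (Eu d)} (hU : MeasurableSet U) (hUV : U ⊆ V) {v : Eu d → Eu d}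
    {g : Eu d → ℝ} (h : IsWeakDiv V v g) : IsWeakDiv U v g := by
  intro φ hφ
  have := h φ (hφ.mono hUV)
  rwa [setIntegral_eq_of_subset hU hUV fun x hx => by simp [hφ.gradient_eq_zero hx],
    setIntegral_eq_of_subset hU hUV fun x hx => by simp [hφ.eq_zero hx]] at this

lemma IsH1Grad.mono {U V : Set (Eu d)} (hU : MeasurableSet U) (hUV : U ⊆ V) {w : Eu d → ℝ}
    {G : Eu d → Eu d} (h : IsH1Grad V w G) : IsH1Grad U w G :=
  ⟨h.1.mono_measure (Measure.restrict_mono hUV le_rfl),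
    h.2.1.mono_measure (Measure.restrict_mono hUV le_rfl), h.2.2.mono hU hUV⟩

lemma IsWeakGrad.congr {U : Set (Eu d)} {w w' : Eu d → ℝ}
    {G G' : Eu d → Eu d} (h : IsWeakGrad U w G) (hw : w =ᵐ[volume.restrict U] w')
    (hG : G =ᵐ[volume.restrict U] G') : IsWeakGrad U w' G' := by
  intro φ hφ i
  have := h φ hφ i
  rwa [integral_congr_ae (g := fun x => w' x * gradient φ x i)
      (by filter_upwards [hw] with x hx; rw [hx]),
    integral_congr_ae (f := fun x => G x i * φ x) (g := fun x => G' x i * φ x)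
      (by filter_upwards [hG] with x hx; rw [hx])] at this

/-- The weak gradient of a smooth function. -/
lemma isWeakGrad_gradient (U : Set (Eu d)) {ψ : Eu d → ℝ} (hψ : ContDiff ℝ 1 ψ) :
    IsWeakGrad U ψ (gradient ψ) := by
  intro φ hφ i
  rw [setIntegral_eq_integral_of_forall_compl_eq_zero
      fun x hx => by simp [hφ.gradient_eq_zero hx],
    setIntegral_eq_integral_of_forall_compl_eq_zero fun x hx => by simp [hφ.eq_zero hx]]
  simp_rw [gradient_apply]
  have hc : HasCompactSupport fun x => fderiv ℝ φ x (EuclideanSpace.single i 1) :=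
    hφ.2.1.fderiv_apply ℝ _
  have h1 : Continuous fun x => fderiv ℝ φ x (EuclideanSpace.single i 1) :=
    (hφ.contDiff_one.continuous_fderiv (by simp)).clm_apply continuous_const
  have h2 : Continuous fun x => fderiv ℝ ψ x (EuclideanSpace.single i 1) :=
    (hψ.continuous_fderiv (by simp)).clm_apply continuous_const
  refine integral_mul_fderiv_eq_neg_fderiv_mul_of_integrable ?_ ?_ ?_ ?_ ?_
  · exact (h2.mul hφ.1.continuous).integrable_of_hasCompactSupport hφ.2.1.mul_left
  · exact (hψ.continuous.mul h1).integrable_of_hasCompactSupport hc.mul_left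
  · exact (hψ.continuous.mul hφ.1.continuous).integrable_of_hasCompactSupport hφ.2.1.mul_left
  · exact fun x _ => hψ.differentiable (by simp) x
  · exact fun x _ => hφ.contDiff_one.differentiable (by simp) x

/-- The weak divergence of a vector field with components in `H¹`. -/
lemma IsWeakGrad.isWeakDiv {U : Set (Eu d)} {v : Eu d → Eu d} {G : Fin d → Eu d → Eu d}
    (h : ∀ i, IsH1Grad U (fun x => v x i) (G i)) : IsWeakDiv U v fun x => ∑ i, G i x i := by
  intro φ hφ
  have e : ∀ x, ⟪v x, gradient φ x⟫_ℝ = ∑ i, v x i * gradient φ x i := fun x => by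
    rw [PiLp.inner_apply]; simp [mul_comm]
  simp_rw [e, Finset.sum_mul]
  rw [integral_finsetSum, integral_finsetSum, ← Finset.sum_neg_distrib]
  · exact Finset.sum_congr rfl fun i _ => (h i).2.2 φ hφ i
  · exact fun i _ => (memLp_coord (h i).2.1 i).integrable_mul (hφ.memLp U)
  · exact fun i _ => (h i).1.integrable_mul (memLp_coord (hφ.memLp_gradient U) i)

/-! ### Smooth functions on simplices -/

lemma memLp_openHull {F : Type*} [NormedAddCommGroup F] [NormedSpace ℝ F]
    [FiniteDimensional ℝ F] (s : Finset (Eu d))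
    {g : Eu d → F} (hg : Continuous g) : MemLp g 2 (volume.restrict (openHull s)) := by
  rw [restrict_openHull]
  obtain ⟨C, hC⟩ := (isCompact_hull s).exists_bound_of_continuousOn hg.continuousOn
  have : IsFiniteMeasure (volume.restrict (hull s)) :=
    ⟨by simpa using (isCompact_hull s).measure_lt_top⟩
  exact MemLp.of_bound hg.aestronglyMeasurable C
    ((ae_restrict_mem (isCompact_hull s).measurableSet).mono fun x hx => hC x hx)

lemma memLp_surf {F : Finset (Eu d)} [IsFiniteMeasure (surf F)] {g : Eu d → ℝ}
    (hg : Continuous g) : MemLp g 2 (surf F) := by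
  obtain ⟨C, hC⟩ := (isCompact_hull F).exists_bound_of_continuousOn hg.continuousOn
  exact MemLp.of_bound hg.aestronglyMeasurable C ((ae_surf_mem F).mono fun x hx => hC x hx)

lemma isH1Grad_gradient (s : Finset (Eu d)) {ψ : Eu d → ℝ} (hψ : ContDiff ℝ 1 ψ) :
    IsH1Grad (openHull s) ψ (gradient ψ) :=
  ⟨memLp_openHull s hψ.continuous, memLp_openHull s (continuous_gradient hψ),
    isWeakGrad_gradient _ hψ⟩

/-- By Hölder, `L²` convergence of one factor gives `L¹` convergence of the product. This carries
Green's formula from smooth functions to `H¹`. -/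
lemma tendsto_integral_mul {μ : Measure (Eu d)} {φ : ℕ → Eu d → ℝ} {w g : Eu d → ℝ}
    (hφ : ∀ n, MemLp (φ n) 2 μ) (hw : MemLp w 2 μ) (hg : MemLp g 2 μ)
    (h : Tendsto (fun n => eLpNorm (fun x => φ n x - w x) 2 μ) atTop (𝓝 0)) :
    Tendsto (fun n => ∫ x, φ n x * g x ∂μ) atTop (𝓝 (∫ x, w x * g x ∂μ)) := by
  refine tendsto_integral_of_L1' _ (hw.integrable_mul hg).1
    (Eventually.of_forall fun n => (hφ n).integrable_mul hg) ?_
  have hb : Tendsto (fun n => eLpNorm (fun x => φ n x - w x) 2 μ * eLpNorm g 2 μ) atTop (𝓝 0) := by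
    have := ENNReal.Tendsto.mul_const (b := eLpNorm g 2 μ) h (Or.inr hg.2.ne)
    simpa using this
  refine tendsto_of_tendsto_of_tendsto_of_le_of_le tendsto_const_nhds hb (fun _ => bot_le)
    fun n => ?_
  have := eLpNorm_smul_le_mul_eLpNorm (r := 1) (p := 2) (q := 2) hg.1 ((hφ n).sub hw).1
  refine le_of_eq_of_le ?_ this
  congr 1
  ext x
  simp [sub_mul]

/-! ### Traces on the facets of a simplex -/

lemma eLpNorm_two_sq {F : Type*} [NormedAddCommGroup F] {μ : Measure (Eu d)} {f : Eu d → F}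
    (hf : MemLp f 2 μ) : eLpNorm f 2 μ ^ 2 = ENNReal.ofReal (∫ x, ‖f x‖ ^ 2 ∂μ) := by
  rw [hf.eLpNorm_eq_integral_rpow_norm two_ne_zero ENNReal.ofNat_ne_top,
    ← ENNReal.ofReal_pow (by positivity)]
  congr 1
  simp only [ENNReal.toReal_ofNat, Real.rpow_ofNat]
  rw [← Real.rpow_natCast, ← Real.rpow_mul (by positivity)]
  norm_num

namespace IsSimplex

variable {s : Finset (Eu d)}

/-- The trace inequality for smooth functions. -/
lemma exists_trace_bound (hs : IsSimplex s) (hd : 0 < d) (v : s) :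
    ∃ C : NNReal, ∀ ψ : Eu d → ℝ, ContDiff ℝ 1 ψ →
      eLpNorm ψ 2 (surf (s.erase v)) ≤ C * (eLpNorm ψ 2 (volume.restrict (openHull s)) +
        eLpNorm (gradient ψ) 2 (volume.restrict (openHull s))) := by
  have := hs.isFiniteMeasure_surf hd v
  have hpos : 0 < ‖hs.grad v‖ := norm_pos_iff.2 (hs.grad_ne_zero hd v)
  obtain ⟨R, hR⟩ := (isCompact_hull s).exists_bound_of_continuousOn
    (f := fun x => x - (v : Eu d)) (by fun_prop)
  set D : ℝ := ‖hs.grad v‖ * (d + 1 + R ^ 2) with hD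
  have hD0 : 0 ≤ D := by positivity
  refine ⟨Real.toNNReal (Real.sqrt D), fun ψ hψ => ?_⟩
  have hg := continuous_gradient hψ
  have hc := hψ.continuous
  set A := ∫ x in openHull s, ‖ψ x‖ ^ 2 with hA
  set B := ∫ x in openHull s, ‖gradient ψ x‖ ^ 2 with hB
  have hA0 : 0 ≤ A := integral_nonneg fun x => by positivity
  have hB0 : 0 ≤ B := integral_nonneg fun x => by positivity
  -- Apply `integral_cone` to `ψ ^ 2`: the field `x - v` has flux only through the facet opposite
  -- `v`.
  have hmain : ∫ x, ‖ψ x‖ ^ 2 ∂(surf (s.erase v)) ≤ D * (A + B) := by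
    have h1 := hs.integral_cone hd v (hψ.pow 2)
    have hfd : ∀ x, fderiv ℝ (fun x => ψ x ^ 2) x (x - v) =
        2 * ψ x * ⟪gradient ψ x, x - v⟫_ℝ := fun x => by
      rw [fderiv_fun_pow _ (hψ.differentiable (by simp) x), inner_gradient]
      simp
    have h2 : ∫ x in hull s, (d * ψ x ^ 2 + fderiv ℝ (fun x => ψ x ^ 2) x (x - v)) ≤
        ∫ x in hull s, ((d + 1) * ‖ψ x‖ ^ 2 + R ^ 2 * ‖gradient ψ x‖ ^ 2) := by
      refine setIntegral_mono_on (integrableOn_hull ?_) (integrableOn_hull (by fun_prop))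
        (isCompact_hull s).measurableSet fun x hx => ?_
      · simp_rw [hfd]; fun_prop
      · rw [hfd, Real.norm_eq_abs, sq_abs]
        have h3 : |⟪gradient ψ x, x - v⟫_ℝ| ≤ ‖gradient ψ x‖ * R :=
          (abs_real_inner_le_norm _ _).trans
            (mul_le_mul_of_nonneg_left (hR x hx) (norm_nonneg _))
        have h4 : ⟪gradient ψ x, x - v⟫_ℝ ^ 2 ≤ (‖gradient ψ x‖ * R) ^ 2 := by
          rw [← sq_abs]; gcongr
        -- Young's inequality `2ab ≤ a² + b²`; it accounts for the constants `d + 1` and `R ^ 2` in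
        -- `D`.
        nlinarith [sq_nonneg (ψ x - ⟪gradient ψ x, x - v⟫_ℝ)]
    have h5 : ∫ x in hull s, ((d + 1) * ‖ψ x‖ ^ 2 + R ^ 2 * ‖gradient ψ x‖ ^ 2) =
        (d + 1) * A + R ^ 2 * B := by
      rw [hA, hB, restrict_openHull, integral_add (integrableOn_hull (by fun_prop))
        (integrableOn_hull (by fun_prop)), integral_const_mul, integral_const_mul]
    rw [h1, h5] at h2
    have h6 : ∫ x, ‖ψ x‖ ^ 2 ∂(surf (s.erase v)) = ∫ x, ψ x ^ 2 ∂(surf (s.erase v)) := by simp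
    rw [h6]
    rw [inv_mul_le_iff₀ hpos] at h2
    refine h2.trans ?_
    rw [hD, mul_assoc]
    refine mul_le_mul_of_nonneg_left ?_ hpos.le
    have : 0 ≤ (d : ℝ) := Nat.cast_nonneg d
    nlinarith [mul_nonneg (sq_nonneg R) hA0, mul_nonneg this hB0]
  rw [← ENNReal.pow_le_pow_left_iff two_ne_zero, eLpNorm_two_sq (memLp_surf hc), mul_pow]
  have h7 : eLpNorm ψ 2 (volume.restrict (openHull s)) ^ 2 +
      eLpNorm (gradient ψ) 2 (volume.restrict (openHull s)) ^ 2 ≤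
      (eLpNorm ψ 2 (volume.restrict (openHull s)) +
        eLpNorm (gradient ψ) 2 (volume.restrict (openHull s))) ^ 2 := by
    rw [add_sq, add_right_comm]
    exact le_self_add
  refine le_trans ?_ (mul_le_mul_right h7 _)
  rw [eLpNorm_two_sq (memLp_openHull s hc), eLpNorm_two_sq (memLp_openHull s hg),
    ← ENNReal.ofReal_add hA0 hB0]
  have h8 : ((Real.toNNReal (Real.sqrt D) : NNReal) : ENNReal) ^ 2 = ENNReal.ofReal D := by
    rw [← ENNReal.ofReal, ← ENNReal.ofReal_pow (by positivity), Real.sq_sqrt hD0]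
  rw [h8, ← ENNReal.ofReal_mul hD0]
  exact ENNReal.ofReal_le_ofReal hmain

/-- Sequences with the same limit in `H¹` have the same limit in `L²` of a facet. -/
lemma tendsto_trace_sub (hs : IsSimplex s) (hd : 0 < d) (v : s) {ι : Type*} {l : Filter ι}
    {w : Eu d → ℝ} {G : Eu d → Eu d} {φ ψ : ι → Eu d → ℝ}
    (hw : AEStronglyMeasurable w (volume.restrict (openHull s)))
    (hG : AEStronglyMeasurable G (volume.restrict (openHull s)))
    (hφ : ∀ n, ContDiff ℝ 1 (φ n)) (hψ : ∀ n, ContDiff ℝ 1 (ψ n))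
    (h1 : Tendsto (fun n => eLpNorm (fun x => φ n x - w x) 2 (volume.restrict (openHull s))) l
      (𝓝 0))
    (h2 : Tendsto (fun n => eLpNorm (fun x => gradient (φ n) x - G x) 2
      (volume.restrict (openHull s))) l (𝓝 0))
    (h3 : Tendsto (fun n => eLpNorm (fun x => ψ n x - w x) 2 (volume.restrict (openHull s))) l
      (𝓝 0))
    (h4 : Tendsto (fun n => eLpNorm (fun x => gradient (ψ n) x - G x) 2
      (volume.restrict (openHull s))) l (𝓝 0)) :
    Tendsto (fun n => eLpNorm (fun x => φ n x - ψ n x) 2 (surf (s.erase v))) l (𝓝 0) := by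
  obtain ⟨C, hC⟩ := hs.exists_trace_bound hd v
  have hlim : Tendsto (fun n => (C : ENNReal) *
      ((eLpNorm (fun x => φ n x - w x) 2 (volume.restrict (openHull s)) +
        eLpNorm (fun x => ψ n x - w x) 2 (volume.restrict (openHull s))) +
      (eLpNorm (fun x => gradient (φ n) x - G x) 2 (volume.restrict (openHull s)) +
        eLpNorm (fun x => gradient (ψ n) x - G x) 2 (volume.restrict (openHull s))))) l (𝓝 0) := by
    have := ENNReal.Tendsto.const_mul (a := (C : ENNReal)) ((h1.add h3).add (h2.add h4))
      (Or.inr ENNReal.coe_ne_top)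
    simpa using this
  refine tendsto_of_tendsto_of_tendsto_of_le_of_le tendsto_const_nhds hlim (fun _ => bot_le)
    fun n => ?_
  refine (hC _ ((hφ n).sub (hψ n))).trans ?_
  gcongr
  · have e : (fun x => φ n x - ψ n x) =
        (fun x => φ n x - w x) - fun x => ψ n x - w x := by ext x; simp
    rw [e]
    exact eLpNorm_sub_le ((hφ n).continuous.aestronglyMeasurable.sub hw)
      ((hψ n).continuous.aestronglyMeasurable.sub hw) one_le_two
  · have e : gradient (fun x => φ n x - ψ n x) =
        (fun x => gradient (φ n) x - G x) - fun x => gradient (ψ n) x - G x := by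
      ext1 x; rw [gradient_sub (hφ n) (hψ n)]; simp
    rw [e]
    exact eLpNorm_sub_le ((continuous_gradient (hφ n)).aestronglyMeasurable.sub hG)
      ((continuous_gradient (hψ n)).aestronglyMeasurable.sub hG) one_le_two

end IsSimplex

/-- `TendstoH1` hides the limit gradient behind an existential; almost everywhere uniqueness lets it
be any prescribed one. -/
lemma TendstoH1.tendsto_gradient {U : Set (Eu d)} (hU : IsOpen U) {φ : ℕ → Eu d → ℝ}
    {w : Eu d → ℝ} {G : Eu d → Eu d} (h : TendstoH1 U φ w) (hG : IsH1Grad U w G) :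
    Tendsto (fun n => eLpNorm (fun x => gradient (φ n) x - G x) 2 (volume.restrict U))
      atTop (𝓝 0) := by
  obtain ⟨G', hG', _, h2⟩ := h
  refine h2.congr fun n => eLpNorm_congr_ae ?_
  filter_upwards [hG.2.2.ae_eq hU hG'.2.2 hG.2.1 hG'.2.1] with x hx
  rw [hx]

lemma TendstoH1.mono {U V : Set (Eu d)} (hU : MeasurableSet U) (hUV : U ⊆ V) {φ : ℕ → Eu d → ℝ}
    {w : Eu d → ℝ} (h : TendstoH1 V φ w) : TendstoH1 U φ w := by
  obtain ⟨G, hG, h1, h2⟩ := h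
  have hm := Measure.restrict_mono hUV (le_refl (volume : Measure (Eu d)))
  exact ⟨G, hG.mono hU hUV,
    tendsto_of_tendsto_of_tendsto_of_le_of_le tendsto_const_nhds h1 (fun _ => bot_le)
      fun n => eLpNorm_mono_measure _ hm,
    tendsto_of_tendsto_of_tendsto_of_le_of_le tendsto_const_nhds h2 (fun _ => bot_le)
      fun n => eLpNorm_mono_measure _ hm⟩

namespace IsSimplex

variable {s : Finset (Eu d)}

/-- Limits in `H¹` of smooth functions have a trace. -/
lemma exists_isTrace (hs : IsSimplex s) (hd : 0 < d) (v : s) {w : Eu d → ℝ} {φ : ℕ → Eu d → ℝ}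
    (hφ : ∀ n, ContDiff ℝ ∞ (φ n)) (h : TendstoH1 (openHull s) φ w) :
    ∃ g, IsTrace s (s.erase v) w g := by
  have := hs.isFiniteMeasure_surf hd v
  have hφ1 : ∀ n, ContDiff ℝ 1 (φ n) := fun n => (hφ n).of_le (by simp)
  obtain ⟨G, hG, h1, h2⟩ := h
  have hm : ∀ n, MemLp (φ n) 2 (surf (s.erase v)) := fun n => memLp_surf (hφ n).continuous
  -- Comparing the sequence with itself over the index set `ℕ × ℕ` makes `tendsto_trace_sub` the
  -- Cauchy property.
  have hcau : CauchySeq fun n => (hm n).toLp (φ n) := by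
    rw [cauchySeq_iff_tendsto_dist_atTop_0]
    have hfst : Tendsto Prod.fst (atTop : Filter (ℕ × ℕ)) atTop := by
      rw [← prod_atTop_atTop_eq]; exact tendsto_fst
    have hsnd : Tendsto Prod.snd (atTop : Filter (ℕ × ℕ)) atTop := by
      rw [← prod_atTop_atTop_eq]; exact tendsto_snd
    have h3 := hs.tendsto_trace_sub hd v (l := (atTop : Filter (ℕ × ℕ)))
      (φ := fun n => φ n.1) (ψ := fun n => φ n.2) hG.1.1 hG.2.1.1 (fun n => hφ1 n.1)
      (fun n => hφ1 n.2) (h1.comp hfst) (h2.comp hfst)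
      (h1.comp hsnd) (h2.comp hsnd)
    have h4 := (ENNReal.tendsto_toReal ENNReal.zero_ne_top).comp h3
    refine h4.congr fun n => ?_
    rw [Lp.dist_def]
    simp only [Function.comp_apply]
    congr 1
    refine eLpNorm_congr_ae ?_
    filter_upwards [(hm n.1).coeFn_toLp, (hm n.2).coeFn_toLp] with x hx hx'
    simp [hx, hx']
  obtain ⟨g, hg⟩ := cauchySeq_tendsto_of_complete hcau
  refine ⟨g, Lp.memLp g, φ, hφ, ⟨G, hG, h1, h2⟩, ?_⟩
  rw [tendsto_iff_edist_tendsto_0] at hg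
  refine hg.congr fun n => ?_
  rw [Lp.edist_def]
  refine eLpNorm_congr_ae ?_
  filter_upwards [(hm n).coeFn_toLp] with x hx
  simp [hx]

/-- The restrictions to a facet of any smooth approximations converge to the trace. -/
lemma tendsto_isTrace (hs : IsSimplex s) (hd : 0 < d) (v : s) {w g : Eu d → ℝ}
    (hg : IsTrace s (s.erase v) w g) {φ : ℕ → Eu d → ℝ} (hφ : ∀ n, ContDiff ℝ 1 (φ n))
    (h : TendstoH1 (openHull s) φ w) :
    Tendsto (fun n => eLpNorm (fun x => φ n x - g x) 2 (surf (s.erase v))) atTop (𝓝 0) := by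
  have := hs.isFiniteMeasure_surf hd v
  obtain ⟨hg2, ψ, hψ, hψw, hψg⟩ := hg
  have hψ1 : ∀ n, ContDiff ℝ 1 (ψ n) := fun n => (hψ n).of_le (by simp)
  have h2 := hψw
  obtain ⟨G, hG, h1, h1'⟩ := h
  have h3 := hs.tendsto_trace_sub hd v hG.1.1 hG.2.1.1 hφ hψ1 h1 h1'
    (let ⟨_, _, h, _⟩ := hψw; h) (hψw.tendsto_gradient (isOpen_openHull s) hG)
  have h4 := h3.add hψg
  rw [add_zero] at h4
  refine tendsto_of_tendsto_of_tendsto_of_le_of_le tendsto_const_nhds h4 (fun _ => bot_le)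
    fun n => ?_
  have e : (fun x => φ n x - g x) = (fun x => φ n x - ψ n x) + fun x => ψ n x - g x := by
    ext x; simp
  rw [e]
  exact eLpNorm_add_le
    ((hφ n).continuous.aestronglyMeasurable.sub (hψ1 n).continuous.aestronglyMeasurable)
    ((hψ1 n).continuous.aestronglyMeasurable.sub hg2.1) one_le_two

end IsSimplex

/-- Limits in `L²` are unique. -/
lemma ae_eq_of_tendsto_eLpNorm {μ : Measure (Eu d)} {φ : ℕ → Eu d → ℝ} {g g' : Eu d → ℝ}
    (hφ : ∀ n, AEStronglyMeasurable (φ n) μ) (hg : MemLp g 2 μ) (hg' : MemLp g' 2 μ)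
    (h : Tendsto (fun n => eLpNorm (fun x => φ n x - g x) 2 μ) atTop (𝓝 0))
    (h' : Tendsto (fun n => eLpNorm (fun x => φ n x - g' x) 2 μ) atTop (𝓝 0)) : g =ᵐ[μ] g' := by
  have h0 : eLpNorm (g' - g) 2 μ = 0 := by
    have h4 := h.add h'
    rw [add_zero] at h4
    refine le_antisymm (ge_of_tendsto' h4 fun n => ?_) bot_le
    have e : g' - g = (fun x => φ n x - g x) - fun x => φ n x - g' x := by ext x; simp
    rw [e]
    exact eLpNorm_sub_le ((hφ n).sub hg.1) ((hφ n).sub hg'.1) one_le_two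
  rw [eLpNorm_eq_zero_iff (hg'.sub hg).1 two_ne_zero] at h0
  filter_upwards [h0] with x hx
  exact (sub_eq_zero.1 hx).symm

namespace IsSimplex

variable {s : Finset (Eu d)}

/-- The smooth sequence defining `g` also converges to the chosen trace, and `L²` limits are unique.
-/
lemma trace_ae_eq (hs : IsSimplex s) (hd : 0 < d) (v : s) {w g : Eu d → ℝ}
    (hg : IsTrace s (s.erase v) w g) : trace s (s.erase v) w =ᵐ[surf (s.erase v)] g := by
  have h0 : ∃ g, IsTrace s (s.erase v) w g := ⟨g, hg⟩
  rw [trace, dif_pos h0]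
  obtain ⟨hg2, ψ, hψ, hψw, hψg⟩ := hg
  exact ae_eq_of_tendsto_eLpNorm (fun n => (hψ n).continuous.aestronglyMeasurable)
    h0.choose_spec.1 hg2 (hs.tendsto_isTrace hd v h0.choose_spec
      (fun n => (hψ n).of_le (by simp)) hψw) hψg

lemma isTrace_trace {s F : Finset (Eu d)} {w : Eu d → ℝ} (h : ∃ g, IsTrace s F w g) :
    IsTrace s F w (trace s F w) := by
  rw [trace, dif_pos h]
  exact h.choose_spec

/-- The trace of a function that is smooth on a simplex. -/
lemma isTrace_of_eq (hs : IsSimplex s) (hd : 0 < d) (v : s) {w ψ : Eu d → ℝ}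
    (hψ : ContDiff ℝ ∞ ψ) (h : ∀ x ∈ openHull s, w x = ψ x) : IsTrace s (s.erase v) w ψ := by
  have := hs.isFiniteMeasure_surf hd v
  have h1 := isH1Grad_gradient s (hψ.of_le (m := 1) (by simp))
  have hae : ψ =ᵐ[volume.restrict (openHull s)] w := by
    filter_upwards [ae_restrict_mem (isOpen_openHull s).measurableSet] with x hx
    exact (h x hx).symm
  refine ⟨memLp_surf hψ.continuous, fun _ => ψ, fun _ => hψ, ⟨gradient ψ,
    ⟨h1.1.ae_eq hae, h1.2.1, h1.2.2.congr hae (ae_eq_refl _)⟩, ?_, by simp⟩, by simp⟩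
  have : eLpNorm (fun x => ψ x - w x) 2 (volume.restrict (openHull s)) = 0 := by
    rw [eLpNorm_congr_ae (g := fun _ => 0)]
    · simp
    · filter_upwards [hae] with x hx; simp [hx]
  simp [this]

/-- Integration by parts on a simplex for a function in `H¹` and a smooth one. -/
lemma integral_isTrace (hs : IsSimplex s) (hd : 0 < d) {w : Eu d → ℝ} {G : Eu d → Eu d}
    (hG : IsH1Grad (openHull s) w G) {g : s → Eu d → ℝ}
    (hg : ∀ v : s, IsTrace s (s.erase v) w (g v)) {η : Eu d → ℝ} (hη : ContDiff ℝ 1 η)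
    (e : Eu d) :
    ∫ x in openHull s, (w x * fderiv ℝ η x e + ⟪G x, e⟫_ℝ * η x) =
      ∑ v : s, ⟪outerNormal s (s.erase v), e⟫_ℝ * ∫ y, g v y * η y ∂(surf (s.erase v)) := by
  have hne : Nonempty s := hs.basis.nonempty
  -- One approximating sequence, taken from any facet, serves all of them, because `tendsto_isTrace`
  -- does not depend on the sequence.
  obtain ⟨_, φ, hφ, hφw, _⟩ := hg hne.some
  have hφ1 : ∀ n, ContDiff ℝ 1 (φ n) := fun n => (hφ n).of_le (by simp)
  have hη' : Continuous fun x => fderiv ℝ η x e :=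
    (hη.continuous_fderiv (by simp)).clm_apply continuous_const
  have hfin := fun v => hs.isFiniteMeasure_surf hd v
  have h1 := hφw.tendsto_gradient (isOpen_openHull s) hG
  obtain ⟨-, -, h0, -⟩ := id hφw
  have mφ : ∀ n, MemLp (φ n) 2 (volume.restrict (openHull s)) :=
    fun n => memLp_openHull s (hφ n).continuous
  have mdφ : ∀ n, MemLp (fun x => ⟪gradient (φ n) x, e⟫_ℝ) 2 (volume.restrict (openHull s)) :=
    fun n => (memLp_openHull s (continuous_gradient (hφ1 n))).inner_const e
  have mη := memLp_openHull s hη.continuous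
  have mη' := memLp_openHull s hη'
  have mG : MemLp (fun x => ⟪G x, e⟫_ℝ) 2 (volume.restrict (openHull s)) := hG.2.1.inner_const e
  have h1' : Tendsto (fun n => eLpNorm (fun x => ⟪gradient (φ n) x, e⟫_ℝ - ⟪G x, e⟫_ℝ) 2
      (volume.restrict (openHull s))) atTop (𝓝 0) := by
    have hb : Tendsto (fun n => ENNReal.ofReal ‖e‖ * eLpNorm (fun x => gradient (φ n) x - G x) 2
        (volume.restrict (openHull s))) atTop (𝓝 0) := by
      have := ENNReal.Tendsto.const_mul (a := ENNReal.ofReal ‖e‖) h1 (Or.inr ENNReal.ofReal_ne_top)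
      simpa using this
    refine tendsto_of_tendsto_of_tendsto_of_le_of_le tendsto_const_nhds hb (fun _ => bot_le)
      fun n => ?_
    refine eLpNorm_le_mul_eLpNorm_of_ae_le_mul (Eventually.of_forall fun x => ?_) 2
    rw [← inner_sub_left, mul_comm]
    exact norm_inner_le_norm _ _
  have hL := (tendsto_integral_mul mφ hG.1 mη' h0).add (tendsto_integral_mul mdφ mG mη h1')
  have hR1 : ∀ v : s, Tendsto (fun n => ∫ y, φ n y * η y ∂(surf (s.erase v))) atTop
      (𝓝 (∫ y, g v y * η y ∂(surf (s.erase v)))) := fun v =>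
    tendsto_integral_mul (fun n => memLp_surf (hφ n).continuous) (hg v).1
      (memLp_surf hη.continuous) (hs.tendsto_isTrace hd v (hg v) hφ1 hφw)
  have hR := tendsto_finsetSum Finset.univ fun (v : s) _ =>
    (hR1 v).const_mul ⟪outerNormal s (s.erase v), e⟫_ℝ
  rw [integral_add (integrable_fun_mul hG.1 mη') (integrable_fun_mul mG mη)]
  refine tendsto_nhds_unique hL (hR.congr fun n => ?_)
  rw [← hs.integral_mul_fderiv hd (hφ1 n) hη, ← restrict_openHull,
    ← integral_add (integrable_fun_mul (mφ n) mη') (integrable_fun_mul (mdφ n) mη)]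
  simp only [inner_gradient]

end IsSimplex

/-! ### Density of smooth functions in `H¹` of a convex set -/

section Mollify

variable {c : Eu d} (ρ : ContDiffBump c)

/-- The mollifier at scale `ε`, supported away from the origin, in the direction of `-c`. -/
def kernel (ε : ℝ) (ξ : Eu d) : ℝ := (ε ^ d)⁻¹ * ρ.normed volume ((-ε⁻¹) • ξ)

lemma contDiff_kernel (ε : ℝ) : ContDiff ℝ ∞ (kernel ρ ε) :=
  contDiff_const.mul (ρ.contDiff_normed.comp (contDiff_const_smul _))

lemma continuous_kernel (ε : ℝ) : Continuous (kernel ρ ε) := (contDiff_kernel ρ ε).continuous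

lemma kernel_nonneg {ε : ℝ} (hε : 0 < ε) (ξ : Eu d) : 0 ≤ kernel ρ ε ξ :=
  mul_nonneg (by positivity) (ρ.nonneg_normed _)

lemma hasCompactSupport_kernel {ε : ℝ} (hε : 0 < ε) : HasCompactSupport (kernel ρ ε) := by
  have h : HasCompactSupport fun ξ => ρ.normed volume ((-ε⁻¹) • ξ) :=
    ρ.hasCompactSupport_normed.comp_smul (by simpa using hε.ne')
  exact h.mul_left

lemma integral_kernel {ε : ℝ} (hε : 0 < ε) : ∫ ξ, kernel ρ ε ξ = 1 := by
  simp_rw [kernel]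
  rw [integral_const_mul, Measure.integral_comp_smul, ρ.integral_normed, finrank_euclideanSpace_fin]
  rw [smul_eq_mul, mul_one, neg_pow, inv_pow, abs_inv, abs_mul, abs_inv, abs_pow, abs_pow]
  simp [abs_of_pos hε, hε.ne']

/-- Mollifying at `x` samples only points `(1 - ε)x + εz` with `z` near `c`. In a convex set
containing a ball about `c` these stay inside, so no extension across the boundary is needed. -/
lemma mem_of_kernel_ne_zero {ε : ℝ} (hε : 0 < ε) {x t : Eu d}
    (h : kernel ρ ε ((1 - ε) • x - t) ≠ 0) :
    ∃ z ∈ Metric.closedBall c ρ.rOut, t = (1 - ε) • x + ε • z := by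
  refine ⟨(-ε⁻¹) • ((1 - ε) • x - t), ?_, ?_⟩
  · have h1 : ρ.normed volume ((-ε⁻¹) • ((1 - ε) • x - t)) ≠ 0 := right_ne_zero_of_mul h
    have h2 : (-ε⁻¹) • ((1 - ε) • x - t) ∈ Function.support (ρ.normed volume) := h1
    rw [ρ.support_normed_eq] at h2
    exact Metric.ball_subset_closedBall h2
  · rw [smul_smul, mul_neg, mul_inv_cancel₀ hε.ne']
    module

variable {F : Type*} [NormedAddCommGroup F] [NormedSpace ℝ F]

/-- Mollification combined with a contraction towards the point `c`. -/
def mollify (ε : ℝ) (f : Eu d → F) (x : Eu d) : F := ∫ t, kernel ρ ε ((1 - ε) • x - t) • f t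

lemma integrable_kernel_smul {ε : ℝ} (hε : 0 < ε) {f : Eu d → F} (hf : LocallyIntegrable f)
    (X : Eu d) : Integrable fun t => kernel ρ ε (X - t) • f t := by
  refine hf.integrable_smul_left_of_hasCompactSupport ?_ ?_
  · exact (continuous_kernel ρ ε).comp (continuous_const.sub continuous_id)
  · exact (hasCompactSupport_kernel ρ hε).comp_homeomorph (Homeomorph.subLeft X)

lemma integrable_kernel {ε : ℝ} (hε : 0 < ε) : Integrable (kernel ρ ε) :=
  (continuous_kernel ρ ε).integrable_of_hasCompactSupport (hasCompactSupport_kernel ρ hε)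

lemma mollify_sub {ε : ℝ} (hε : 0 < ε) {f g : Eu d → F} (hf : LocallyIntegrable f)
    (hg : LocallyIntegrable g) (x : Eu d) :
    mollify ρ ε (f - g) x = mollify ρ ε f x - mollify ρ ε g x := by
  simp_rw [mollify, Pi.sub_apply, smul_sub]
  exact integral_sub (integrable_kernel_smul ρ hε hf _) (integrable_kernel_smul ρ hε hg _)

lemma mollify_eq_convolution (ε : ℝ) (f : Eu d → F) :
    mollify ρ ε f = (MeasureTheory.convolution f (kernel ρ ε)
      (ContinuousLinearMap.lsmul ℝ ℝ).flip volume) ∘ fun x => (1 - ε) • x := by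
  ext x
  simp [mollify, MeasureTheory.convolution]

lemma contDiff_mollify {ε : ℝ} (hε : 0 < ε) {f : Eu d → F} (hf : LocallyIntegrable f) :
    ContDiff ℝ ∞ (mollify ρ ε f) := by
  rw [mollify_eq_convolution]
  exact ((hasCompactSupport_kernel ρ hε).contDiff_convolution_right _ hf
    (contDiff_kernel ρ ε)).comp (contDiff_const_smul _)

/-- The derivative falls on the kernel; `1 - ε` is the chain rule for the contraction. -/
lemma fderiv_mollify {ε : ℝ} (hε : 0 < ε) {f : Eu d → ℝ} (hf : LocallyIntegrable f)
    (x e : Eu d) : fderiv ℝ (mollify ρ ε f) x e =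
      (1 - ε) * ∫ t, f t * fderiv ℝ (kernel ρ ε) ((1 - ε) • x - t) e := by
  have hk1 : ContDiff ℝ 1 (kernel ρ ε) := (contDiff_kernel ρ ε).of_le (by simp)
  have h1 := (hasCompactSupport_kernel ρ hε).hasFDerivAt_convolution_right
    (ContinuousLinearMap.lsmul ℝ ℝ).flip hf hk1 ((1 - ε) • x)
  have h2 : HasFDerivAt (fun x : Eu d => (1 - ε) • x) ((1 - ε) • ContinuousLinearMap.id ℝ (Eu d))
    x := (hasFDerivAt_id x).const_smul (1 - ε)
  rw [mollify_eq_convolution, (h1.comp x h2).fderiv]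
  simp only [ContinuousLinearMap.coe_comp, Function.comp_apply, smul_apply,
    ContinuousLinearMap.id_apply, map_smul, smul_eq_mul]
  congr 1
  rw [convolution_precompR_apply _ hf ((hasCompactSupport_kernel ρ hε).fderiv ℝ)
    (hk1.continuous_fderiv (by simp))]
  simp [MeasureTheory.convolution, mul_comm]

/-! ### `L²` bounds and convergence of the mollifier -/

/-- Jensen's inequality for the square. -/
lemma lintegral_mul_sq_le {k g : Eu d → ENNReal} (hk : AEMeasurable k) (hg : AEMeasurable g)
    (hk1 : ∫⁻ t, k t = 1) : (∫⁻ t, k t * g t) ^ 2 ≤ ∫⁻ t, k t * g t ^ 2 := by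
  have hac := withDensity_absolutelyContinuous (volume : Measure (Eu d)) k
  -- Cauchy–Schwarz against the constant 1 for the probability measure with density `k`.
  have h := ENNReal.lintegral_mul_le_Lp_mul_Lq (volume.withDensity k) Real.HolderConjugate.two_two
    (hg.mono_ac hac) (aemeasurable_const (b := (1 : ENNReal)))
  have h2 : (volume.withDensity k) Set.univ = 1 := by simp [hk1]
  simp only [Pi.mul_apply, mul_one, ENNReal.one_rpow, lintegral_const, h2] at h
  rw [lintegral_withDensity_eq_lintegral_mul₀ hk hg,
    lintegral_withDensity_eq_lintegral_mul₀ hk (hg.pow_const _)] at h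
  simp only [Pi.mul_apply, ENNReal.rpow_ofNat] at h
  calc (∫⁻ t, k t * g t) ^ 2 ≤ ((∫⁻ t, k t * g t ^ 2) ^ (1 / 2 : ℝ)) ^ 2 := by gcongr
    _ = _ := by
      rw [← ENNReal.rpow_natCast, ← ENNReal.rpow_mul]; norm_num

lemma eLpNorm_two_sq_eq_lintegral {F : Type*} [NormedAddCommGroup F] {μ : Measure (Eu d)}
    (f : Eu d → F) :
    eLpNorm f 2 μ ^ 2 = ∫⁻ x, ‖f x‖ₑ ^ 2 ∂μ := by
  have := eLpNorm_nnreal_pow_eq_lintegral (f := f) (μ := μ) (p := 2) (by simp)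
  simpa using this

/-- Jensen in `t`, then Tonelli: integrating the kernel over `x` costs `(1 - ε)⁻ᵈ ≤ 2ᵈ` because of
the contraction. The density argument needs a bound uniform in `ε`. -/
lemma eLpNorm_mollify_le {ε : ℝ} (hε : 0 < ε) (hε' : ε ≤ 1 / 2) {f : Eu d → F}
    (hf : MemLp f 2 volume) : eLpNorm (mollify ρ ε f) 2 volume ≤ 2 ^ d * eLpNorm f 2 volume := by
  have hk := continuous_kernel ρ ε
  have h1 : ∀ X, ∫⁻ t, ENNReal.ofReal (kernel ρ ε (X - t)) = 1 := fun X => by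
    rw [lintegral_sub_left_eq_self (fun t => ENNReal.ofReal (kernel ρ ε t)) X,
      ← ofReal_integral_eq_lintegral_ofReal (integrable_kernel ρ hε)
        (Eventually.of_forall (kernel_nonneg ρ hε)), integral_kernel ρ hε, ENNReal.ofReal_one]
  have h2 : ∀ t, ∫⁻ x, ENNReal.ofReal (kernel ρ ε ((1 - ε) • x - t)) ≤ (2 ^ d : ENNReal) := by
    intro t
    have hpos : 0 < 1 - ε := by linarith
    have hi : Integrable fun x => kernel ρ ε (x - t) := (integrable_kernel ρ hε).comp_sub_right t
    rw [← ofReal_integral_eq_lintegral_ofReal (hi.comp_smul hpos.ne')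
      (Eventually.of_forall fun x => kernel_nonneg ρ hε _),
      Measure.integral_comp_smul volume (fun x => kernel ρ ε (x - t)), integral_sub_right_eq_self,
      integral_kernel ρ hε, finrank_euclideanSpace_fin, smul_eq_mul, mul_one]
    have h3 : |((1 - ε) ^ d)⁻¹| ≤ 2 ^ d := by
      rw [abs_of_pos (by positivity), ← inv_pow]
      refine pow_le_pow_left₀ (by positivity) ?_ d
      rw [inv_le_comm₀ hpos two_pos]; linarith
    refine (ENNReal.ofReal_le_ofReal h3).trans (le_of_eq ?_)
    rw [ENNReal.ofReal_pow (by norm_num)]; simp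
  rw [← ENNReal.pow_le_pow_left_iff two_ne_zero, mul_pow, eLpNorm_two_sq_eq_lintegral,
    eLpNorm_two_sq_eq_lintegral]
  have hfm : AEMeasurable fun t => ‖f t‖ₑ := hf.1.enorm
  calc ∫⁻ x, ‖mollify ρ ε f x‖ₑ ^ 2
      ≤ ∫⁻ x, ∫⁻ t, ENNReal.ofReal (kernel ρ ε ((1 - ε) • x - t)) * ‖f t‖ₑ ^ 2 := by
        refine lintegral_mono fun x => ?_
        refine le_trans ?_ (lintegral_mul_sq_le (k := fun t =>
          ENNReal.ofReal (kernel ρ ε ((1 - ε) • x - t))) ?_ hfm (h1 _))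
        · gcongr
          refine (enorm_integral_le_lintegral_enorm _).trans (le_of_eq ?_)
          refine lintegral_congr fun t => ?_
          rw [enorm_smul, Real.enorm_of_nonneg (kernel_nonneg ρ hε _)]
        · exact (hk.comp (continuous_const.sub continuous_id)).measurable.ennreal_ofReal.aemeasurable
    _ = ∫⁻ t, ∫⁻ x, ENNReal.ofReal (kernel ρ ε ((1 - ε) • x - t)) * ‖f t‖ₑ ^ 2 := by
        refine lintegral_lintegral_swap ?_
        refine AEMeasurable.mul ?_ ((hfm.pow_const 2).comp_snd)
        have : Continuous fun q : Eu d × Eu d => kernel ρ ε ((1 - ε) • q.1 - q.2) := by fun_prop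
        exact this.measurable.ennreal_ofReal.aemeasurable
    _ ≤ ∫⁻ t, 2 ^ d * ‖f t‖ₑ ^ 2 := by
        refine lintegral_mono fun t => ?_
        rw [lintegral_mul_const]
        · gcongr; exact h2 t
        · have : Continuous fun x : Eu d => kernel ρ ε ((1 - ε) • x - t) := by fun_prop
          exact this.measurable.ennreal_ofReal
    -- The factor is squared wastefully, so that no fractional power of 2 appears in the norm bound.
    _ ≤ (2 ^ d) ^ 2 * ∫⁻ t, ‖f t‖ₑ ^ 2 := by
        rw [lintegral_const_mul'' _ (hfm.pow_const 2)]
        have h4 : (1 : ENNReal) ≤ 2 ^ d := by exact_mod_cast Nat.one_le_two_pow (n := d)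
        exact mul_le_mul' (le_self_pow₀ h4 two_ne_zero) le_rfl

/-- Mollifications of continuous functions converge uniformly on bounded sets. -/
lemma exists_norm_mollify_sub_le [CompleteSpace F] {U : Set (Eu d)} (hU : Bornology.IsBounded U)
    {f : Eu d → F} (hf : Continuous f) (hf' : HasCompactSupport f) {δ : ℝ} (hδ : 0 < δ) :
    ∃ ε₀ > 0, ∀ ε, 0 < ε → ε < ε₀ → ∀ x ∈ U, ‖mollify ρ ε f x - f x‖ ≤ δ := by
  obtain ⟨R, hR⟩ := hU.exists_norm_le
  have huc := hf'.uniformContinuous_of_continuous hf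
  rw [Metric.uniformContinuous_iff] at huc
  obtain ⟨η, hη, hfη⟩ := huc δ hδ
  -- `D` bounds `‖z - x‖` for all sampled `z` and `x ∈ U`, so `ε * D < η` keeps the sample points
  -- within the modulus of continuity.
  set D := ‖c‖ + ρ.rOut + |R| + 1 with hD
  have hD0 : 0 < D := by have := ρ.rOut_pos; positivity
  refine ⟨η / D, by positivity, fun ε hε hεD x hx => ?_⟩
  have hi := integrable_kernel_smul ρ hε hf.locallyIntegrable ((1 - ε) • x)
  have hi' : Integrable fun t => kernel ρ ε ((1 - ε) • x - t) :=
    (integrable_kernel ρ hε).comp_sub_left _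
  have h1 : ∫ t, kernel ρ ε ((1 - ε) • x - t) = 1 := by
    rw [integral_sub_left_eq_self (kernel ρ ε), integral_kernel ρ hε]
  have h2 : mollify ρ ε f x - f x = ∫ t, kernel ρ ε ((1 - ε) • x - t) • (f t - f x) := by
    simp_rw [smul_sub]
    rw [integral_sub hi (hi'.smul_const _), integral_smul_const, h1, one_smul, mollify]
  rw [h2]
  refine (norm_integral_le_of_norm_le (hi'.mul_const δ) (Eventually.of_forall fun t => ?_)).trans
    (le_of_eq (by rw [integral_mul_const, h1, one_mul]))
  rw [norm_smul, Real.norm_of_nonneg (kernel_nonneg ρ hε _)]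
  by_cases h0 : kernel ρ ε ((1 - ε) • x - t) = 0
  · simp [h0]
  refine mul_le_mul_of_nonneg_left ?_ (kernel_nonneg ρ hε _)
  obtain ⟨z, hz, rfl⟩ := mem_of_kernel_ne_zero ρ hε h0
  rw [← dist_eq_norm]
  refine (hfη ?_).le
  have e : (1 - ε) • x + ε • z - x = ε • (z - x) := by module
  rw [dist_eq_norm, e, norm_smul, Real.norm_of_nonneg hε.le]
  have hz' : ‖z‖ ≤ ‖c‖ + ρ.rOut := by
    have := norm_le_norm_add_norm_sub' z c
    rw [Metric.mem_closedBall, dist_eq_norm] at hz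
    linarith
  have h5 : ‖z - x‖ ≤ D := by
    have := norm_sub_le z x
    have := (hR x hx).trans (le_abs_self R)
    linarith
  calc ε * ‖z - x‖ ≤ ε * D := by gcongr
    _ < η := by rwa [lt_div_iff₀ hD0] at hεD

/-- Mollifications converge in `L²` on bounded sets. -/
lemma tendsto_mollify [CompleteSpace F] {U : Set (Eu d)} (hU : Bornology.IsBounded U)
    (hUm : MeasurableSet U)
    {f : Eu d → F} (hf : MemLp f 2 volume) :
    Tendsto (fun ε => eLpNorm (fun x => mollify ρ ε f x - f x) 2 (volume.restrict U))
      (𝓝[>] 0) (𝓝 0) := by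
  rw [ENNReal.tendsto_nhds_zero]
  intro δ hδ
  rcases eq_or_ne δ ⊤ with rfl | hδt
  · simp
  have hD : (2 : ENNReal) ^ d + 1 ≠ ⊤ := by simp
  have hD0 : (2 : ENNReal) ^ d + 1 ≠ 0 := by simp
  have hδ2 : δ / 2 ≠ 0 := (ENNReal.half_pos hδ.ne').ne'
  -- The error `f - g` enters once directly and once mollified, hence with total factor `2 ^ d + 1`;
  -- the other half of `δ` is left for the uniform convergence of `g`.
  obtain ⟨g, hg, hfg, hgc, hg2⟩ := hf.exists_hasCompactSupport_eLpNorm_sub_le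
    ENNReal.ofNat_ne_top (ENNReal.div_pos hδ2 hD).ne'
  have hV : (volume.restrict U) Set.univ ^ (2 : ENNReal).toReal⁻¹ ≠ ⊤ :=
    ENNReal.rpow_ne_top_of_nonneg (by positivity) (by simpa using hU.measure_lt_top.ne)
  obtain ⟨C, hC, hCV⟩ := ENNReal.exists_nnreal_pos_mul_lt hV hδ2
  obtain ⟨ε₀, hε₀, hunif⟩ := exists_norm_mollify_sub_le ρ hU hgc hg (δ := C) (by exact_mod_cast hC)
  have hmem : Set.Ioo 0 (min ε₀ (1 / 2)) ∈ 𝓝[>] (0 : ℝ) := Ioo_mem_nhdsGT (by positivity)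
  filter_upwards [hmem] with ε hε
  have hε1 : ε < ε₀ := hε.2.trans_le (min_le_left _ _)
  have hε2 : ε ≤ 1 / 2 := (hε.2.trans_le (min_le_right _ _)).le
  have hfl := hf.locallyIntegrable one_le_two
  have hgl := hg2.locallyIntegrable one_le_two
  have hm : ∀ {h : Eu d → F}, LocallyIntegrable h → ∀ μ, AEStronglyMeasurable (mollify ρ ε h) μ :=
    fun hh μ => (contDiff_mollify ρ hε.1 hh).continuous.aestronglyMeasurable
  have e : (fun x => mollify ρ ε f x - f x) =
      (mollify ρ ε (f - g) - (f - g)) + fun x => mollify ρ ε g x - g x := by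
    ext1 x
    simp only [Pi.add_apply, Pi.sub_apply, mollify_sub ρ hε.1 hfl hgl]
    abel
  have h1 : eLpNorm (mollify ρ ε (f - g) - (f - g)) 2 (volume.restrict U) ≤ δ / 2 := by
    refine (eLpNorm_mono_measure _ Measure.restrict_le_self).trans ?_
    refine (eLpNorm_sub_le (hm (hfl.sub hgl) _) (hf.sub hg2).1 one_le_two).trans ?_
    calc eLpNorm (mollify ρ ε (f - g)) 2 volume + eLpNorm (f - g) 2 volume
        ≤ 2 ^ d * eLpNorm (f - g) 2 volume + eLpNorm (f - g) 2 volume := by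
          gcongr; exact eLpNorm_mollify_le ρ hε.1 hε2 (hf.sub hg2)
      _ = (2 ^ d + 1) * eLpNorm (f - g) 2 volume := by ring
      _ ≤ (2 ^ d + 1) * (δ / 2 / (2 ^ d + 1)) := by gcongr
      _ = δ / 2 := ENNReal.mul_div_cancel hD0 hD
  have h2 : eLpNorm (fun x => mollify ρ ε g x - g x) 2 (volume.restrict U) ≤ δ / 2 := by
    refine (eLpNorm_le_of_ae_bound (C := C) ?_).trans ?_
    · filter_upwards [ae_restrict_mem hUm] with x hx using hunif ε hε.1 hε1 x hx
    · rw [mul_comm, ENNReal.ofReal_coe_nnreal]; exact hCV.le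
  rw [e]
  refine (eLpNorm_add_le ((hm (hfl.sub hgl) _).sub (hf.sub hg2).1.restrict)
    ((hm hgl _).sub hg2.1.restrict) one_le_two).trans ?_
  exact (add_le_add h1 h2).trans (ENNReal.add_halves δ).le

lemma mollify_apply {ε : ℝ} (hε : 0 < ε) {G : Eu d → Eu d} (hG : LocallyIntegrable G) (x : Eu d)
    (i : Fin d) : mollify ρ ε G x i = mollify ρ ε (fun y => G y i) x := by
  have := (EuclideanSpace.proj (𝕜 := ℝ) i).integral_comp_comm
    (integrable_kernel_smul ρ hε hG ((1 - ε) • x))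
  simpa [mollify] using this.symm

/-- On a convex set, the mollifier used here commutes with weak gradients. -/
lemma gradient_mollify {U : Set (Eu d)} (hU : IsOpen U) (hconv : Convex ℝ U)
    (hc : Metric.closedBall c ρ.rOut ⊆ U) {w : Eu d → ℝ} {G : Eu d → Eu d} (h : IsH1Grad U w G)
    {ε : ℝ} (hε : 0 < ε) (hε1 : ε < 1) {x : Eu d} (hx : x ∈ U) :
    gradient (mollify ρ ε (U.indicator w)) x = (1 - ε) • mollify ρ ε (U.indicator G) x := by
  have hw : MemLp (U.indicator w) 2 volume := (memLp_indicator_iff_restrict hU.measurableSet).2 h.1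
  have hG : MemLp (U.indicator G) 2 volume :=
    (memLp_indicator_iff_restrict hU.measurableSet).2 h.2.1
  ext i
  rw [gradient_apply, fderiv_mollify ρ hε (hw.locallyIntegrable one_le_two), PiLp.smul_apply,
    smul_eq_mul, mollify_apply ρ hε (hG.locallyIntegrable one_le_two)]
  congr 1
  set φ : Eu d → ℝ := fun t => kernel ρ ε ((1 - ε) • x - t) with hφ
  -- Convexity enters here: the support consists of convex combinations of `x` and points of the
  -- ball, so the kernel is an admissible test function in `t`.
  have hsupp : tsupport φ ⊆ U := by
    have hK : IsCompact ((fun z => (1 - ε) • x + ε • z) '' Metric.closedBall c ρ.rOut) :=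
      (isCompact_closedBall c _).image (by fun_prop)
    refine Set.Subset.trans (closure_minimal (fun t ht => ?_) hK.isClosed) ?_
    · obtain ⟨z, hz, e⟩ := mem_of_kernel_ne_zero ρ hε ht
      exact ⟨z, hz, e.symm⟩
    · rintro _ ⟨z, hz, rfl⟩
      exact hconv hx (hc hz) (by linarith) hε.le (by ring)
  have ht : IsTest U φ := ⟨(contDiff_kernel ρ ε).comp (contDiff_const.sub contDiff_id),
    (hasCompactSupport_kernel ρ hε).comp_homeomorph (Homeomorph.subLeft ((1 - ε) • x)), hsupp⟩
  have hgrad : ∀ t, gradient φ t i =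
      -fderiv ℝ (kernel ρ ε) ((1 - ε) • x - t) (EuclideanSpace.single i 1) := fun t => by
    rw [gradient_apply, hφ]
    have h1 := ((contDiff_kernel ρ ε).differentiable (by simp)
      ((1 - ε) • x - t)).hasFDerivAt.comp t ((hasFDerivAt_id t).const_sub ((1 - ε) • x))
    have h2 := h1.fderiv
    simp only [Function.comp_def] at h2
    rw [h2]
    simp
  -- The sign from differentiating in `t` instead of `x` cancels the sign in the weak gradient.
  have key := h.2.2 φ ht i
  simp_rw [hgrad, mul_neg, integral_neg, neg_inj] at key
  rw [← integral_indicator hU.measurableSet, ← integral_indicator hU.measurableSet] at key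
  rw [mollify]
  refine (integral_congr_ae (Eventually.of_forall fun t => ?_)).trans
    (key.trans (integral_congr_ae (Eventually.of_forall fun t => ?_)))
  · by_cases htU : t ∈ U <;> simp [htU]
  · by_cases htU : t ∈ U <;> simp [htU, hφ, mul_comm]

end Mollify

/-- Smooth functions are dense in `H¹(U)` for convex `U`. -/
lemma exists_tendstoH1 {U : Set (Eu d)} (hU : IsOpen U) (hconv : Convex ℝ U)
    (hb : Bornology.IsBounded U) (hne : U.Nonempty) {w : Eu d → ℝ} {G : Eu d → Eu d}
    (h : IsH1Grad U w G) : ∃ φ : ℕ → Eu d → ℝ, (∀ n, ContDiff ℝ ∞ (φ n)) ∧ TendstoH1 U φ w := by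
  obtain ⟨c, hc⟩ := hne
  obtain ⟨r, hr, hrU⟩ := Metric.nhds_basis_closedBall.mem_iff.1 (hU.mem_nhds hc)
  let ρ : ContDiffBump c := ⟨r / 2, r, by positivity, by linarith⟩
  have hm := hU.measurableSet
  have hw : MemLp (U.indicator w) 2 volume := (memLp_indicator_iff_restrict hm).2 h.1
  have hG : MemLp (U.indicator G) 2 volume := (memLp_indicator_iff_restrict hm).2 h.2.1
  have hwl := hw.locallyIntegrable one_le_two
  have hGl := hG.locallyIntegrable one_le_two
  -- The shift by 2 keeps `ε n ≤ 1 / 2`, the range of the uniform `L²` bound.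
  let ε : ℕ → ℝ := fun n => 1 / ((n : ℝ) + 2)
  have hε0 : ∀ n, 0 < ε n := fun n => by positivity
  have hε2 : ∀ n, ε n ≤ 1 / 2 := fun n => by
    refine one_div_le_one_div_of_le two_pos ?_
    have : (0 : ℝ) ≤ n := Nat.cast_nonneg n
    linarith
  have hεlim0 : Tendsto ε atTop (𝓝 0) :=
    tendsto_const_nhds.div_atTop (tendsto_natCast_atTop_atTop.atTop_add tendsto_const_nhds)
  have hεlim : Tendsto ε atTop (𝓝[>] 0) :=
    tendsto_nhdsWithin_iff.2 ⟨hεlim0, Eventually.of_forall hε0⟩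
  refine ⟨fun n => mollify ρ (ε n) (U.indicator w), fun n => contDiff_mollify ρ (hε0 n) hwl,
    G, h, ?_, ?_⟩
  · refine ((tendsto_mollify ρ hb hm hw).comp hεlim).congr fun n => eLpNorm_congr_ae ?_
    filter_upwards [ae_restrict_mem hm] with x hx
    simp [hx]
  · have h1 := (tendsto_mollify ρ hb hm hG).comp hεlim
    have h2 : Tendsto (fun n => ENNReal.ofReal (ε n) * (2 ^ d * eLpNorm (U.indicator G) 2 volume))
        atTop (𝓝 0) := by
      have := ENNReal.Tendsto.mul_const (b := 2 ^ d * eLpNorm (U.indicator G) 2 volume)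
        (ENNReal.tendsto_ofReal hεlim0)
        (Or.inr (ENNReal.mul_ne_top (by simp) hG.2.ne))
      simpa using this
    have h3 := h1.add h2
    rw [add_zero] at h3
    refine tendsto_of_tendsto_of_tendsto_of_le_of_le tendsto_const_nhds h3 (fun _ => bot_le)
      fun n => ?_
    have hmm : AEStronglyMeasurable (mollify ρ (ε n) (U.indicator G)) (volume.restrict U) :=
      (contDiff_mollify ρ (hε0 n) hGl).continuous.aestronglyMeasurable
    -- The factor `1 - ε` from the contraction leaves an extra term of order `ε`, controlled by the
    -- uniform bound.
    have e : (fun x => gradient (mollify ρ (ε n) (U.indicator w)) x - G x)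
        =ᵐ[volume.restrict U] (fun x => mollify ρ (ε n) (U.indicator G) x - U.indicator G x) -
          ε n • mollify ρ (ε n) (U.indicator G) := by
      filter_upwards [ae_restrict_mem hm] with x hx
      rw [gradient_mollify ρ hU hconv hrU h (hε0 n) ((hε2 n).trans_lt (by norm_num)) hx]
      simp only [Pi.sub_apply, Pi.smul_apply, Set.indicator_of_mem hx]
      module
    simp only
    rw [eLpNorm_congr_ae e]
    refine (eLpNorm_sub_le (hmm.sub hG.1.restrict) (hmm.const_smul _) one_le_two).trans ?_
    refine add_le_add le_rfl ?_
    rw [eLpNorm_const_smul, Real.enorm_of_nonneg (hε0 n).le]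
    gcongr
    exact (eLpNorm_mono_measure _ Measure.restrict_le_self).trans
      (eLpNorm_mollify_le ρ (hε0 n) (hε2 n) hG)

namespace IsSimplex

variable {s : Finset (Eu d)}

/-- Density on the convex open simplex makes every `H¹` function a limit of smooth ones, so `trace`
is a genuine trace and not its default value. -/
lemma isTrace_of_isH1Grad (hs : IsSimplex s) (hd : 0 < d) (v : s) {w : Eu d → ℝ}
    {G : Eu d → Eu d} (h : IsH1Grad (openHull s) w G) :
    IsTrace s (s.erase v) w (trace s (s.erase v) w) := by
  obtain ⟨φ, hφ, hφw⟩ := exists_tendstoH1 (isOpen_openHull s) (convex_convexHull ℝ _).interior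
    ((isCompact_hull s).isBounded.subset (openHull_subset s)) hs.openHull_nonempty h
  exact isTrace_trace (hs.exists_isTrace hd v hφ hφw)

end IsSimplex

/-! ### Geometry of a triangulation -/

/-- A Lipschitz domain lies on one side of its boundary. -/
lemma IsLipschitzDomain.interior_closure_subset {Ω : Set (Eu d)} (hΩ : IsLipschitzDomain Ω) :
    interior (closure Ω) ⊆ Ω := by
  intro x hx
  by_contra hxΩ
  have hfr : x ∈ frontier Ω := ⟨interior_subset hx, by rwa [hΩ.isOpen.interior_eq]⟩
  obtain ⟨e, γ, L, r, he, hγ, hinv, hr, hiff⟩ := hΩ.lipschitz x hfr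
  have hγx : ⟪e, x⟫_ℝ ≤ γ x := by
    by_contra! h
    exact hxΩ ((hiff x (Metric.mem_ball_self hr)).2 h)
  obtain ⟨δ, hδ, hδs⟩ := Metric.isOpen_iff.1 isOpen_interior x hx
  -- Descending from `x` by `t` along `-e` stays in the interior of the closure but goes at least
  -- `t` below the graph value `γ x`. Points of `Ω` nearby would have to lie above the graph.
  set t := min δ r / 2 with ht
  have ht0 : 0 < t := by positivity
  have htδ : t < δ := by have := min_le_left δ r; have := lt_min hδ hr; rw [ht]; linarith
  have htr : t < r := by have := min_le_right δ r; have := lt_min hδ hr; rw [ht]; linarith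
  have hy0 : x - t • e ∈ interior (closure Ω) := by
    refine hδs ?_
    rw [Metric.mem_ball, dist_eq_norm, sub_sub_cancel_left, norm_neg, norm_smul, he,
      Real.norm_of_nonneg ht0.le]
    linarith
  have hcl := Metric.mem_closure_iff.1 (interior_subset hy0)
  -- The first bound keeps `y` in the chart. The second makes the gain in height plus the Lipschitz
  -- drop of `γ` smaller than `t`.
  have hpos : 0 < min (r - t) (t / (L + 1)) := by
    have : (0 : ℝ) < L + 1 := by positivity
    exact lt_min (by linarith) (by positivity)
  obtain ⟨y, hyΩ, hy⟩ := hcl _ hpos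
  rw [dist_eq_norm, norm_sub_rev] at hy
  have hy1 : ‖y - (x - t • e)‖ < r - t := hy.trans_le (min_le_left _ _)
  have hy2 : ‖y - (x - t • e)‖ * (L + 1) < t := by
    have : (0 : ℝ) < L + 1 := by positivity
    exact (lt_div_iff₀ this).1 (hy.trans_le (min_le_right _ _))
  have hyb : y ∈ Metric.ball x r := by
    rw [Metric.mem_ball, dist_eq_norm]
    have e1 : y - x = (y - (x - t • e)) - t • e := by abel
    rw [e1]
    refine (norm_sub_le _ _).trans_lt ?_
    rw [norm_smul, he, Real.norm_of_nonneg ht0.le]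
    linarith
  have h1 := (hiff y hyb).1 hyΩ
  have h2 : γ x - γ y ≤ L * ‖y - (x - t • e)‖ := by
    have h3 := hγ.dist_le_mul (y + t • e) x
    rw [hinv, Real.dist_eq, dist_eq_norm] at h3
    have e2 : y + t • e - x = y - (x - t • e) := by abel
    rw [e2] at h3
    exact (le_abs_self _).trans (by rwa [abs_sub_comm] at h3)
  have h4 : ⟪e, y⟫_ℝ ≤ ⟪e, x⟫_ℝ - t + ‖y - (x - t • e)‖ := by
    have e3 : y = (y - (x - t • e)) + x - t • e := by abel
    have h5 : ⟪e, y⟫_ℝ = ⟪e, y - (x - t • e)⟫_ℝ + ⟪e, x⟫_ℝ - t := by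
      conv_lhs => rw [e3]
      rw [inner_sub_right, inner_add_right, real_inner_smul_right, real_inner_self_eq_norm_sq, he]
      ring
    have h6 := (le_abs_self _).trans (abs_real_inner_le_norm e (y - (x - t • e)))
    rw [he, one_mul] at h6
    linarith
  nlinarith

/-! ### Elements and facets of a triangulation -/

namespace Mesh

variable {Ω : Set (Eu d)} (M : Mesh Ω)

lemma mem_elements {s : Finset (Eu d)} : s ∈ M.elements ↔ s ∈ M.K.faces ∧ s.card = d + 1 := by
  simp [elements]

lemma mem_facets {F : Finset (Eu d)} : F ∈ M.facets ↔ F ∈ M.K.faces ∧ F.card = d := by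
  simp [facets]

variable {M}

lemma isSimplex {s : Finset (Eu d)} (hs : s ∈ M.elements) : IsSimplex s :=
  ⟨M.K.indep (M.mem_elements.1 hs).1, (M.mem_elements.1 hs).2⟩

lemma plus_mem {F : Finset (Eu d)} (hF : F ∈ M.facets) : M.plus F ∈ M.elements := by
  obtain ⟨h1, h2⟩ := M.mem_facets.1 hF
  obtain ⟨h3, h4, -⟩ := M.plus_spec F h1 h2
  exact M.mem_elements.2 ⟨h3, h4⟩

lemma subset_plus {F : Finset (Eu d)} (hF : F ∈ M.facets) : F ⊆ M.plus F := by
  obtain ⟨h1, h2⟩ := M.mem_facets.1 hF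
  exact (M.plus_spec F h1 h2).2.2

lemma exists_eq_erase {s F : Finset (Eu d)} (hs : s ∈ M.elements) (hF : F ∈ M.facets)
    (h : F ⊆ s) : ∃ v : s, F = s.erase v := by
  have h1 := (M.mem_elements.1 hs).2
  have h2 := (M.mem_facets.1 hF).2
  have h3 : (s \ F).card = 1 := by rw [Finset.card_sdiff_of_subset h]; omega
  obtain ⟨v, hv⟩ := Finset.card_eq_one.1 h3
  have hvs : v ∈ s := (Finset.mem_sdiff.1 (hv ▸ Finset.mem_singleton_self v)).1
  refine ⟨⟨v, hvs⟩, ?_⟩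
  rw [Finset.erase_eq, ← hv, Finset.sdiff_sdiff_eq_self h]

lemma erase_mem_facets (hd : 0 < d) {s : Finset (Eu d)} (hs : s ∈ M.elements) (v : s) :
    s.erase v ∈ M.facets := by
  obtain ⟨h1, h2⟩ := M.mem_elements.1 hs
  have h3 : (s.erase v).card = d := by rw [Finset.card_erase_of_mem v.2, h2]; rfl
  refine M.mem_facets.2 ⟨M.K.down_closed h1 (Finset.erase_subset _ _) ?_, h3⟩
  rw [← Finset.card_pos, h3]; exact hd

lemma isFiniteMeasure_surf (hd : 0 < d) {F : Finset (Eu d)} (hF : F ∈ M.facets) :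
    IsFiniteMeasure (surf F) := by
  obtain ⟨v, hv⟩ := exists_eq_erase (plus_mem hF) hF (subset_plus hF)
  rw [hv]
  exact (isSimplex (plus_mem hF)).isFiniteMeasure_surf hd v

variable (M)

/-- The complement of all faces that do not contain `F`. -/
def star (F : Finset (Eu d)) : Set (Eu d) := (⋃ t ∈ {t ∈ M.K.faces | ¬F ⊆ t}, hull t)ᶜ

lemma isOpen_star (F : Finset (Eu d)) : IsOpen (M.star F) :=
  ((M.finite.subset (Set.sep_subset _ _)).isClosed_biUnion
    fun t _ => (isCompact_hull t).isClosed).isOpen_compl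

variable {M}

lemma subset_of_mem_star {F t : Finset (Eu d)} {x : Eu d} (hx : x ∈ M.star F) (ht : t ∈ M.K.faces)
    (hxt : x ∈ hull t) : F ⊆ t := by
  by_contra h
  exact hx (Set.mem_biUnion (show t ∈ {t ∈ M.K.faces | ¬F ⊆ t} from ⟨ht, h⟩) hxt)

/-- Almost every point of a facet lies on no other facet. -/
lemma ae_mem_star {F : Finset (Eu d)} (hF : F ∈ M.facets) : ∀ᵐ x ∂(surf F), x ∈ M.star F := by
  classical
  obtain ⟨h1, h2⟩ := M.mem_facets.1 hF
  have hnull : ∀ t ∈ {t ∈ M.K.faces | ¬F ⊆ t}, ∀ᵐ x ∂(surf F), x ∉ hull t := by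
    rintro t ⟨ht, htF⟩
    have hsub : hull F ∩ hull t ⊆ hull (F ∩ t) := by
      have := M.K.inter_subset_convexHull h1 ht
      rwa [← Finset.coe_inter] at this
    -- A face not containing `F` shares at most `d - 1` vertices with it, so the overlap has no `(d
    -- - 1)`-dimensional measure.
    have hcard : (F ∩ t).card ≤ d - 1 := by
      have : (F ∩ t).card < F.card := Finset.card_lt_card
        ⟨Finset.inter_subset_left, fun h => htF (h.trans Finset.inter_subset_right)⟩
      omega
    have h0 := measure_mono_null hsub (euclideanHausdorffMeasure_hull_eq_zero _ _ hcard)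
    rw [ae_iff]
    simp only [not_not]
    rw [Set.ofPred_mem_eq, surf, Measure.restrict_apply (isCompact_hull t).measurableSet,
      Set.inter_comm]
    exact h0
  have := (ae_ball_iff (M.finite.subset (Set.sep_subset _ _)).countable).2 hnull
  filter_upwards [this] with x hx
  simp only [star, Set.mem_compl_iff, Set.mem_iUnion, not_exists]
  exact fun t ht => hx t ht

/-- A facet containing `F` equals it by cardinality. Hence a function supported in `star F` vanishes
on all other facets. -/
lemma star_inter_hull_eq_empty {F F' : Finset (Eu d)} (hF : F ∈ M.facets) (hF' : F' ∈ M.facets)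
    (h : F' ≠ F) {x : Eu d} (hx : x ∈ hull F') : x ∉ M.star F := by
  intro hxs
  have h1 := subset_of_mem_star hxs (M.mem_facets.1 hF').1 hx
  refine h (Finset.eq_of_subset_of_card_le h1 ?_).symm
  rw [(M.mem_facets.1 hF).2, (M.mem_facets.1 hF').2]

/-- If the coordinate vanished, `x` would lie in the face without `i`, which does not contain `F`.
-/
lemma coord_pos_of_mem_star {s F : Finset (Eu d)} (hs : s ∈ M.elements) {v : s}
    (hF : F = s.erase v) {x : Eu d} (hx : x ∈ M.star F) (hxF : x ∈ hull F) {i : s} (hi : i ≠ v) :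
    0 < (isSimplex hs).basis.coord i x := by
  have hxs : x ∈ hull s := convexHull_mono (by simp [hF]) hxF
  have h0 : 0 ≤ (isSimplex hs).basis.coord i x := by
    have := hxs
    rw [(isSimplex hs).hull_eq] at this
    exact this i
  refine h0.lt_of_ne fun h => ?_
  have h1 := ((isSimplex hs).mem_hull_erase i x).2 ⟨hxs, h.symm⟩
  have hface : s.erase i ∈ M.K.faces := by
    refine M.K.down_closed (M.mem_elements.1 hs).1 (Finset.erase_subset _ _) ⟨v, ?_⟩
    simp [hi.symm]
  have h2 := subset_of_mem_star hx hface h1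
  have h3 : (i : Eu d) ∈ F := by rw [hF]; simp [hi]
  simpa using h2 h3

lemma inter_eq_of_ne [DecidableEq (Eu d)] {s t F : Finset (Eu d)} (hs : s ∈ M.elements)
    (ht : t ∈ M.elements) (hF : F ∈ M.facets) (hFs : F ⊆ s) (hFt : F ⊆ t) (hst : s ≠ t) :
    s ∩ t = F := by
  refine (Finset.eq_of_subset_of_card_le (Finset.subset_inter hFs hFt) ?_).symm
  rw [(M.mem_facets.1 hF).2]
  have h1 : (s ∩ t).card < s.card := by
    refine Finset.card_lt_card ⟨Finset.inter_subset_left, fun h => hst ?_⟩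
    refine Finset.eq_of_subset_of_card_le (h.trans Finset.inter_subset_right) ?_
    rw [(M.mem_elements.1 hs).2, (M.mem_elements.1 ht).2]
  rw [(M.mem_elements.1 hs).2] at h1
  omega

/-- Two elements with a common facet lie on different sides of it. -/
lemma outerNormal_eq_neg (hd : 0 < d) {s t F : Finset (Eu d)} (hs : s ∈ M.elements)
    (ht : t ∈ M.elements) (hF : F ∈ M.facets) (hFs : F ⊆ s) (hFt : F ⊆ t) (hst : s ≠ t) :
    outerNormal t F = -outerNormal s F := by
  classical
  obtain ⟨a, ha⟩ := exists_eq_erase hs hF hFs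
  obtain ⟨b, hb⟩ := exists_eq_erase ht hF hFt
  have ss := isSimplex hs
  have st := isSimplex ht
  have hns := ss.isOuterNormal hd a
  have hnt := st.isOuterNormal hd b
  rw [← ss.outerNormal_erase hd, ← ha] at hns
  rw [← st.outerNormal_erase hd, ← hb] at hnt
  have hgs := norm_pos_iff.2 (ss.grad_ne_zero hd a)
  have hgt := norm_pos_iff.2 (st.grad_ne_zero hd b)
  have hns' : outerNormal s F = -(‖ss.grad a‖⁻¹ • ss.grad a) := by
    rw [ha, ss.outerNormal_erase hd]
  have hnt' : outerNormal t F = -(‖st.grad b‖⁻¹ • st.grad b) := by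
    rw [hb, st.outerNormal_erase hd]
  obtain ⟨w, hw, h1⟩ := ss.exists_eq_smul_grad hd a (n := outerNormal t F) (by
    rw [← ha]; exact hnt.2.1)
  set c := ⟪outerNormal t F, (a : Eu d) - w⟫_ℝ with hc
  have habs : |c| * ‖ss.grad a‖ = 1 := by
    have := hnt.1
    rwa [h1, norm_smul, Real.norm_eq_abs] at this
  have hc1 := eq_inv_of_mul_eq_one_left habs
  -- Both normals are unit multiples of the same gradient, so only the sign of `c` is open. If `c <
  -- 0` the two elements lie on the same side of `F`, and they would overlap.
  rcases le_or_gt 0 c with hc0 | hc0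
  · rw [abs_of_nonneg hc0] at hc1
    rw [h1, hns', hc1, neg_neg]
  · exfalso
    obtain ⟨m, hm, hmpos⟩ := st.exists_pos_coord hd b
    have hmF : m ∈ hull F := by rw [hb]; exact hm
    have hma := (ss.mem_hull_erase a m).1 (by rw [← ha]; exact hmF)
    -- the vertex opposite to `F` in `s` lies on the same side as `t`
    have hba : 0 < ⟪st.grad b, (a : Eu d) - m⟫_ℝ := by
      have h2 : st.grad b = (-‖st.grad b‖) • outerNormal t F := by
        rw [hnt', smul_neg, neg_smul, neg_neg, smul_smul, mul_inv_cancel₀ hgt.ne', one_smul]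
      have h3 : ⟪ss.grad a, (a : Eu d) - m⟫_ℝ = 1 := by
        rw [← ss.coord_sub, ss.coord_self, hma.2, sub_zero]
      rw [h2, h1, real_inner_smul_left, real_inner_smul_left, h3]
      nlinarith
    -- A short step from the relative interior of `F` towards `a` keeps these coordinates positive,
    -- so it stays in `t` as well as in `s`.
    have hev : ∀ᶠ δ in 𝓝[>] (0 : ℝ), ∀ i, i ≠ b →
        0 < st.basis.coord i (m + δ • ((a : Eu d) - m)) := by
      rw [eventually_all]
      intro i
      by_cases hi : i = b
      · simp [hi]
      have hcont : Continuous fun δ : ℝ => st.basis.coord i (m + δ • ((a : Eu d) - m)) :=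
        (continuous_barycentric_coord st.basis i).comp (by fun_prop)
      have h4 := hcont.tendsto 0
      simp only [zero_smul, add_zero] at h4
      have h5 := (h4.eventually (lt_mem_nhds (hmpos i hi))).filter_mono
        (nhdsWithin_le_nhds (s := Set.Ioi 0))
      filter_upwards [h5] with δ hδ _ using hδ
    obtain ⟨δ, hδ, hδ1⟩ := (hev.and (Ioo_mem_nhdsGT (zero_lt_one' ℝ))).exists
    set y := m + δ • ((a : Eu d) - m) with hy
    have hyb : 0 < st.basis.coord b y := by
      rw [hy, st.coord_add, ((st.mem_hull_erase b m).1 hm).2, zero_add, real_inner_smul_right]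
      exact mul_pos hδ1.1 hba
    have hyt : y ∈ hull t := by
      rw [st.hull_eq]
      intro i
      by_cases hi : i = b
      · rw [hi]; exact hyb.le
      · exact (hδ i hi).le
    have hys : y ∈ hull s := by
      have has : (a : Eu d) ∈ hull s := subset_convexHull ℝ _ a.2
      have := (convex_convexHull ℝ (s : Set (Eu d))).add_smul_sub_mem hma.1 has
        ⟨hδ1.1.le, hδ1.2.le⟩
      exact this
    -- The complex forces the common point into the hull of `s ∩ t = F`, where the coordinate of `b`
    -- is zero.
    have h6 := M.K.inter_subset_convexHull (M.mem_elements.1 hs).1 (M.mem_elements.1 ht).1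
      ⟨hys, hyt⟩
    rw [← Finset.coe_inter, inter_eq_of_ne hs ht hF hFs hFt hst, hb] at h6
    exact hyb.ne' ((st.mem_hull_erase b y).1 h6).2

/-- The interior of a facet between two elements lies in the domain. -/
lemma mem_of_mem_star (hd : 0 < d) (hΩ : IsLipschitzDomain Ω) {s t F : Finset (Eu d)}
    (hs : s ∈ M.elements)
    (ht : t ∈ M.elements) (hF : F ∈ M.facets) (hFs : F ⊆ s) (hFt : F ⊆ t) (hst : s ≠ t)
    {x : Eu d} (hx : x ∈ M.star F) (hxF : x ∈ hull F) : x ∈ Ω := by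
  refine hΩ.interior_closure_subset ?_
  rw [mem_interior_iff_mem_nhds, ← M.space_eq]
  obtain ⟨a, ha⟩ := exists_eq_erase hs hF hFs
  obtain ⟨b, hb⟩ := exists_eq_erase ht hF hFt
  have ss := isSimplex hs
  have st := isSimplex ht
  -- Near `x` only the constraint belonging to `F` is active, so each element fills its half-space
  -- locally; opposite half-spaces then cover a neighbourhood.
  have key : ∀ {r : Finset (Eu d)} (hr : r ∈ M.elements) {v : r} (_ : F = r.erase v),
      ∀ᶠ y in 𝓝 x, ⟪outerNormal r F, y - x⟫_ℝ ≤ 0 → y ∈ hull r := by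
    intro r hr v hv
    have sr := isSimplex hr
    have h1 : ∀ᶠ y in 𝓝 x, ∀ i, i ≠ v → 0 < sr.basis.coord i y := by
      rw [eventually_all]
      intro i
      by_cases hi : i = v
      · simp [hi]
      have h2 := (continuous_barycentric_coord sr.basis i).tendsto x
      filter_upwards [h2.eventually (lt_mem_nhds (coord_pos_of_mem_star hr hv hx hxF hi))]
        with y hy _ using hy
    filter_upwards [h1] with y hy hn
    rw [sr.hull_eq]
    intro i
    by_cases hi : i = v
    · have h3 := sr.coord_sub v x y
      rw [((sr.mem_hull_erase v x).1 (hv ▸ hxF)).2, sub_zero] at h3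
      rw [hi, h3]
      rw [hv, sr.outerNormal_erase hd, inner_neg_left, real_inner_smul_left, neg_nonpos] at hn
      exact nonneg_of_mul_nonneg_right hn (inv_pos.2 (norm_pos_iff.2 (sr.grad_ne_zero hd v)))
    · exact (hy i hi).le
  filter_upwards [key hs ha, key ht hb] with y h1 h2
  rw [Geometry.SimplicialComplex.mem_space_iff]
  rcases le_total ⟪outerNormal s F, y - x⟫_ℝ 0 with h | h
  · exact ⟨s, (M.mem_elements.1 hs).1, h1 h⟩
  · refine ⟨t, (M.mem_elements.1 ht).1, h2 ?_⟩
    rw [outerNormal_eq_neg hd hs ht hF hFs hFt hst, inner_neg_left]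
    linarith

/-! ### Splitting the domain into open elements -/

lemma openHull_subset (hΩ : IsLipschitzDomain Ω) {s : Finset (Eu d)} (hs : s ∈ M.elements) :
    openHull s ⊆ Ω := by
  refine Set.Subset.trans (interior_mono ?_) hΩ.interior_closure_subset
  rw [← M.space_eq]
  exact Geometry.SimplicialComplex.convexHull_subset_space (M.mem_elements.1 hs).1

/-- The intersection is open and lies in the hull of at most `d` points, a null set; an open null
set is empty. -/
lemma pairwiseDisjoint_openHull : (M.elements : Set (Finset (Eu d))).PairwiseDisjoint openHull := by
  classical
  intro s hs t ht hst
  rw [Function.onFun, Set.disjoint_iff_inter_eq_empty,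
    ← ((isOpen_openHull s).inter (isOpen_openHull t)).measure_eq_zero_iff volume]
  have h1 : openHull s ∩ openHull t ⊆ hull (s ∩ t) := by
    have := M.K.inter_subset_convexHull (M.mem_elements.1 hs).1 (M.mem_elements.1 ht).1
    rw [← Finset.coe_inter] at this
    exact (Set.inter_subset_inter (MCS.openHull_subset s) (MCS.openHull_subset t)).trans this
  refine measure_mono_null h1 (volume_hull_eq_zero _ ?_)
  have h2 : (s ∩ t).card < s.card := by
    refine Finset.card_lt_card ⟨Finset.inter_subset_left, fun h => hst ?_⟩
    refine Finset.eq_of_subset_of_card_le (h.trans Finset.inter_subset_right) ?_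
    rw [(M.mem_elements.1 hs).2, (M.mem_elements.1 ht).2]
  rw [(M.mem_elements.1 hs).2] at h2
  omega

/-- The open elements cover the domain up to a null set. -/
lemma iUnion_openHull_ae_eq (hΩ : IsLipschitzDomain Ω) :
    (⋃ s ∈ M.elements, openHull s : Set (Eu d)) =ᵐ[volume] Ω := by
  have h0 : (⋃ s ∈ M.elements, openHull s) ⊆ Ω :=
    Set.iUnion₂_subset fun s hs => openHull_subset hΩ hs
  refine (LE.le.eventuallyLE h0).antisymm ?_
  -- Lower-dimensional faces are null, and full simplices exceed their interiors by a null set.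
  have h1 : ∀ t ∈ M.K.faces, ∀ᵐ x, x ∈ hull t → x ∈ ⋃ s ∈ M.elements, openHull s := by
    intro t ht
    by_cases hc : t.card = d + 1
    · filter_upwards [(openHull_ae_eq t).mem_iff] with x hx hxt
      exact Set.mem_biUnion (M.mem_elements.2 ⟨ht, hc⟩) (hx.2 hxt)
    · have hle : t.card ≤ d := by
        have := (M.K.indep ht).card_le_finrank_succ
        have h2 : Module.finrank ℝ (vectorSpan ℝ (Set.range ((↑) : t → Eu d))) ≤ d := by
          simpa using (vectorSpan ℝ (Set.range ((↑) : t → Eu d))).finrank_le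
        simp only [Fintype.card_coe] at this
        omega
      have h3 : ∀ᵐ x, x ∉ hull t := by
        rw [ae_iff]; simpa using volume_hull_eq_zero t hle
      filter_upwards [h3] with x hx hxt using absurd hxt hx
  have h2 := (ae_ball_iff M.finite.countable).2 h1
  filter_upwards [h2] with x hx hxΩ
  have h3 : x ∈ M.K.space := by rw [M.space_eq]; exact subset_closure hxΩ
  obtain ⟨t, ht, hxt⟩ := Geometry.SimplicialComplex.mem_space_iff.1 h3
  exact hx t ht hxt

lemma setIntegral_eq_sum (hΩ : IsLipschitzDomain Ω) {f : Eu d → ℝ}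
    (hf : ∀ s ∈ M.elements, IntegrableOn f (openHull s)) :
    ∫ x in Ω, f x = ∑ s ∈ M.elements, ∫ x in openHull s, f x := by
  rw [← setIntegral_congr_set (iUnion_openHull_ae_eq (M := M) hΩ)]
  exact integral_biUnion_finset _ (fun s _ => (isOpen_openHull s).measurableSet)
    pairwiseDisjoint_openHull hf

end Mesh

/-! ### Piecewise polynomials -/

lemma contDiff_polyEval (p : MvPolynomial (Fin d) ℝ) : ContDiff ℝ ∞ (polyEval p) := by
  induction p using MvPolynomial.induction_on with
  | C a =>
    have : polyEval (d := d) (MvPolynomial.C a) = fun _ => a := by ext x; simp [polyEval]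
    rw [this]; exact contDiff_const
  | add p q hp hq =>
    have : polyEval (p + q) = fun x => polyEval p x + polyEval q x := by ext x; simp [polyEval]
    rw [this]; exact hp.add hq
  | mul_X p i hp =>
    have : polyEval (p * MvPolynomial.X i) = fun x => polyEval p x * x i := by
      ext x; simp [polyEval]
    rw [this]; exact hp.mul (EuclideanSpace.proj (𝕜 := ℝ) i).contDiff

/-- Each polynomial piece extends to the whole space, which makes its trace and gradient classical.
-/
lemma IsPiecewisePoly.exists_contDiff {Ω : Set (Eu d)} {M : Mesh Ω} {k : ℕ} {w : Eu d → ℝ}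
    (h : IsPiecewisePoly M k w) : ∃ ψ : Finset (Eu d) → Eu d → ℝ, (∀ s, ContDiff ℝ ∞ (ψ s)) ∧
      ∀ s ∈ M.elements, ∀ x ∈ openHull s, w x = ψ s x := by
  have h' : ∀ s, ∃ p : MvPolynomial (Fin d) ℝ, s ∈ M.elements →
      ∀ x ∈ openHull s, w x = polyEval p x := by
    intro s
    by_cases hs : s ∈ M.elements
    · obtain ⟨p, -, hp⟩ := h s hs
      exact ⟨p, fun _ => hp⟩
    · exact ⟨0, fun h => absurd h hs⟩
  choose p hp using h'
  exact ⟨fun s => polyEval (p s), fun s => contDiff_polyEval _, hp⟩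

lemma isH1Grad_of_eq {s : Finset (Eu d)} {w ψ : Eu d → ℝ} (hψ : ContDiff ℝ ∞ ψ)
    (h : ∀ x ∈ openHull s, w x = ψ x) : IsH1Grad (openHull s) w (gradient ψ) := by
  have h1 := isH1Grad_gradient s (hψ.of_le (m := 1) (by simp))
  have hae : ψ =ᵐ[volume.restrict (openHull s)] w := by
    filter_upwards [ae_restrict_mem (isOpen_openHull s).measurableSet] with x hx
    exact (h x hx).symm
  exact ⟨h1.1.ae_eq hae, h1.2.1, h1.2.2.congr hae (ae_eq_refl _)⟩

namespace Mesh

variable {Ω : Set (Eu d)} {M : Mesh Ω}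

/-! ### Jumps -/

lemma jump_congr {X : Type*} [AddCommGroup X] {F : Finset (Eu d)} (hF : F ∈ M.facets)
    {w w' : Finset (Eu d) → X} (h : ∀ s ∈ M.elements, F ⊆ s → w s = w' s) :
    M.jump F w = M.jump F w' := by
  rw [jump, jump, h _ (plus_mem hF) (subset_plus hF)]
  congr 1
  refine Finset.sum_congr rfl fun s hs => ?_
  simp only [Finset.mem_filter] at hs
  exact h s hs.1 hs.2.1

variable (M) in
/-- The jump as a linear map. -/
def jumpL (X : Type*) [AddCommGroup X] [Module ℝ X] (F : Finset (Eu d)) :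
    (Finset (Eu d) → X) →ₗ[ℝ] X where
  toFun := M.jump F
  map_add' w w' := by
    simp only [jump, Pi.add_apply, Finset.sum_add_distrib]; abel
  map_smul' c w := by
    simp only [jump, Pi.smul_apply, ← Finset.smul_sum, smul_sub, RingHom.id_apply]

lemma jump_sum {ι : Type*} (u : Finset ι) (F : Finset (Eu d)) (w : ι → Finset (Eu d) → ℝ) :
    M.jump F (fun s => ∑ i ∈ u, w i s) = ∑ i ∈ u, M.jump F (w i) := by
  have h : (fun s => ∑ i ∈ u, w i s) = ∑ i ∈ u, w i := by ext s; simp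
  rw [h]
  exact map_sum (M.jumpL ℝ F) w u

lemma jump_add (F : Finset (Eu d)) (w w' : Finset (Eu d) → ℝ) :
    M.jump F (fun s => w s + w' s) = M.jump F w + M.jump F w' := (M.jumpL ℝ F).map_add w w'

lemma jump_const_mul (F : Finset (Eu d)) (c : ℝ) (w : Finset (Eu d) → ℝ) :
    M.jump F (fun s => c * w s) = c * M.jump F w := (M.jumpL ℝ F).map_smul c w

lemma jump_mul_const (F : Finset (Eu d)) (c : ℝ) (w : Finset (Eu d) → ℝ) :
    M.jump F (fun s => w s * c) = M.jump F w * c := by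
  simp_rw [mul_comm _ c]; exact jump_const_mul F c w

lemma jump_inner (F : Finset (Eu d)) (g : Eu d) (w : Finset (Eu d) → Eu d) :
    M.jump F (fun s => ⟪g, w s⟫_ℝ) = ⟪g, M.jump F w⟫_ℝ := by
  simp only [jump, inner_sub_right, inner_sum]

lemma jump_eq_plus {X : Type*} [AddCommGroup X] {F : Finset (Eu d)}
    (h : ∀ s ∈ M.elements, F ⊆ s → s = M.plus F) (w : Finset (Eu d) → X) :
    M.jump F w = w (M.plus F) := by
  rw [jump, Finset.sum_eq_zero, sub_zero]
  intro s hs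
  simp only [Finset.mem_filter] at hs
  exact absurd (h s hs.1 hs.2.1) hs.2.2

lemma integrable_jump {F : Finset (Eu d)} (hF : F ∈ M.facets) {f : Finset (Eu d) → Eu d → ℝ}
    (hf : ∀ s ∈ M.elements, F ⊆ s → Integrable (f s) (surf F)) :
    Integrable (fun y => M.jump F fun s => f s y) (surf F) := by
  refine (hf _ (plus_mem hF) (subset_plus hF)).sub (integrable_finsetSum _ fun s hs => ?_)
  simp only [Finset.mem_filter] at hs
  exact hf s hs.1 hs.2.1

lemma integral_jump {F : Finset (Eu d)} (hF : F ∈ M.facets) {f : Finset (Eu d) → Eu d → ℝ}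
    (hf : ∀ s ∈ M.elements, F ⊆ s → Integrable (f s) (surf F)) :
    ∫ y, M.jump F (fun s => f s y) ∂(surf F) = M.jump F fun s => ∫ y, f s y ∂(surf F) := by
  have h : ∀ s ∈ {s ∈ M.elements | F ⊆ s ∧ s ≠ M.plus F}, Integrable (f s) (surf F) := by
    intro s hs
    simp only [Finset.mem_filter] at hs
    exact hf s hs.1 hs.2.1
  simp only [jump]
  rw [integral_sub (hf _ (plus_mem hF) (subset_plus hF)) (integrable_finsetSum _ ?_),
    integral_finsetSum]
  · convert h
  · convert h

/-! ### From sums over elements to sums over facets -/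

open Classical in
-- In an element, facets correspond to opposite vertices; the rest is interchanging two sums.
lemma sum_elements_eq_sum_facets (hd : 0 < d) (X : Finset (Eu d) → Finset (Eu d) → ℝ) :
    ∑ s ∈ M.elements, ∑ v : s, X s (s.erase v) =
      ∑ F ∈ M.facets, ∑ s ∈ M.elements with F ⊆ s, X s F := by
  have h1 : ∀ s ∈ M.elements, ∑ v : s, X s (s.erase v) = ∑ F ∈ M.facets with F ⊆ s, X s F := by
    intro s hs
    refine Finset.sum_bij (fun v _ => s.erase v) (fun v _ => ?_) (fun v _ w _ h => ?_)
      (fun F hF => ?_) (fun v _ => ?_)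
    · exact Finset.mem_filter.2 ⟨erase_mem_facets hd hs v, Finset.erase_subset _ _⟩
    · exact Subtype.ext (Finset.erase_injOn s v.2 w.2 (by convert h))
    · obtain ⟨hF, hFs⟩ := Finset.mem_filter.1 hF
      obtain ⟨v, hv⟩ := exists_eq_erase hs hF hFs
      exact ⟨v, Finset.mem_univ _, by rw [hv]⟩
    · rfl
  rw [Finset.sum_congr rfl h1]
  refine Finset.sum_comm' fun s F => ?_
  simp only [Finset.mem_filter]
  tauto

open Classical in
-- Every element at `F` other than `plus F` has the opposite outward normal, which produces the
-- minus sign of the jump.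
lemma sum_outerNormal_mul (hd : 0 < d) {F : Finset (Eu d)} (hF : F ∈ M.facets) (e : Eu d)
    (Y : Finset (Eu d) → ℝ) :
    ∑ s ∈ M.elements with F ⊆ s, ⟪outerNormal s F, e⟫_ℝ * Y s =
      ⟪M.normal F, e⟫_ℝ * M.jump F Y := by
  have hp := plus_mem hF
  have hsp := subset_plus hF
  rw [← Finset.add_sum_erase _ _ (Finset.mem_filter.2 ⟨hp, hsp⟩), jump, mul_sub, Finset.mul_sum,
    sub_eq_add_neg, ← Finset.sum_neg_distrib, normal]
  congr 1
  refine Finset.sum_congr ?_ fun s hs => ?_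
  · ext s
    simp only [Finset.mem_erase, Finset.mem_filter]
    tauto
  · simp only [Finset.mem_filter] at hs
    rw [outerNormal_eq_neg hd hp hs.1 hF hsp hs.2.1 (Ne.symm hs.2.2), inner_neg_left, neg_mul]

lemma norm_normal (hd : 0 < d) {F : Finset (Eu d)} (hF : F ∈ M.facets) : ‖M.normal F‖ = 1 := by
  obtain ⟨v, hv⟩ := exists_eq_erase (plus_mem hF) hF (subset_plus hF)
  have h1 := (isSimplex (plus_mem hF)).isOuterNormal hd v
  rw [← (isSimplex (plus_mem hF)).outerNormal_erase hd, ← hv] at h1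
  exact h1.1

lemma isTrace_trace (hd : 0 < d) {s F : Finset (Eu d)} (hs : s ∈ M.elements) (hF : F ∈ M.facets)
    (hFs : F ⊆ s) {w : Eu d → ℝ} {G : Eu d → Eu d} (h : IsH1Grad (openHull s) w G) :
    IsTrace s F w (trace s F w) := by
  obtain ⟨v, rfl⟩ := exists_eq_erase hs hF hFs
  exact (isSimplex hs).isTrace_of_isH1Grad hd v h

/-- Elementwise integration by parts. -/
lemma sum_integral_by_parts (hd : 0 < d) {w : Eu d → ℝ} {G : Finset (Eu d) → Eu d → Eu d}
    (hG : ∀ s ∈ M.elements, IsH1Grad (openHull s) w (G s)) {η : Finset (Eu d) → Eu d → ℝ}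
    (hη : ∀ s, ContDiff ℝ 1 (η s)) (e : Eu d) :
    ∑ s ∈ M.elements, ∫ x in openHull s, (w x * fderiv ℝ (η s) x e + ⟪G s x, e⟫_ℝ * η s x) =
      ∑ F ∈ M.facets, ⟪M.normal F, e⟫_ℝ *
        ∫ y, M.jump F (fun s => trace s F w y * η s y) ∂(surf F) := by
  classical
  have h1 : ∀ s ∈ M.elements,
      ∫ x in openHull s, (w x * fderiv ℝ (η s) x e + ⟪G s x, e⟫_ℝ * η s x) =
      ∑ v : s, ⟪outerNormal s (s.erase v), e⟫_ℝ *
        ∫ y, trace s (s.erase v) w y * η s y ∂(surf (s.erase v)) := fun s hs =>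
    (isSimplex hs).integral_isTrace hd (hG s hs)
      (fun v => (isSimplex hs).isTrace_of_isH1Grad hd v (hG s hs)) (hη s) e
  rw [Finset.sum_congr rfl h1, sum_elements_eq_sum_facets hd fun s F =>
    ⟪outerNormal s F, e⟫_ℝ * ∫ y, trace s F w y * η s y ∂(surf F)]
  refine Finset.sum_congr rfl fun F hF => ?_
  have := isFiniteMeasure_surf hd hF
  rw [sum_outerNormal_mul hd hF e fun s => ∫ y, trace s F w y * η s y ∂(surf F),
    integral_jump hF]
  intro s hs hFs
  exact integrable_fun_mul (isTrace_trace hd hs hF hFs (hG s hs)).1 (memLp_surf (hη s).continuous)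

/-- The trace of a function in `H¹(Ω)` does not jump. -/
lemma jump_trace_ae_eq_zero (hd : 0 < d) (hΩ : IsLipschitzDomain Ω) {w : Eu d → ℝ}
    {G : Eu d → Eu d} (h : IsH1Grad Ω w G) {F t : Finset (Eu d)} (hF : F ∈ M.facets)
    (ht : t ∈ M.elements) (hFt : F ⊆ t) (htp : t ≠ M.plus F) :
    ∀ᵐ x ∂(surf F), M.jump F (fun s => trace s F w x) = 0 := by
  have := isFiniteMeasure_surf hd hF
  have hG : ∀ s ∈ M.elements, IsH1Grad (openHull s) w G := fun s hs =>
    h.mono (isOpen_openHull s).measurableSet (openHull_subset hΩ hs)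
  have hint : Integrable (fun y => M.jump F fun s => trace s F w y) (surf F) :=
    integrable_jump hF fun s hs hFs =>
      (isTrace_trace hd hs hF hFs (hG s hs)).1.integrable one_le_two
  -- Testing with a single partial derivative suffices, along a coordinate in which the normal does
  -- not vanish.
  obtain ⟨i, hi⟩ : ∃ i, M.normal F i ≠ 0 := by
    by_contra! h0
    have h1 : M.normal F = 0 := by ext i; exact h0 i
    have := norm_normal hd hF
    simp [h1] at this
  have key := ((M.isOpen_star F).inter hΩ.isOpen).ae_eq_zero_of_integral_contDiff_smul_eq_zero
    (hint.locallyIntegrable.locallyIntegrableOn _) fun φ h1 h2 h3 => by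
      -- Support in `star F` isolates the facet `F`; support in `Ω` makes the volume terms cancel by
      -- the global weak gradient.
      have hφ : IsTest (M.star F ∩ Ω) φ := ⟨h1, h2, h3⟩
      have hφΩ : IsTest Ω φ := hφ.mono Set.inter_subset_right
      have hbp := M.sum_integral_by_parts hd (G := fun _ => G) hG (η := fun _ => φ)
        (fun _ => hφ.contDiff_one) (EuclideanSpace.single i 1)
      simp only [← gradient_apply, EuclideanSpace.inner_single_right, one_mul,
        RCLike.conj_to_real] at hbp
      have hi1 := integrable_fun_mul h.1 (memLp_coord (hφΩ.memLp_gradient Ω) i)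
      have hi2 := integrable_fun_mul (memLp_coord h.2.1 i) (hφΩ.memLp Ω)
      have hsum := setIntegral_eq_sum (M := M) hΩ
        (f := fun x => w x * gradient φ x i + G x i * φ x) fun s hs =>
          (hi1.add hi2).mono_measure (Measure.restrict_mono (openHull_subset hΩ hs) le_rfl)
      rw [← hsum, integral_add hi1 hi2,
        h.2.2 φ hφΩ i, neg_add_cancel, Finset.sum_eq_single_of_mem F hF] at hbp
      · have h4 := (mul_eq_zero.1 hbp.symm).resolve_left hi
        simp_rw [jump_mul_const] at h4
        simpa [mul_comm] using h4
      · intro F' hF' hne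
        rw [integral_eq_zero_of_ae, mul_zero]
        filter_upwards [ae_surf_mem F'] with y hy
        rw [jump_mul_const, hφ.eq_zero fun hy' => star_inter_hull_eq_empty hF hF' hne hy hy'.1]
        simp
  filter_upwards [key, ae_mem_star hF, ae_surf_mem F] with x hx hxs hxF
  exact hx ⟨hxs, mem_of_mem_star hd hΩ (plus_mem hF) ht hF (subset_plus hF) hFt htp.symm hxs hxF⟩

end Mesh

/-! ### Divergences -/

lemma MemHDiv.weakDiv_spec {U : Set (Eu d)} {v : Eu d → Eu d} (h : MemHDiv U v) :
    MemLp (weakDiv U v) 2 (volume.restrict U) ∧ IsWeakDiv U v (weakDiv U v) := by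
  rw [weakDiv, dif_pos h.2]
  exact h.2.choose_spec

lemma memLp_sum_coord {U : Set (Eu d)} {G : Fin d → Eu d → Eu d}
    (h : ∀ i, MemLp (G i) 2 (volume.restrict U)) :
    MemLp (fun x => ∑ i, G i x i) 2 (volume.restrict U) :=
  memLp_finsetSum _ fun i _ => memLp_coord (h i) i

lemma weakDiv_ae_eq_sum {U : Set (Eu d)} (hU : IsOpen U) {v : Eu d → Eu d}
    {G : Fin d → Eu d → Eu d} (h : ∀ i, IsH1Grad U (fun x => v x i) (G i)) :
    weakDiv U v =ᵐ[volume.restrict U] fun x => ∑ i, G i x i :=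
  weakDiv_ae_eq hU (memLp_sum_coord fun i => (h i).2.1) (IsWeakGrad.isWeakDiv h)

/-- The global divergence restricts to the smaller set, where uniqueness identifies it with the sum
of partial derivatives. -/
lemma MemHDiv.weakDiv_ae_eq_sum {U V : Set (Eu d)} (hU : IsOpen U) (hUV : U ⊆ V)
    {v : Eu d → Eu d} (hv : MemHDiv V v)
    {G : Fin d → Eu d → Eu d} (h : ∀ i, IsH1Grad U (fun x => v x i) (G i)) :
    weakDiv V v =ᵐ[volume.restrict U] fun x => ∑ i, G i x i :=
  (hv.weakDiv_spec.2.mono hU.measurableSet hUV).ae_eq hU (IsWeakGrad.isWeakDiv h)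
    (hv.weakDiv_spec.1.mono_measure (Measure.restrict_mono hUV le_rfl))
    (memLp_sum_coord fun i => (h i).2.1)

lemma inner_eq_sum (x y : Eu d) : ⟪x, y⟫_ℝ = ∑ i, x i * y i := by
  rw [PiLp.inner_apply]; simp [mul_comm]

lemma integrable_inner {μ : Measure (Eu d)} {v w : Eu d → Eu d} (hv : MemLp v 2 μ)
    (hw : MemLp w 2 μ) : Integrable (fun x => ⟪v x, w x⟫_ℝ) μ := by
  simp_rw [inner_eq_sum]
  exact integrable_finsetSum _ fun i _ => integrable_fun_mul (memLp_coord hv i) (memLp_coord hw i)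

lemma nn_eq_sum (n : Eu d) (A : Mat d) : nn n A = ∑ i, ∑ j, n i * n j * A i j := by
  rw [nn, inner_eq_sum]
  refine Finset.sum_congr rfl fun i _ => ?_
  simp only [mulV, Matrix.mulVec, dotProduct, Finset.mul_sum]
  exact Finset.sum_congr rfl fun j _ => by ring

lemma mulV_eq (n : Eu d) (A : Mat d) : mulV A n = nn n A • n + nt n A := by
  rw [nt]; abel

lemma dev_eq_self {A : Mat d} (h : A.trace = 0) : dev A = A := by simp [dev, h]

namespace Mesh

variable {Ω : Set (Eu d)} {M : Mesh Ω}

/-! ### Normal traces in `H₀(div)` -/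

/-- The normal component of a piecewise smooth field in `H₀(div)` vanishes on outer facets. -/
lemma normalTrace_ae_eq_zero (hd : 0 < d) (hΩ : IsLipschitzDomain Ω) {v : Eu d → Eu d}
    {G : Fin d → Finset (Eu d) → Eu d → Eu d}
    (hG : ∀ i, ∀ s ∈ M.elements, IsH1Grad (openHull s) (fun x => v x i) (G i s))
    (hv : MemHDiv0 Ω v) {F : Finset (Eu d)} (hF : F ∈ M.facets)
    (hb : ∀ s ∈ M.elements, F ⊆ s → s = M.plus F) :
    ∀ᵐ x ∂(surf F), M.normalTrace v F x = 0 := by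
  have := isFiniteMeasure_surf hd hF
  have htr : ∀ i, MemLp (trace (M.plus F) F fun x => v x i) 2 (surf F) := fun i =>
    (isTrace_trace hd (plus_mem hF) hF (subset_plus hF) (hG i _ (plus_mem hF))).1
  have hnt : M.normalTrace v F =
      fun x => ∑ i, M.normal F i * trace (M.plus F) F (fun x => v x i) x := by
    ext x
    rw [normalTrace, inner_eq_sum]
    exact Finset.sum_congr rfl fun i _ => mul_comm _ _
  have hint : Integrable (M.normalTrace v F) (surf F) := by
    rw [hnt]
    exact integrable_finsetSum _ fun i _ => ((htr i).integrable one_le_two).const_mul _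
  have key := (M.isOpen_star F).ae_eq_zero_of_integral_contDiff_smul_eq_zero
    (hint.locallyIntegrable.locallyIntegrableOn _) fun φ h1 h2 h3 => by
      -- Here `φ` need not vanish on the boundary of `Ω`: the condition defining `H₀(div)` admits
      -- all of `H¹(Ω)`.
      have hφ : IsTest (M.star F) φ := ⟨h1, h2, h3⟩
      have hφH : IsH1Grad Ω φ (gradient φ) :=
        ⟨hφ.memLp Ω, hφ.memLp_gradient Ω, isWeakGrad_gradient Ω hφ.contDiff_one⟩
      have hbp : ∀ i, ∑ s ∈ M.elements, ∫ x in openHull s,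
          (v x i * gradient φ x i + G i s x i * φ x) =
          ∫ y, M.normal F i * (trace (M.plus F) F (fun x => v x i) y * φ y) ∂(surf F) := by
        intro i
        have hbp := M.sum_integral_by_parts hd (hG i) (η := fun _ => φ)
          (fun _ => hφ.contDiff_one) (EuclideanSpace.single i 1)
        simp only [← gradient_apply, EuclideanSpace.inner_single_right, one_mul,
          RCLike.conj_to_real] at hbp
        rw [hbp, Finset.sum_eq_single_of_mem F hF, integral_const_mul]
        · simp_rw [jump_eq_plus hb]
        · intro F' hF' hne
          rw [integral_eq_zero_of_ae, mul_zero]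
          filter_upwards [ae_surf_mem F'] with y hy
          rw [jump_mul_const, hφ.eq_zero fun hy' => star_inter_hull_eq_empty hF hF' hne hy hy']
          simp
      have hI1 := integrable_inner hv.1.1 hφH.2.1
      have hI2 := integrable_fun_mul hv.1.weakDiv_spec.1 hφH.1
      -- The elementwise divergences assemble to the global one, so `H₀(div)` makes the volume terms
      -- vanish and only the integral over `F` survives.
      have h0 : ∑ i, ∑ s ∈ M.elements, ∫ x in openHull s,
          (v x i * gradient φ x i + G i s x i * φ x) = 0 := by
        rw [Finset.sum_comm, ← hv.2 φ (gradient φ) hφH, ← integral_add hI1 hI2,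
          setIntegral_eq_sum (M := M) hΩ
            (f := fun x => ⟪v x, gradient φ x⟫_ℝ + weakDiv Ω v x * φ x) fun s hs =>
            (hI1.add hI2).mono_measure (Measure.restrict_mono (openHull_subset hΩ hs) le_rfl)]
        refine Finset.sum_congr rfl fun s hs => ?_
        have hI : ∀ i, IntegrableOn (fun x => v x i * gradient φ x i + G i s x i * φ x)
            (openHull s) := fun i =>
          (integrable_fun_mul (hG i s hs).1 (memLp_coord (hφ.memLp_gradient _) i)).add
            (integrable_fun_mul (memLp_coord (hG i s hs).2.1 i) (hφ.memLp _))
        rw [← integral_finsetSum _ fun i _ => hI i]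
        refine integral_congr_ae ?_
        filter_upwards [hv.1.weakDiv_ae_eq_sum (isOpen_openHull s) (openHull_subset hΩ hs)
          fun i => hG i s hs] with x hx
        rw [hx, inner_eq_sum, Finset.sum_add_distrib, Finset.sum_mul]
      simp_rw [hbp] at h0
      rw [← integral_finsetSum _ fun i _ =>
        ((integrable_fun_mul (htr i) (memLp_surf hφ.1.continuous)).const_mul _)] at h0
      rw [← h0]
      refine integral_congr_ae (Eventually.of_forall fun x => ?_)
      simp only [hnt, smul_eq_mul, Finset.mul_sum]
      exact Finset.sum_congr rfl fun i _ => by ring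
  filter_upwards [key, ae_mem_star hF] with x hx hxs using hx hxs

/-- For a globally smooth stress the form `b₂` reduces to the volume term. -/
lemma formB2_eq_integral (hd : 0 < d) (hΩ : IsLipschitzDomain Ω) {σ : Eu d → Mat d}
    {D : Fin d → Fin d → Eu d → Eu d} (hσ : ∀ i j, IsH1Grad Ω (fun x => σ x i j) (D i j))
    {v : Eu d → Eu d} {G : Fin d → Finset (Eu d) → Eu d → Eu d}
    (hG : ∀ i, ∀ s ∈ M.elements, IsH1Grad (openHull s) (fun x => v x i) (G i s))
    (hv : MemHDiv0 Ω v) :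
    formB2 M σ v = ∫ x in Ω, ∑ i, (∑ j, D i j x j) * v x i := by
  have hfac : ∑ F ∈ M.facets, ∫ x, M.jumpNN σ F x * M.normalTrace v F x ∂(surf F) = 0 := by
    refine Finset.sum_eq_zero fun F hF => integral_eq_zero_of_ae ?_
    -- The dichotomy is combinatorial: with a single element at `F` the normal trace of `v`
    -- vanishes, and with a second one the jump of `σ` does.
    by_cases hb : ∀ s ∈ M.elements, F ⊆ s → s = M.plus F
    · filter_upwards [normalTrace_ae_eq_zero hd hΩ hG hv hF hb] with x hx
      simp [hx]
    · push Not at hb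
      obtain ⟨t, ht, hFt, htp⟩ := hb
      have hj : ∀ i j, ∀ᵐ x ∂(surf F), M.jump F (fun s => traceM s F σ x i j) = 0 :=
        fun i j => jump_trace_ae_eq_zero hd hΩ (hσ i j) hF ht hFt htp
      simp_rw [← ae_all_iff] at hj
      filter_upwards [hj] with x hx
      have : M.jumpNN σ F x = 0 := by
        simp_rw [jumpNN, nn_eq_sum, jump_sum, jump_const_mul, hx]
        simp
      simp [this]
  have hint : Integrable (fun x => ∑ i, (∑ j, D i j x j) * v x i) (volume.restrict Ω) :=
    integrable_finsetSum _ fun i _ => integrable_fun_mul (memLp_sum_coord fun j => (hσ i j).2.1)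
      (memLp_coord hv.1.1 i)
  rw [formB2, hfac, sub_zero, setIntegral_eq_sum (M := M) hΩ fun s hs => hint.mono_measure
    (Measure.restrict_mono (openHull_subset hΩ hs) le_rfl)]
  refine Finset.sum_congr rfl fun s hs => integral_congr_ae ?_
  have h1 : ∀ i, ∀ᵐ x ∂(volume.restrict (openHull s)),
      matDiv (openHull s) σ x i = ∑ j, D i j x j := fun i =>
    MCS.weakDiv_ae_eq_sum (v := row σ i) (isOpen_openHull s) fun j =>
      (hσ i j).mono (isOpen_openHull s).measurableSet (openHull_subset hΩ hs)
  filter_upwards [ae_all_iff.2 h1] with x hx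
  simp_rw [inner_eq_sum, hx]

/-! ### Traces in `H¹₀` -/

lemma tendsto_trace (hd : 0 < d) (hΩ : IsLipschitzDomain Ω) {w : Eu d → ℝ} {φ : ℕ → Eu d → ℝ}
    (hφ : ∀ n, IsTest Ω (φ n)) (h : TendstoH1 Ω φ w) {s F : Finset (Eu d)}
    (hs : s ∈ M.elements) (hF : F ∈ M.facets) (hFs : F ⊆ s) :
    MemLp (trace s F w) 2 (surf F) ∧
      Tendsto (fun n => eLpNorm (fun x => φ n x - trace s F w x) 2 (surf F)) atTop (𝓝 0) := by
  have hm := h.mono (isOpen_openHull s).measurableSet (openHull_subset hΩ hs)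
  obtain ⟨G, hG, -⟩ := id hm
  have ht := isTrace_trace hd hs hF hFs hG
  refine ⟨ht.1, ?_⟩
  obtain ⟨v, rfl⟩ := exists_eq_erase hs hF hFs
  exact (isSimplex hs).tendsto_isTrace hd v ht (fun n => (hφ n).contDiff_one) hm

/-- The restrictions to `F` of one sequence of test functions converge to both traces. -/
lemma trace_ae_eq_trace (hd : 0 < d) (hΩ : IsLipschitzDomain Ω) {w : Eu d → ℝ}
    (h : MemH10 Ω w) {s t F : Finset (Eu d)} (hs : s ∈ M.elements) (ht : t ∈ M.elements)
    (hF : F ∈ M.facets) (hFs : F ⊆ s) (hFt : F ⊆ t) : trace s F w =ᵐ[surf F] trace t F w := by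
  obtain ⟨φ, hφ, hφw⟩ := h
  obtain ⟨h1, h2⟩ := tendsto_trace hd hΩ hφ hφw hs hF hFs
  obtain ⟨h3, h4⟩ := tendsto_trace hd hΩ hφ hφw ht hF hFt
  exact ae_eq_of_tendsto_eLpNorm (fun n => (hφ n).1.continuous.aestronglyMeasurable) h1 h3 h2 h4

/-- Test functions on the open set `Ω` vanish on its frontier, hence so does their limit in `L²(F)`.
-/
lemma trace_ae_eq_zero (hd : 0 < d) (hΩ : IsLipschitzDomain Ω) {w : Eu d → ℝ}
    (h : MemH10 Ω w) {s F : Finset (Eu d)} (hs : s ∈ M.elements)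
    (hF : F ∈ M.facets) (hFs : F ⊆ s) (hfr : hull F ⊆ frontier Ω) :
    trace s F w =ᵐ[surf F] fun _ => 0 := by
  obtain ⟨φ, hφ, hφw⟩ := h
  obtain ⟨h1, h2⟩ := tendsto_trace hd hΩ hφ hφw hs hF hFs
  refine ae_eq_of_tendsto_eLpNorm (fun n => (hφ n).1.continuous.aestronglyMeasurable) h1
    MemLp.zero' h2 (tendsto_const_nhds.congr fun n => ?_)
  rw [eLpNorm_congr_ae (g := fun _ => (0 : ℝ)), eLpNorm_zero']
  filter_upwards [ae_surf_mem F] with x hx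
  have hx' : x ∉ Ω := fun h' => by
    have := hfr hx
    rw [frontier, hΩ.isOpen.interior_eq] at this
    exact this.2 h'
  simp [(hφ n).eq_zero hx']

/-- The discrete stresses satisfy the weak form of the constitutive law. -/
lemma integral_add_formB2 (hd : 0 < d) (hΩ : IsLipschitzDomain Ω) {k : ℕ} {τ : Eu d → Mat d}
    (hτ : MemSigmaH M k τ) {u : Eu d → Eu d} (hu : ∀ i, MemH10 Ω fun x => u x i)
    {B : Eu d → Mat d} (hB : ∀ i, IsH1Grad Ω (fun x => u x i) (row B i)) :
    (∫ x in Ω, frob (B x) (τ x)) + formB2 M τ u = 0 := by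
  choose ψ hψ hτψ using fun i j => (hτ.poly i j).exists_contDiff
  have hψ1 : ∀ i j s, ContDiff ℝ 1 (ψ i j s) := fun i j s => (hψ i j s).of_le (by simp)
  have hBs : ∀ i, ∀ s ∈ M.elements, IsH1Grad (openHull s) (fun x => u x i) (row B i) :=
    fun i s hs => (hB i).mono (isOpen_openHull s).measurableSet (openHull_subset hΩ hs)
  have hm : ∀ i j, ∀ s ∈ M.elements, MemLp (fun x => B x i j) 2 (volume.restrict (openHull s)) :=
    fun i j s hs => memLp_coord (hBs i s hs).2.1 j
  have hbp : ∀ i j, ∑ s ∈ M.elements, ∫ x in openHull s,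
      (u x i * gradient (ψ i j s) x j + B x i j * ψ i j s x) =
      ∑ F ∈ M.facets, M.normal F j * ∫ y, M.jump F
        (fun s => trace s F (fun x => u x i) y * ψ i j s y) ∂(surf F) := by
    intro i j
    have hbp := M.sum_integral_by_parts hd (hBs i) (hψ1 i j) (EuclideanSpace.single j 1)
    simp only [← gradient_apply, EuclideanSpace.inner_single_right, one_mul,
      RCLike.conj_to_real] at hbp
    exact hbp
  have hfrob : ∀ s ∈ M.elements, ∀ x ∈ openHull s,
      frob (B x) (τ x) = ∑ i, ∑ j, B x i j * ψ i j s x := fun s hs x hx => by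
    simp only [frob]
    exact Finset.sum_congr rfl fun i _ => Finset.sum_congr rfl fun j _ => by
      rw [hτψ i j s hs x hx]
  have hI1 : ∀ s ∈ M.elements, Integrable (fun x => ∑ i, ∑ j, B x i j * ψ i j s x)
      (volume.restrict (openHull s)) := fun s hs =>
    integrable_finsetSum _ fun i _ => integrable_finsetSum _ fun j _ =>
      integrable_fun_mul (hm i j s hs) (memLp_openHull s (hψ1 i j s).continuous)
  have hI2 : ∀ s ∈ M.elements, Integrable (fun x => ∑ i, ∑ j, u x i * gradient (ψ i j s) x j)
      (volume.restrict (openHull s)) := fun s hs =>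
    integrable_finsetSum _ fun i _ => integrable_finsetSum _ fun j _ =>
      integrable_fun_mul (hBs i s hs).1
        (memLp_coord (memLp_openHull s (continuous_gradient (hψ1 i j s))) j)
  have hfae : ∀ s ∈ M.elements, (fun x => frob (B x) (τ x)) =ᵐ[volume.restrict (openHull s)]
      fun x => ∑ i, ∑ j, B x i j * ψ i j s x := fun s hs => by
    filter_upwards [ae_restrict_mem (isOpen_openHull s).measurableSet] with x hx
    exact hfrob s hs x hx
  have hdae : ∀ s ∈ M.elements, (fun x => ⟪matDiv (openHull s) τ x, u x⟫_ℝ)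
      =ᵐ[volume.restrict (openHull s)] fun x => ∑ i, ∑ j, u x i * gradient (ψ i j s) x j := by
    intro s hs
    have h1 : ∀ i, ∀ᵐ x ∂(volume.restrict (openHull s)),
        matDiv (openHull s) τ x i = ∑ j, gradient (ψ i j s) x j := fun i =>
      MCS.weakDiv_ae_eq_sum (v := row τ i) (isOpen_openHull s) fun j =>
        isH1Grad_of_eq (hψ i j s) (hτψ i j s hs)
    filter_upwards [ae_all_iff.2 h1] with x hx
    simp_rw [inner_eq_sum, hx, Finset.sum_mul]
    exact Finset.sum_congr rfl fun i _ => Finset.sum_congr rfl fun j _ => mul_comm _ _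
  have hvol : (∫ x in Ω, frob (B x) (τ x)) +
      ∑ s ∈ M.elements, ∫ x in openHull s, ⟪matDiv (openHull s) τ x, u x⟫_ℝ =
      ∑ i, ∑ j, ∑ s ∈ M.elements, ∫ x in openHull s,
        (u x i * gradient (ψ i j s) x j + B x i j * ψ i j s x) := by
    rw [setIntegral_eq_sum (M := M) hΩ fun s hs => (hI1 s hs).congr (hfae s hs).symm,
      ← Finset.sum_add_distrib]
    simp_rw [Finset.sum_comm (t := M.elements)]
    refine Finset.sum_congr rfl fun s hs => ?_
    rw [integral_congr_ae (hfae s hs), integral_congr_ae (hdae s hs), add_comm,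
      ← integral_add (hI2 s hs) (hI1 s hs)]
    simp_rw [← Finset.sum_add_distrib]
    have hI : ∀ i j, Integrable (fun x => u x i * gradient (ψ i j s) x j + B x i j * ψ i j s x)
        (volume.restrict (openHull s)) := fun i j =>
      (integrable_fun_mul (hBs i s hs).1
        (memLp_coord (memLp_openHull s (continuous_gradient (hψ1 i j s))) j)).add
      (integrable_fun_mul (hm i j s hs) (memLp_openHull s (hψ1 i j s).continuous))
    rw [integral_finsetSum _ fun i _ => integrable_finsetSum _ fun j _ => hI i j]
    exact Finset.sum_congr rfl fun i _ => integral_finsetSum _ fun j _ => hI i j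
  have hfac : ∑ F ∈ M.facets, ∫ x, M.jumpNN τ F x * M.normalTrace u F x ∂(surf F) =
      ∑ i, ∑ j, ∑ F ∈ M.facets, M.normal F j * ∫ y, M.jump F
        (fun s => trace s F (fun x => u x i) y * ψ i j s y) ∂(surf F) := by
    simp_rw [Finset.sum_comm (t := M.facets)]
    refine Finset.sum_congr rfl fun F hF => ?_
    have := isFiniteMeasure_surf hd hF
    have hI : ∀ i j, Integrable (fun y => M.normal F j * M.jump F
        fun s => trace s F (fun x => u x i) y * ψ i j s y) (surf F) := fun i j =>
      (integrable_jump hF fun s hs hFs => integrable_fun_mul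
        (isTrace_trace hd hs hF hFs (hBs i s hs)).1 (memLp_surf (hψ1 i j s).continuous)).const_mul _
    simp_rw [← integral_const_mul]
    rw [Finset.sum_congr rfl fun i _ => (integral_finsetSum _ fun j _ => hI i j).symm,
      ← integral_finsetSum _ fun i _ => integrable_finsetSum _ fun j _ => hI i j]
    have hu1 : ∀ i, ∀ s ∈ M.elements, ∀ᵐ y ∂(surf F), F ⊆ s →
        trace s F (fun x => u x i) y = trace (M.plus F) F (fun x => u x i) y := by
      intro i s hs
      by_cases hFs : F ⊆ s
      · filter_upwards [trace_ae_eq_trace hd hΩ (hu i) hs (plus_mem hF) hF hFs (subset_plus hF)]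
          with y hy _ using hy
      · exact Eventually.of_forall fun y h => absurd h hFs
    have hτ1 : ∀ i j, ∀ s ∈ M.elements, ∀ᵐ y ∂(surf F), F ⊆ s →
        traceM s F τ y i j = ψ i j s y := by
      intro i j s hs
      by_cases hFs : F ⊆ s
      · obtain ⟨v, rfl⟩ := exists_eq_erase hs hF hFs
        have := (isSimplex hs).trace_ae_eq hd v
          ((isSimplex hs).isTrace_of_eq hd v (hψ i j s) (hτψ i j s hs))
        filter_upwards [this] with y hy _ using hy
      · exact Eventually.of_forall fun y h => absurd h hFs
    -- This is where the choice of spaces matters: continuity of `τ_nt` handles interior facets, and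
    -- the zero trace of `u` the others.
    have hnt : ∀ᵐ y ∂(surf F), ⟪traceV (M.plus F) F u y, M.jumpNT τ F y⟫_ℝ = 0 := by
      by_cases hint : M.IsInteriorFacet F
      · filter_upwards [hτ.jump_nt F hint] with y hy
        rw [hy, inner_zero_right]
      · have hfr : hull F ⊆ frontier Ω := by
          by_contra h
          exact hint ⟨hF, h⟩
        have h1 : ∀ i, ∀ᵐ y ∂(surf F), trace (M.plus F) F (fun x => u x i) y = 0 := fun i =>
          trace_ae_eq_zero hd hΩ (hu i) (plus_mem hF) hF (subset_plus hF) hfr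
        filter_upwards [ae_all_iff.2 h1] with y hy
        simp [inner_eq_sum, traceV, hy]
    have hcount : (M.elements : Set (Finset (Eu d))).Countable := M.elements.countable_toSet
    have hu2 := ae_all_iff.2 fun i => (ae_ball_iff hcount).2 (hu1 i)
    have hτ2 := ae_all_iff.2 fun i => ae_all_iff.2 fun j => (ae_ball_iff hcount).2 (hτ1 i j)
    refine integral_congr_ae ?_
    filter_upwards [hu2, hτ2, hnt] with y hy1 hy2 hy3
    -- The trace of `u` is single-valued on `F`, so it factors out of the jump.
    have e1 : ∀ i j, M.jump F (fun s => trace s F (fun x => u x i) y * ψ i j s y) =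
        traceV (M.plus F) F u y i * M.jump F fun s => traceM s F τ y i j := by
      intro i j
      rw [← jump_const_mul]
      refine jump_congr hF fun s hs hFs => ?_
      rw [hy1 i s hs hFs, hy2 i j s hs hFs]
      rfl
    simp_rw [e1]
    have e2 : ∑ i, ∑ j, M.normal F j * (traceV (M.plus F) F u y i *
        M.jump F fun s => traceM s F τ y i j) =
        M.jump F fun s => ⟪traceV (M.plus F) F u y, mulV (traceM s F τ y) (M.normal F)⟫_ℝ := by
      simp_rw [inner_eq_sum, jump_sum, jump_const_mul]
      refine Finset.sum_congr rfl fun i _ => ?_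
      simp only [mulV, Matrix.mulVec, dotProduct]
      rw [jump_sum, Finset.mul_sum]
      refine Finset.sum_congr rfl fun j _ => ?_
      rw [jump_mul_const]
      ring
    rw [e2]
    -- Splitting `τ n` leaves the normal-normal term of `b₂` plus the tangential term killed by
    -- `hnt`.
    simp_rw [mulV_eq, inner_add_right, real_inner_smul_right]
    rw [jump_add, jump_mul_const, jump_inner]
    change _ = M.jumpNN τ F y * M.normalTrace u F y +
      ⟪traceV (M.plus F) F u y, M.jumpNT τ F y⟫_ℝ
    rw [hy3, add_zero]
  rw [formB2, ← add_sub_assoc, hvol, hfac, sub_eq_zero]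
  exact Finset.sum_congr rfl fun i _ => Finset.sum_congr rfl fun j _ => hbp i j

end Mesh

/-! ### Consistency -/

/-- Since `σ` is in `H¹`, its divergence is in `L²`, and the momentum equation reads `∇p = f + div
σ` with right-hand side in `L²`. This extra regularity makes `p` admissible in the definition of
`MemHDiv0`. -/
lemma isH1Grad_pressure {Ω : Set (Eu d)} {ν : ℝ} {f : Eu d → Eu d} {σ : Eu d → Mat d}
    {u : Eu d → Eu d} {p : Eu d → ℝ} (hsol : IsStokesSolution Ω ν f σ u p)
    (hf : MemLp f 2 (volume.restrict Ω)) (hp : MemLp p 2 (volume.restrict Ω))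
    {D : Fin d → Fin d → Eu d → Eu d} (hσ : ∀ i j, IsH1Grad Ω (fun x => σ x i j) (D i j)) :
    IsH1Grad Ω p fun x => WithLp.toLp 2 fun i => f x i + ∑ j, D i j x j := by
  have hD : ∀ i, MemLp (fun x => ∑ j, D i j x j) 2 (volume.restrict Ω) := fun i =>
    memLp_sum_coord fun j => (hσ i j).2.1
  refine ⟨hp, MemLp.of_eval_piLp fun i => (memLp_coord hf i).add (hD i), fun φ hφ i => ?_⟩
  have h1 := hsol.momentum φ hφ i
  have h2 := IsWeakGrad.isWeakDiv (v := row σ i) (fun j => hσ i j) φ hφ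
  simp only [add_mul]
  rw [integral_add (integrable_fun_mul (memLp_coord hf i) (hφ.memLp Ω))
    (integrable_fun_mul (hD i) (hφ.memLp Ω))]
  rw [h2] at h1
  linarith

/-- The constitutive law already names the gradient; only square integrability of the entries of
`dev σ` is to be checked. -/
lemma isH1Grad_velocity {Ω : Set (Eu d)} {ν : ℝ} {f : Eu d → Eu d} {σ : Eu d → Mat d}
    {u : Eu d → Eu d} {p : Eu d → ℝ} (hsol : IsStokesSolution Ω ν f σ u p)
    (hσ : ∀ i j, MemLp (fun x => σ x i j) 2 (volume.restrict Ω)) (i : Fin d)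
    (hu : MemLp (fun x => u x i) 2 (volume.restrict Ω)) :
    IsH1Grad Ω (fun x => u x i) (row (fun x => ν⁻¹ • dev (σ x)) i) := by
  refine ⟨hu, MemLp.of_eval_piLp fun j => ?_, hsol.constitutive i⟩
  have htr : MemLp (fun x => (σ x).trace) 2 (volume.restrict Ω) :=
    memLp_finsetSum _ fun i _ => hσ i i
  have h : MemLp (fun x => ν⁻¹ * (σ x i j - (1 : Mat d) i j / d * (σ x).trace)) 2
      (volume.restrict Ω) := ((hσ i j).sub (htr.const_mul _)).const_mul _
  convert h using 2 with x
  simp only [row, dev, Matrix.smul_apply, Matrix.sub_apply, smul_eq_mul]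
  ring

lemma ae_exists_mem_openHull {Ω : Set (Eu d)} (hΩ : IsLipschitzDomain Ω) (M : Mesh Ω) :
    ∀ᵐ x ∂(volume.restrict Ω), ∃ s ∈ M.elements, x ∈ openHull s := by
  filter_upwards [ae_restrict_mem hΩ.isOpen.measurableSet,
    ae_restrict_of_ae (Mesh.iUnion_openHull_ae_eq (M := M) hΩ).mem_iff] with x hx h
  simpa using h.2 hx

/-- The discrete stress is trace-free on the open elements, hence almost everywhere, so its deviator
can be dropped. -/
lemma formA_eq_integral {Ω : Set (Eu d)} (hΩ : IsLipschitzDomain Ω) {M : Mesh Ω} {k : ℕ}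
    {τ : Eu d → Mat d} (hτ : MemSigmaH M k τ) (ν : ℝ) (σ : Eu d → Mat d) :
    formA Ω ν σ τ = ∫ x in Ω, frob (ν⁻¹ • dev (σ x)) (τ x) := by
  refine integral_congr_ae ?_
  filter_upwards [ae_exists_mem_openHull hΩ M] with x hx
  obtain ⟨s, hs, hxs⟩ := hx
  rw [dev_eq_self (hτ.trace_zero s hs x hxs)]
  simp only [frob, Finset.mul_sum, Matrix.smul_apply, smul_eq_mul, mul_assoc]

lemma formB1_eq_zero {Ω : Set (Eu d)} (hΩ : IsOpen Ω) {u : Eu d → Eu d} (hu : IsWeakDiv Ω u 0)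
    (q : Eu d → ℝ) : formB1 Ω u q = 0 := by
  refine integral_eq_zero_of_ae ?_
  filter_upwards [weakDiv_ae_eq hΩ MemLp.zero hu] with x hx
  simp [hx]

end MCS

end

/-! ### The consistency identity -/

theorem mainTheorem9 (d : ℕ) (hd : d = 2 ∨ d = 3)
    (Ω : Set (MCS.Eu d)) (hΩ : MCS.IsLipschitzDomain Ω) (M : MCS.Mesh Ω)
    (k : ℕ) (hk : 1 ≤ k) (ν : ℝ) (hν : 0 < ν)
    (f : MCS.Eu d → MCS.Eu d) (hf : MemLp f 2 (volume.restrict Ω))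
    (σ : MCS.Eu d → MCS.Mat d) (u : MCS.Eu d → MCS.Eu d) (p : MCS.Eu d → ℝ)
    (hsol : MCS.IsStokesSolution Ω ν f σ u p)
    (hu : ∀ i, MCS.MemH1 Ω fun x => u x i)
    (hσ : ∀ i j, MCS.MemH1 Ω fun x => σ x i j)
    (hp : MCS.MemL20 Ω p) :
    ∀ (τh : MCS.Eu d → MCS.Mat d) (vh : MCS.Eu d → MCS.Eu d) (qh : MCS.Eu d → ℝ),
      MCS.MemSigmaH M k τh → MCS.MemVH M k vh → MCS.MemQH M k qh →
      MCS.formA Ω ν σ τh + MCS.formB2 M τh u + MCS.formB2 M σ vh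
          + MCS.formB1 Ω vh p + MCS.formB1 Ω u qh
        = -∫ x in Ω, inner ℝ (f x) (vh x) := by
  intro τh vh qh hτ hv _
  have hd0 : 0 < d := by omega
  choose D hD using hσ
  choose ψ hψ hvψ using fun i => (hv.1 i).exists_contDiff
  have hDL : ∀ i, MemLp (fun x => ∑ j, D i j x j) 2 (volume.restrict Ω) := fun i =>
    MCS.memLp_sum_coord fun j => (hD i j).2.1
  have h1 : MCS.formA Ω ν σ τh + MCS.formB2 M τh u = 0 := by
    rw [MCS.formA_eq_integral hΩ hτ]
    exact MCS.Mesh.integral_add_formB2 hd0 hΩ hτ hsol.boundary fun i =>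
      MCS.isH1Grad_velocity hsol (fun i j => (hD i j).1) i (hu i).choose_spec.1
  have h2 : MCS.formB2 M σ vh = ∫ x in Ω, ∑ i, (∑ j, D i j x j) * vh x i :=
    MCS.Mesh.formB2_eq_integral hd0 hΩ hD
      (fun i s hs => MCS.isH1Grad_of_eq (hψ i s) (hvψ i s hs)) hv.2
  -- Testing the vanishing normal trace of `vh` with the pressure gives `(vh, f + div σ) + (div vh,
  -- p) = 0`, the discrete momentum balance.
  have h3 := hv.2.2 p _ (MCS.isH1Grad_pressure hsol hf hp.1 hD)
  have h4 : ∫ x in Ω, inner ℝ (vh x)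
      (WithLp.toLp 2 fun i => f x i + ∑ j, D i j x j : MCS.Eu d) =
      (∫ x in Ω, inner ℝ (f x) (vh x)) + ∫ x in Ω, ∑ i, (∑ j, D i j x j) * vh x i := by
    rw [← integral_add (MCS.integrable_inner hf hv.2.1.1)
      (integrable_finsetSum _ fun i _ =>
        MCS.integrable_fun_mul (hDL i) (MCS.memLp_coord hv.2.1.1 i))]
    refine integral_congr_ae (Eventually.of_forall fun x => ?_)
    simp only [MCS.inner_eq_sum, ← Finset.sum_add_distrib]
    exact Finset.sum_congr rfl fun i _ => by ring
  rw [h1, h2, MCS.formB1_eq_zero hΩ.isOpen hsol.incompressible, MCS.formB1]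
  linarith
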